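/- **Circuits.** Let $\theta\in\mathbb R$. We consider quantum circuits with fan-out over the fixed basis consisting of the Hadamard gate $H$, the rotation $R_z(\theta)=|0\rangle\langle 0|+e^{i\theta}|1\rangle\langle 1|$, its inverse $R_z(-\theta)$, and the unbounded fan-out gate $|y_1\rangle\cdots|y_k\rangle|x\rangle\mapsto|y_1\oplus x\rangle\cdots|y_k\oplus x\rangle|x\rangle$, $k\ge 0$ (for $k=1$ this is the controlled-not gate). A circuit is a sequence of layers; the gates of one layer act on pairwise disjoint sets of qubits. The depth is the number of layers, the size of a gate is the number of qubits it affects, and the size of a circuit is the sum of the sizes of its gates. A family of circuits has, for every $n$, one circuit $C_n$ acting on $n$ input qubits, one output qubit and some number of ancilla qubits, which start in $|0\rangle$. The family is uniform if some Turing machine with a read-only input tape and a write-only output tape, using $O(\log n)$ cells of its work tapes, writes a description of $C_n$ on input $1^n$. **Approximation.** Let $g:\{0,1\}^n\to\{0,1\}$ and let $G$ be the gate $|x\rangle|y\rangle\mapsto|x\rangle|y\oplus g(x)\rangle$. A circuit $C$ with $a$ ancillas approximates $G$ with one-sided error $\varepsilon$ if (i) $C|x\rangle|y\rangle|0^a\rangle=|x\rangle|y\rangle|0^a\rangle$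 for all $x$ with $g(x)=0$ and all $y$, so that there is no error at all when $g(x)=0$; and (ii) for every normalised state $|\Psi\rangle$ of the $n+1$ input and output qubits, the final state $C|\Psi\rangle|0^a\rangle$ is the correct state up to error probability $\varepsilon$, that is, $\bigl|\bigl(\langle\Psi|G^\dagger\otimes\langle 0^a|\bigr)\,C\,|\Psi\rangle|0^a\rangle\bigr|^2\ge 1-\varepsilon$. **The class.** $\mathrm{R\text{-}QNC}_{\mathrm f}^0$ (over the basis with angle $\theta$) consists of the families $(g_n)_n$ such that for every constant $c\in\mathbb N$ there is a uniform family of circuits over the basis, of depth $O(1)$ and of size polynomial in $n$, whose $n$-th circuit approximates the gate of $g_n$ with one-sided error $n^{-c}$ for all $n\ge 1$. **Theorem.** There is a fixed angle $\theta$, an irrational multiple of $\pi$, such that for the basis with angle $\theta$ the following hold, where $\mathrm{Or}(x)=1$ iff the Hamming weight of $x$ is positive. 1. $\mathrm{Or}\in\mathrm{R\text{-}QNC}_{\mathrm f}^0$. 2. There is a uniform family of circuits over this basis, of depth $O(1)$ and size $O(n^2\log n)$, whose $n$-th circuit approximates the $\mathrm{Or}$ gate on $n$ input qubits with one-sided error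 $\frac1n$, for every $n\ge 1$. -/

import Mathlib

open Filter Asymptotics
open scoped Topology

namespace QCirc

/-! ### Gates, layers and circuits -/

/-- The available gates, on qubits labelled by `Q`: the Hadamard gate, the rotation `R_z(θ)` by a
fixed angle, its inverse `R_z(-θ)`, and the unbounded fan-out gate with control `c` and list of
targets `ts`. The controlled-not gate is the fan-out gate with one target. -/
inductive Gate (Q : Type) : Type
  | had (q : Q)
  | rot (q : Q)
  | rotInv (q : Q)
  | fanout (c : Q) (ts : List Q)

namespace Gate

/-- The qubits that a gate affects. -/
def qubits {Q : Type} : Gate Q → List Q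
  | had q => [q]
  | rot q => [q]
  | rotInv q => [q]
  | fanout c ts => c :: ts

/-- The size of a gate is the number of qubits it affects. -/
def size {Q : Type} (g : Gate Q) : ℕ := g.qubits.length

end Gate

/-- A (not necessarily normalised) pure state of the qubits labelled by `Q`: the vector of its
amplitudes in the computational basis. -/
abbrev State (Q : Type) : Type := (Q → Bool) → ℂ

/-- `R_z(α) = |0⟩⟨0| + e^{iα} |1⟩⟨1|` applied to qubit `q`. -/
noncomputable def applyRz {Q : Type} (α : ℝ) (q : Q) (ψ : State Q) : State Q :=
  fun b => (if b q then Complex.exp (α * Complex.I) else 1) * ψ b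

/-- `H = (1/√2) [[1, 1], [1, -1]]` applied to qubit `q`. -/
noncomputable def applyHad {Q : Type} [DecidableEq Q] (q : Q) (ψ : State Q) : State Q :=
  fun b => (1 / (Real.sqrt 2 : ℂ)) *
    (ψ (Function.update b q false) +
      (if b q then -1 else 1) * ψ (Function.update b q true))

/-- The classical action `y_j ↦ y_j ⊕ x` (for the targets `j`) of the fan-out gate, where `x` is
the control bit. -/
def fanoutBits {Q : Type} [DecidableEq Q] (c : Q) (ts : List Q) (b : Q → Bool) : Q → Bool :=
  fun q => if q ∈ ts then xor (b q) (b c) else b q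

/-- The linear action of a gate on states; `θ` is the rotation angle of the basis. The map
`fanoutBits c ts` is an involution if `c ∉ ts`, so composing the amplitudes with it maps the basis
state `|b⟩` to `|fanoutBits c ts b⟩`. -/
noncomputable def Gate.apply {Q : Type} [DecidableEq Q] (θ : ℝ) : Gate Q → State Q → State Q
  | .had q, ψ => applyHad q ψ
  | .rot q, ψ => applyRz θ q ψ
  | .rotInv q, ψ => applyRz (-θ) q ψ
  | .fanout c ts, ψ => fun b => ψ (fanoutBits c ts b)

/-- A layer is a collection of gates that are applied in parallel. -/
abbrev Layer (Q : Type) : Type := List (Gate Q)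

/-- No qubit occurs twice in a layer: the qubits of each gate are distinct, and different gates of
the layer act on disjoint sets of qubits. -/
def Layer.Valid {Q : Type} (l : Layer Q) : Prop := (l.flatMap Gate.qubits).Nodup

/-- A circuit is a sequence of layers. -/
abbrev Circuit (Q : Type) : Type := List (Layer Q)

namespace Circuit

variable {Q : Type}

def Valid (C : Circuit Q) : Prop := ∀ l ∈ C, Layer.Valid l

/-- The depth is the number of layers. -/
def depth (C : Circuit Q) : ℕ := C.length

/-- The size is the total size of all gates. -/
def size (C : Circuit Q) : ℕ := (C.flatten.map Gate.size).sum

/-- The operator computed by a circuit: the layers are applied in order, the first one first.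
(The gates of one layer of a valid circuit commute.) -/
noncomputable def run [DecidableEq Q] (θ : ℝ) (C : Circuit Q) (ψ : State Q) : State Q :=
  C.flatten.foldl (fun φ g => Gate.apply θ g φ) ψ

end Circuit

/-! ### Computing a Boolean function with one-sided error -/

/-- The Hamming weight. -/
def weight {n : ℕ} (x : Fin n → Bool) : ℕ := (Finset.univ.filter fun i => x i = true).card

/-- The Boolean function of the Or gate. -/
def orFun (n : ℕ) (x : Fin n → Bool) : Bool := decide (0 < weight x)

/-- The `(n+1)`-qubit gate `|x⟩|y⟩ ↦ |x⟩|y ⊕ g(x)⟩`; the qubits `0, …, n-1` hold `x`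
and the last qubit holds `y`. -/
def gateOf {n : ℕ} (g : (Fin n → Bool) → Bool) (Ψ : State (Fin (n + 1))) :
    State (Fin (n + 1)) :=
  fun b => Ψ (Function.update b (Fin.last n)
    (xor (b (Fin.last n)) (g (fun i => b i.castSucc))))

/-- The state `|Ψ⟩|0^a⟩`: `a` ancilla qubits are added, in state `|0⟩`. -/
def withAncillas {m : ℕ} (a : ℕ) (Ψ : State (Fin m)) : State (Fin (m + a)) :=
  fun b => if ∀ j : Fin a, b (Fin.natAdd m j) = false
    then Ψ (fun i => b (Fin.castAdd a i)) else 0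

/-- The computational basis state `|b⟩`. -/
def ket {m : ℕ} (b : Fin m → Bool) : State (Fin m) := Pi.single b 1

/-- The probability `|⟨φ|ψ⟩|²` that the state `ψ` is found to be the state `φ`. -/
noncomputable def fidelity {m : ℕ} (φ ψ : State (Fin m)) : ℝ :=
  ‖∑ b, (starRingEnd ℂ) (φ b) * ψ b‖ ^ 2

/-- The circuit `C`, which acts on `n` input qubits, an output qubit and `a` ancilla qubits that
start in `|0⟩`, approximates the gate `|x⟩|y⟩ ↦ |x⟩|y ⊕ g(x)⟩` with one-sided error `ε`:
on inputs with `g(x) = 0` it makes no error at all, and on every pure input state the final state,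
ancillas included, is the correct one (with clean ancillas) up to an error probability `ε`. -/
def ApproxOneSided (θ : ℝ) {n a : ℕ} (C : Circuit (Fin (n + 1 + a)))
    (g : (Fin n → Bool) → Bool) (ε : ℝ) : Prop :=
  (∀ b : Fin (n + 1) → Bool, g (fun i => b i.castSucc) = false →
    C.run θ (withAncillas a (ket b)) = withAncillas a (ket b)) ∧
  (∀ Ψ : State (Fin (n + 1)), ∑ b, ‖Ψ b‖ ^ 2 = 1 →
    1 - ε ≤ fidelity (withAncillas a (gateOf g Ψ)) (C.run θ (withAncillas a Ψ)))

/-! ### Descriptions of circuits -/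

/-- The alphabet in which circuits are described. -/
inductive Token : Type
  | bit (b : Bool)
  | endNum
  | had
  | rot
  | rotInv
  | fanout
  | endLayer

/-- A number in binary, least significant bit first, with an end mark. -/
def describeNum (k : ℕ) : List Token := k.bits.map Token.bit ++ [Token.endNum]

def describeGate {N : ℕ} : Gate (Fin N) → List Token
  | .had q => Token.had :: describeNum q
  | .rot q => Token.rot :: describeNum q
  | .rotInv q => Token.rotInv :: describeNum q
  | .fanout c ts => Token.fanout :: (describeNum c ++ ts.flatMap fun t => describeNum t)

def describeLayer {N : ℕ} (l : Layer (Fin N)) : List Token :=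
  l.flatMap describeGate ++ [Token.endLayer]

/-- The number of qubits, followed by the layers. -/
def describe {N : ℕ} (C : Circuit (Fin N)) : List Token :=
  describeNum N ++ C.flatMap describeLayer

/-! ### Log-space Turing machines -/

/-- Head movements. -/
inductive Move : Type
  | left
  | stay
  | right

/-- The new position of a head on a one-way infinite tape; at the left end, a left move has no
effect. -/
def Move.apply : Move → ℕ → ℕ
  | left, p => p - 1
  | stay, p => p
  | right, p => p + 1

/-- The symbols on the read-only input tape, which holds `1^n` between two end markers. -/
inductive InSym : Type
  | leftEnd
  | one
  | rightEnd

def inputSym (n p : ℕ) : InSym :=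
  if p = 0 then .leftEnd else if p ≤ n then .one else .rightEnd

/-- What a machine with states `S`, work alphabet `Γ` and `k` work tapes does in one step. -/
structure Action (S Γ : Type) (k : ℕ) : Type where
  next : S
  inMove : Move
  write : Fin k → Γ
  move : Fin k → Move
  emit : Option Token

/-- A deterministic Turing machine with a two-way read-only input tape, `k` work tapes and a
one-way write-only output tape. It halts where the transition function is undefined. -/
structure Machine : Type 1 where
  S : Type
  Γ : Type
  finS : Finite S
  finΓ : Finite Γ
  k : ℕ
  start : S
  blank : Γ
  transition : S → InSym → (Fin k → Γ) → Option (Action S Γ k)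

namespace Machine

structure Config (M : Machine) : Type where
  state : M.S
  inPos : ℕ
  work : Fin M.k → ℕ → M.Γ
  pos : Fin M.k → ℕ
  out : List Token

variable (M : Machine)

def startConfig : M.Config where
  state := M.start
  inPos := 0
  work := fun _ _ => M.blank
  pos := fun _ => 0
  out := []

/-- One step on input `1^n`; the input head stays between the end markers at `0` and `n + 1`. -/
def step (n : ℕ) (c : M.Config) : Option M.Config :=
  (M.transition c.state (inputSym n c.inPos) (fun i => c.work i (c.pos i))).map fun r =>
    { state := r.next
      inPos := min (r.inMove.apply c.inPos) (n + 1)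
      work := fun i => Function.update (c.work i) (c.pos i) (r.write i)
      pos := fun i => (r.move i).apply (c.pos i)
      out := c.out ++ r.emit.toList }

def Reachable (n : ℕ) (c : M.Config) : Prop :=
  Relation.ReflTransGen (fun c d => M.step n c = some d) M.startConfig c

/-- On input `1^n` the machine halts with output `w`. -/
def Outputs (n : ℕ) (w : List Token) : Prop :=
  ∃ c, M.Reachable n c ∧ M.step n c = none ∧ c.out = w

/-- On input `1^n` the machine uses `O(log n)` cells of its work tapes. -/
def LogSpace : Prop :=
  ∃ s : ℕ, ∀ n c, M.Reachable n c → ∀ i, c.pos i ≤ s * (Nat.log 2 n + 1)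

end Machine

/-! ### Circuit families and the circuit class -/

/-- A family of circuits, one for every input size `n`, on `n` input qubits, one output qubit and
`anc n` ancilla qubits. -/
structure Family : Type where
  anc : ℕ → ℕ
  circ : ∀ n, Circuit (Fin (n + 1 + anc n))
  valid : ∀ n, (circ n).Valid

/-- A log-space Turing machine generates the description of the `n`-th circuit from `1^n`. -/
def Family.Uniform (F : Family) : Prop :=
  ∃ M : Machine, M.LogSpace ∧ ∀ n, M.Outputs n (describe (F.circ n))

/-- `R-QNC_f^k` over the basis with rotation angle `θ`: the functions `g` (identified with the
gates `|x⟩|y⟩ ↦ |x⟩|y ⊕ g(x)⟩`) such that, for every constant `c`, a uniform family of circuits with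
fan-out of depth `O(log^k n)` and polynomial size approximates `g` with one-sided error `n^{-c}`. -/
def RQNCf (θ : ℝ) (k : ℕ) (g : ∀ n, (Fin n → Bool) → Bool) : Prop :=
  ∀ c : ℕ, ∃ F : Family, F.Uniform ∧
    (fun n => ((F.circ n).depth : ℝ)) =O[atTop] (fun n : ℕ => Real.log n ^ k) ∧
    (∃ p : ℕ, (fun n => ((F.circ n).size : ℝ)) =O[atTop] (fun n : ℕ => (n : ℝ) ^ p)) ∧
    ∀ n, 1 ≤ n → ApproxOneSided θ (F.circ n) (g n) (1 / (n : ℝ) ^ c)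

end QCirc

/-! Let w be the Hamming weight of the input. A fresh qubit that passes through a Hadamard gate, a
phase exp(±iθw·2^j) whose sign is given by its bit, and another Hadamard gate is found in the state
zero with amplitude cos(θw·2^j). For w = 0 nothing happens at all; this makes the error one-sided.
For w > 0 the doubling formula gives ∏_{j<m} cos(θw·2^j) = sin(θw·2^m) / (2^m sin(θw)), so m such
qubits are all zero with probability at most 4^(-m) / sin²(θw) (`prod_cos_sq_le`). One angle serves
all w if θ/π is badly approximable, for then |sin(θw)| ≥ 1/(64w).

A `Stage` implements the phase in constant depth: z is fanned out to copies, the copies are rotated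
by θ, negated by the inputs, rotated by -θ and cleared. Each copy met by an input that is one
contributes exp(±iθ), every other copy contributes 1. Stage A takes the n inputs to W·M qubits: M =
log n + O(1) values of j make the probability of all zeros at most 1/4, and W repetitions make it
4^(-W). Stage B takes these to W qubits, with error about (W·M)²/4^W. Here W is of order log n.

The Or of the last W qubits y is a matter of counting. If y is not zero, exactly half of the 2^W
subsets have odd parity on y; if y is zero, none has (`card_odd`). Rotating the output qubit by 2θ
for each odd subset (`Parities`) gives the phase exp(iθ·2^W) or 1. The former is close to -1 if
θ·2^W is close to an odd multiple of π. For θ = π·∑ 2^(-3·2^i) this holds whenever W = 3·2^i,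
because the next binary digit is so far away (`cos_angle_pow_le`). Hadamard gates on the output
qubit turn the controlled sign into a negation, and the inverse stages clear the ancillas. Because
the stages are unitary and commute with the ideal controlled sign, the overlap with the correct
state is an average of signs times phases over the outcomes after stage B (`inn_target`,
`overlap_ge`).

The same number ∑ 2^(-3·2^i) is badly approximable by a folding argument: a good approximation at
denominator q² yields one at denominator q (`kem_fold`, `kempner_bad`).

Size: the depth is constant, so the size is at most a constant times the number of qubits used. For
error 1/n it is dominated by the roughly n·2^M·W copies of stage A, that is O(n² log n).

Uniformity: each qubit has a binary address whose digits are distributed over fields by a list of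
O(log n) labels. Whether a qubit belongs to a layer, and which pairs are control and target, is
decided by a finite automaton reading the digits once (`Track`, `Monitor`). A machine whose tape
holds the labels and two addresses can therefore write every layer in a double loop over addresses
(`writer_outputs`). -/

namespace QCirc

/-! ### A badly approximable number with sparse binary digits -/

/-- The denominators `2 ^ (3 * 2 ^ i)`. -/
def kemDen (i : ℕ) : ℤ := 2 ^ (3 * 2 ^ i)

/-- The numerators of the partial sums of `∑ 2 ^ (-3 * 2 ^ i)`. -/
def kemNum : ℕ → ℤ
  | 0 => 1
  | i + 1 => kemNum i * kemDen i + 1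

/-- The partial sums of `∑ 2 ^ (-3 * 2 ^ i)`. -/
noncomputable def kemSum (i : ℕ) : ℝ := kemNum i / kemDen i

/-- The number `∑ 2 ^ (-3 * 2 ^ i)`. -/
noncomputable def kempner : ℝ := ⨆ i, kemSum i

lemma kemDen_zero : kemDen 0 = 8 := by norm_num [kemDen]

lemma kemDen_succ (i : ℕ) : kemDen (i + 1) = kemDen i ^ 2 := by
  simp only [kemDen]
  rw [← pow_mul]
  congr 1
  ring

lemma kemDen_ge (i : ℕ) : 8 ≤ kemDen i := by
  induction i with
  | zero => simp [kemDen_zero]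
  | succ i ih => rw [kemDen_succ]; nlinarith

lemma kemDen_pos (i : ℕ) : 0 < kemDen i := lt_of_lt_of_le (by norm_num) (kemDen_ge i)

lemma eight_dvd_kemDen (i : ℕ) : 8 ∣ kemDen i := by
  induction i with
  | zero => simp [kemDen_zero]
  | succ i ih => rw [kemDen_succ, sq]; exact Dvd.dvd.mul_right ih _

/-- Oddness is used twice: numerators are coprime to the denominators, and `angle` times a
denominator is nearly an odd multiple of π. -/
lemma kemNum_odd (i : ℕ) : Odd (kemNum i) := by
  cases i with
  | zero => simp [kemNum]
  | succ i =>
    obtain ⟨k, hk⟩ := eight_dvd_kemDen i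
    refine ⟨kemNum i * (4 * k), ?_⟩
    simp only [kemNum, hk]
    ring

lemma lt_kemDen (i : ℕ) : (i : ℤ) < kemDen i := by
  induction i with
  | zero => simp [kemDen_zero]
  | succ i ih =>
    have := kemDen_ge i
    rw [kemDen_succ]
    push_cast
    nlinarith

/-- The passage from level q to level q². The essential content of the invariant is |a·s| ≥ q/128.
Replacing s by a + q·s costs a² in the product, and the surplus 256·(a² + s²) in the hypothesis,
scaled by q², pays for it and for the new surplus. -/
lemma kem_fold_aux {q a s : ℤ} (hq : 8 ≤ q) (ha0 : a ≠ 0) (hs : 8 * |s| ≤ q)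
    (h : q ^ 2 + 256 * (a ^ 2 + s ^ 2) ≤ 128 * |a * s| * q) :
    (q ^ 2) ^ 2 + 256 * (a ^ 2 + (a + q * s) ^ 2) ≤ 128 * |a * (a + q * s)| * q ^ 2 := by
  have h1 : |a| * (q * |s| - |a|) ≤ |a * (a + q * s)| := by
    rw [abs_mul]
    apply mul_le_mul_of_nonneg_left _ (abs_nonneg a)
    have := abs_sub_abs_le_abs_sub (q * s) (-a)
    rw [abs_mul, abs_neg, abs_of_nonneg (by linarith : 0 ≤ q)] at this
    have e : q * s - -a = a + q * s := by ring
    rwa [e] at this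
  have hA : 1 ≤ |a| := Int.one_le_abs ha0
  have hS : 0 ≤ |s| := abs_nonneg s
  rw [abs_mul] at h
  have hsa : a * s ≤ |a| * |s| := by rw [← abs_mul]; exact le_abs_self _
  have e1 : a ^ 2 = |a| ^ 2 := (sq_abs a).symm
  have e2 : s ^ 2 = |s| ^ 2 := (sq_abs s).symm
  have e3 : (a + q * s) ^ 2 = a ^ 2 + 2 * q * (a * s) + q ^ 2 * s ^ 2 := by ring
  rw [e3, e1, e2]
  rw [e1, e2] at h
  clear e1 e2 e3
  generalize |a| = A at *
  generalize |s| = B at *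
  have h2 : 128 * (A * (q * B - A)) * q ^ 2 ≤ 128 * |a * (a + q * s)| * q ^ 2 := by
    apply mul_le_mul_of_nonneg_right _ (by positivity)
    linarith
  have h3 : q ^ 2 * (q ^ 2 + 256 * (A ^ 2 + B ^ 2)) ≤ q ^ 2 * (128 * (A * B) * q) :=
    mul_le_mul_of_nonneg_left h (by positivity)
  have h4 : 512 * q * (a * s) ≤ 512 * q * (A * B) :=
    mul_le_mul_of_nonneg_left hsa (by linarith)
  have h5 : q * A * (8 * B) ≤ q * A * q := mul_le_mul_of_nonneg_left hs (by positivity)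
  have h6 : q ^ 2 * A ≤ q ^ 2 * A ^ 2 := by
    apply mul_le_mul_of_nonneg_left _ (by positivity)
    nlinarith
  have h7 : 64 * A ^ 2 ≤ q ^ 2 * A ^ 2 := by
    apply mul_le_mul_of_nonneg_right _ (by positivity)
    nlinarith
  nlinarith

/-- If neither number is small compared with q, the product exceeds q²/64 already, and no folding is
needed. -/
lemma kem_fold_large {q w N : ℤ} (hq : 8 ≤ q) (hw : q < 8 * |w|) (hN : q < 8 * |N|)
    (hw' : 8 * |w| ≤ q ^ 2) (hN' : 8 * |N| ≤ q ^ 2) :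
    (q ^ 2) ^ 2 + 256 * (w ^ 2 + N ^ 2) ≤ 128 * |w * N| * q ^ 2 := by
  rw [abs_mul, ← sq_abs w, ← sq_abs N]
  have hA : 1 ≤ |w| := by linarith
  have hB : 1 ≤ |N| := by linarith
  generalize |w| = A at *
  generalize |N| = B at *
  have h1 : q ^ 2 ≤ 64 * (A * B) := by nlinarith
  have h2 : q ^ 2 * q ^ 2 ≤ q ^ 2 * (64 * (A * B)) :=
    mul_le_mul_of_nonneg_left h1 (by positivity)
  have h3 : A * (8 * A) ≤ A * q ^ 2 := mul_le_mul_of_nonneg_left hw' (by positivity)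
  have h4 : B * (8 * B) ≤ B * q ^ 2 := mul_le_mul_of_nonneg_left hN' (by positivity)
  have h5 : (A + B) * q ^ 2 ≤ (2 * (A * B)) * q ^ 2 := by
    apply mul_le_mul_of_nonneg_right _ (by positivity)
    nlinarith
  nlinarith

/-- If `8 |t q| ≤ q ^ 2 + q` and `8 ∣ q` then `8 |t| ≤ q`. -/
lemma kem_bound {q t : ℤ} (hq : 8 ≤ q) (h8 : 8 ∣ q) (h : 8 * |q * t| ≤ q ^ 2 + q) :
    8 * |t| ≤ q := by
  rw [abs_mul, abs_of_nonneg (by linarith : 0 ≤ q)] at h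
  have : 8 * |t| ≤ q + 1 := by nlinarith
  -- Both 8·|t| and q are multiples of 8, so an excess of at most 1 is impossible.
  omega

/-- Numerator and denominator are coprime, and w is too small to be a multiple of the denominator.
This keeps the residues in the folding argument away from zero. -/
lemma kem_not_dvd {i : ℕ} {w : ℤ} (hw : w ≠ 0) (h : 8 * |w| ≤ kemDen i) :
    ¬ kemDen i ∣ w * kemNum i := by
  intro hd
  have hc : IsCoprime (kemDen i) (kemNum i) := by
    unfold kemDen
    apply IsCoprime.pow_left
    exact (Int.isCoprime_iff_gcd_eq_one.2 (by
      have := (kemNum_odd i)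
      rw [Int.gcd_comm, ← Int.isCoprime_iff_gcd_eq_one]
      obtain ⟨k, hk⟩ := this
      exact ⟨1, -k, by rw [hk]; ring⟩))
  have := hc.dvd_of_dvd_mul_right hd
  have := Int.le_of_dvd (abs_pos.2 hw) ((dvd_abs _ _).2 this)
  have := abs_pos.2 hw
  linarith

/-- Bad approximability at the level of the partial sums: N is the residue of w times the numerator,
so the statement bounds w times the distance of w·(numerator/denominator) from an integer. The
squares on the left are slack for the induction. The invariant is symmetric in w and N, which allows
either of them to be the small one. -/
lemma kem_fold (i : ℕ) : ∀ w N : ℤ, w ≠ 0 → N ≠ 0 → kemDen i ∣ N - w * kemNum i →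
    8 * |w| ≤ kemDen i → 8 * |N| ≤ kemDen i →
    kemDen i ^ 2 + 256 * (w ^ 2 + N ^ 2) ≤ 128 * |w * N| * kemDen i := by
  induction i with
  | zero =>
    intro w N hw hN _ h1 h2
    rw [kemDen_zero] at *
    have a1 : |w| = 1 := by have := Int.one_le_abs hw; omega
    have a2 : |N| = 1 := by have := Int.one_le_abs hN; omega
    rw [abs_mul, ← sq_abs w, ← sq_abs N, a1, a2]
    norm_num
  | succ i ih =>
    intro w N hw hN hd h1 h2
    rw [kemDen_succ] at *
    have hq := kemDen_ge i
    have h8 := eight_dvd_kemDen i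
    simp only [kemNum] at hd
    obtain ⟨k, hk⟩ := hd
    set q := kemDen i with hqd
    -- Modulo q² the numerator is (old numerator)·q + 1, so N = w + q·t, where t is congruent to w
    -- times the old numerator modulo q: the pair (w, t) is an instance one level down.
    obtain ⟨t, ht⟩ : ∃ t, t = w * kemNum i + q * k := ⟨_, rfl⟩
    have hNt : N = w + q * t := by rw [ht]; linarith [hk]
    by_cases hws : 8 * |w| ≤ q
    · have hts : 8 * |t| ≤ q := by
        apply kem_bound hq h8
        have : q * t = N - w := by linarith
        rw [this]
        have := abs_sub N w
        linarith
      have ht0 : t ≠ 0 := by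
        intro h0
        apply kem_not_dvd hw hws
        exact ⟨-k, by linarith⟩
      have := ih w t hw ht0 ⟨k, by rw [ht]; ring⟩ hws hts
      rw [hNt]
      exact kem_fold_aux hq hw hts this
    -- The mirror image: now w = N - q·t, and (N, t) is the instance one level down.
    · by_cases hNs : 8 * |N| ≤ q
      · have hts : 8 * |t| ≤ q := by
          apply kem_bound hq h8
          have : q * t = N - w := by linarith
          rw [this]
          have := abs_sub N w
          linarith
        have hd' : q ∣ t - N * kemNum i := ⟨k - t * kemNum i, by rw [hNt]; linear_combination ht⟩
        have ht0 : t ≠ 0 := by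
          intro h0
          apply kem_not_dvd hN hNs
          rw [h0, zero_sub] at hd'
          exact (dvd_neg.1 hd')
        have := ih N t hN ht0 hd' hNs hts
        have e : w = N + q * (-t) := by rw [hNt]; ring
        have h3 := kem_fold_aux (s := -t) hq hN (by rwa [abs_neg])
          (by rw [mul_neg, abs_neg, neg_sq]; exact this)
        rw [← e] at h3
        rw [mul_comm w N, add_comm (w ^ 2)]
        exact h3
      · exact kem_fold_large hq (not_le.1 hws) (not_le.1 hNs) h1 h2

lemma kemSum_succ (i : ℕ) : kemSum (i + 1) = kemSum i + 1 / (kemDen i : ℝ) ^ 2 := by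
  have h : (kemDen i : ℝ) ≠ 0 := by exact_mod_cast (kemDen_pos i).ne'
  simp only [kemSum, kemDen_succ, kemNum]
  push_cast
  field_simp

lemma kemSum_mono : Monotone kemSum :=
  monotone_nat_of_le_succ fun i => by
    rw [kemSum_succ]
    have : (0 : ℝ) < kemDen i := by exact_mod_cast kemDen_pos i
    have : 0 ≤ 1 / (kemDen i : ℝ) ^ 2 := by positivity
    linarith

/-- Adding twice the first omitted term to a partial sum gives a decreasing sequence, since each
term is at most half of its predecessor; hence the tail is at most twice its first term. -/
lemma kemSum_upper (i k : ℕ) :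
    kemSum (i + k) + 2 / (kemDen (i + k) : ℝ) ^ 2 ≤ kemSum i + 2 / (kemDen i : ℝ) ^ 2 := by
  induction k with
  | zero => simp
  | succ k ih =>
    refine le_trans ?_ ih
    rw [← add_assoc, kemSum_succ, kemDen_succ]
    have h : (8 : ℝ) ≤ kemDen (i + k) := by exact_mod_cast kemDen_ge (i + k)
    push_cast
    generalize (kemDen (i + k) : ℝ) = q at *
    have h1 : 2 / (q ^ 2) ^ 2 ≤ 1 / q ^ 2 := by
      rw [div_le_div_iff₀ (by positivity) (by positivity)]
      have h8 : 64 ≤ q ^ 2 := by nlinarith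
      nlinarith
    have h2 : 2 / q ^ 2 = 1 / q ^ 2 + 1 / q ^ 2 := by ring
    linarith

lemma kemSum_le (i j : ℕ) : kemSum j ≤ kemSum i + 2 / (kemDen i : ℝ) ^ 2 := by
  have hp : ∀ i, 0 ≤ 2 / (kemDen i : ℝ) ^ 2 := fun i => by positivity
  rcases le_total j i with h | h
  · linarith [kemSum_mono h, hp i]
  · obtain ⟨k, rfl⟩ := Nat.exists_eq_add_of_le h
    linarith [kemSum_upper i k, hp (i + k)]

lemma kemSum_bdd : BddAbove (Set.range kemSum) := by
  refine ⟨kemSum 0 + 2 / (kemDen 0 : ℝ) ^ 2, ?_⟩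
  rintro _ ⟨j, rfl⟩
  exact kemSum_le 0 j

lemma kemSum_le_kempner (i : ℕ) : kemSum i ≤ kempner := le_ciSup kemSum_bdd i

lemma kempner_le (i : ℕ) : kempner ≤ kemSum i + 2 / (kemDen i : ℝ) ^ 2 :=
  ciSup_le (kemSum_le i)

lemma tendsto_kemSum : Tendsto kemSum atTop (𝓝 kempner) :=
  tendsto_atTop_ciSup kemSum_mono kemSum_bdd

/-- The bound holds for all late partial sums, with the same constant, and passes to the limit. -/
lemma kempner_bad (w : ℕ) (hw : 1 ≤ w) (v : ℤ) : 1 / (128 * (w : ℝ)) ≤ |w * kempner - v| := by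
  have ht : Tendsto (fun i => |(w : ℝ) * kemSum i - v|) atTop (𝓝 |w * kempner - v|) :=
    ((tendsto_kemSum.const_mul _).sub_const _).abs
  apply ge_of_tendsto ht
  filter_upwards [eventually_ge_atTop (8 * w)] with i hi
  have hw0 : (w : ℤ) ≠ 0 := by exact_mod_cast (by omega : w ≠ 0)
  have hwq : 8 * |(w : ℤ)| ≤ kemDen i := by
    have := lt_kemDen i
    rw [Nat.abs_cast]
    have : (8 * w : ℤ) ≤ i := by exact_mod_cast hi
    linarith
  have hq : (0 : ℝ) < kemDen i := by exact_mod_cast kemDen_pos i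
  obtain ⟨N, hN⟩ : ∃ N, N = w * kemNum i - v * kemDen i := ⟨_, rfl⟩
  have hN0 : N ≠ 0 := by
    intro h0
    exact kem_not_dvd hw0 hwq ⟨v, by linarith⟩
  have e : (w : ℝ) * kemSum i - v = N / kemDen i := by
    rw [hN, kemSum]
    push_cast
    field_simp
  have hwpos : (1 : ℝ) ≤ w := by exact_mod_cast hw
  rw [e, abs_div, abs_of_pos hq, div_le_div_iff₀ (by positivity) hq]
  -- A small residue is covered by `kem_fold`; a large one means that the distance is at least 1/8
  -- anyway.
  by_cases hs : 8 * |N| ≤ kemDen i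
  · have h := kem_fold i w N hw0 hN0 ⟨-v, by rw [hN]; ring⟩ hwq hs
    have h2 : kemDen i ^ 2 ≤ 128 * |(w : ℤ) * N| * kemDen i := by nlinarith [sq_nonneg N, sq_nonneg (w : ℤ)]
    have h3 : kemDen i ≤ 128 * |(w : ℤ) * N| := by
      have := kemDen_pos i
      nlinarith
    rw [abs_mul, Nat.abs_cast] at h3
    have h4 : (kemDen i : ℝ) ≤ 128 * (w * |(N : ℝ)|) := by exact_mod_cast h3
    linarith
  · have h3 : (kemDen i : ℝ) ≤ 8 * |(N : ℝ)| := by exact_mod_cast (not_le.1 hs).le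
    have := abs_nonneg (N : ℝ)
    nlinarith

lemma irrational_kempner : Irrational kempner := by
  rintro ⟨r, hr⟩
  have h := kempner_bad r.den r.pos r.num
  have hd : (0 : ℝ) < r.den := by exact_mod_cast r.pos
  have e : (r.den : ℝ) * kempner - r.num = 0 := by
    rw [← hr]
    have : (r : ℝ) = r.num / r.den := by exact_mod_cast (Rat.num_div_den r).symm
    rw [this]
    field_simp
    simp
  rw [e, abs_zero] at h
  have : 0 < 1 / (128 * (r.den : ℝ)) := by positivity
  linarith

/-! ### The angle: a phase close to -1 and lower bounds for sines -/

/-- The rotation angle. -/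
noncomputable def angle : ℝ := Real.pi * kempner

lemma irrational_angle : Irrational (angle / Real.pi) := by
  rw [angle, mul_div_cancel_left₀ _ Real.pi_ne_zero]
  exact irrational_kempner

/-- Multiplication by the denominator turns the number into an odd integer plus a tail ρ of size at
most 2/2^(3·2^i), so the cosine is -cos(πρ), which is within (πρ)²/2 of -1. -/
lemma cos_angle_pow_le (i : ℕ) :
    Real.cos (angle * 2 ^ (3 * 2 ^ i)) ≤ -1 + 20 / 4 ^ (3 * 2 ^ i) := by
  have hq : (0 : ℝ) < kemDen i := by exact_mod_cast kemDen_pos i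
  have hqd : (kemDen i : ℝ) = 2 ^ (3 * 2 ^ i) := by simp [kemDen]
  obtain ⟨ρ, hρ⟩ : ∃ ρ, ρ = kemDen i * kempner - kemNum i := ⟨_, rfl⟩
  have h0 : 0 ≤ ρ := by
    have := kemSum_le_kempner i
    rw [kemSum, div_le_iff₀ hq] at this
    linarith
  have h1 : ρ ≤ 2 / kemDen i := by
    have := mul_le_mul_of_nonneg_left (kempner_le i) hq.le
    rw [kemSum] at this
    have e : (kemDen i : ℝ) * (kemNum i / kemDen i + 2 / (kemDen i : ℝ) ^ 2)
      = kemNum i + 2 / kemDen i := by field_simp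
    rw [e] at this
    linarith
  obtain ⟨k, hk⟩ := kemNum_odd i
  have e : angle * 2 ^ (3 * 2 ^ i) = Real.pi * ρ + Real.pi + k * (2 * Real.pi) := by
    rw [← hqd, hρ, hk, angle]
    push_cast
    ring
  rw [e, Real.cos_add_int_mul_two_pi, Real.cos_add_pi]
  have h2 := Real.one_sub_sq_div_two_le_cos (x := Real.pi * ρ)
  have h3 : (Real.pi * ρ) ^ 2 ≤ 40 / 4 ^ (3 * 2 ^ i) := by
    have e4 : (4 : ℝ) ^ (3 * 2 ^ i) = (kemDen i : ℝ) ^ 2 := by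
      rw [hqd, ← pow_mul, mul_comm (3 * 2 ^ i), pow_mul (2 : ℝ) 2]; norm_num
    rw [e4]
    -- With π² ≤ 10 the quadratic term is at most 10·4/2 = 20 times the inverse square of the
    -- denominator.
    have hp : Real.pi ^ 2 ≤ 10 := by nlinarith [Real.pi_lt_d2, Real.pi_pos]
    calc (Real.pi * ρ) ^ 2 = Real.pi ^ 2 * ρ ^ 2 := by ring
      _ ≤ 10 * (2 / (kemDen i : ℝ)) ^ 2 := by gcongr
      _ = 40 / (kemDen i : ℝ) ^ 2 := by ring
  have e5 : (40 : ℝ) / 4 ^ (3 * 2 ^ i) = 2 * (20 / 4 ^ (3 * 2 ^ i)) := by ring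
  linarith

/-- Reduce to the distance from the nearest integer and use Jordan's inequality sin x ≥ 2x/π on [0,
π/2]. -/
lemma two_mul_le_abs_sin_pi_mul {y η : ℝ} (h : ∀ v : ℤ, η ≤ |y - v|) :
    2 * η ≤ |Real.sin (Real.pi * y)| := by
  obtain ⟨r, hr⟩ : ∃ r, r = y - round y := ⟨_, rfl⟩
  have h1 : |r| ≤ 1 / 2 := by rw [hr]; exact abs_sub_round y
  have h2 : η ≤ |r| := by rw [hr]; exact h _
  have e : Real.pi * y = Real.pi * r + round y * Real.pi := by rw [hr]; ring
  rw [e, Real.sin_add_int_mul_pi, abs_mul]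
  have hpm : |((-1 : ℝ) ^ (round y))| = 1 := by
    rw [abs_zpow]; simp
  rw [hpm, one_mul]
  have hp := Real.pi_pos
  have h3 : 2 / Real.pi * (Real.pi * |r|) ≤ Real.sin (Real.pi * |r|) :=
    Real.mul_le_sin (by positivity) (by nlinarith)
  have e2 : 2 / Real.pi * (Real.pi * |r|) = 2 * |r| := by field_simp
  have h4 : |Real.sin (Real.pi * r)| = |Real.sin (Real.pi * |r|)| := by
    rcases abs_choice r with h | h <;> rw [h]
    rw [mul_neg, Real.sin_neg, abs_neg]
  rw [h4]
  linarith [le_abs_self (Real.sin (Real.pi * |r|))]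

lemma abs_sin_angle (w : ℕ) (hw : 1 ≤ w) : 1 / (64 * (w : ℝ)) ≤ |Real.sin (angle * w)| := by
  have h := two_mul_le_abs_sin_pi_mul (kempner_bad w hw)
  have e : angle * w = Real.pi * (w * kempner) := by rw [angle]; ring
  rw [e]
  refine le_trans (le_of_eq ?_) h
  have : (w : ℝ) ≠ 0 := by positivity
  field_simp
  norm_num

/-- The product telescopes by sin 2x = 2 sin x cos x. -/
lemma prod_cos_mul_sin (x : ℝ) (m : ℕ) :
    (∏ j ∈ Finset.range m, Real.cos (x * 2 ^ j)) * (2 ^ m * Real.sin x) = Real.sin (x * 2 ^ m) := by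
  induction m with
  | zero => simp
  | succ m ih =>
    have e : x * 2 ^ (m + 1) = 2 * (x * 2 ^ m) := by ring
    rw [Finset.prod_range_succ, e, Real.sin_two_mul, ← ih]
    ring

/-- The telescoped product has numerator at most 1, and the sine in its denominator is at least
1/(64w). This is the only way in which bad approximability enters the error analysis. -/
lemma prod_cos_sq_le (w m : ℕ) (hw : 1 ≤ w) :
    ∏ j ∈ Finset.range m, Real.cos (angle * w * 2 ^ j) ^ 2 ≤ (64 * (w : ℝ)) ^ 2 / 4 ^ m := by
  have h := prod_cos_mul_sin (angle * w) m
  have hs := abs_sin_angle w hw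
  have hw' : (1 : ℝ) ≤ w := by exact_mod_cast hw
  rw [Finset.prod_pow]
  generalize (∏ j ∈ Finset.range m, Real.cos (angle * w * 2 ^ j)) = P at *
  have h1 : P ^ 2 * (4 ^ m * Real.sin (angle * w) ^ 2) ≤ 1 := by
    have : P ^ 2 * (4 ^ m * Real.sin (angle * w) ^ 2) = (P * (2 ^ m * Real.sin (angle * w))) ^ 2 := by
      have : (4 : ℝ) ^ m = (2 ^ m) ^ 2 := by rw [← pow_mul, mul_comm m, pow_mul]; norm_num
      rw [this]; ring
    rw [this, h]
    exact Real.sin_sq_le_one _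
  have h2 : (1 / (64 * (w : ℝ))) ^ 2 ≤ Real.sin (angle * w) ^ 2 := by
    rw [← sq_abs (Real.sin _)]
    gcongr
  have h3 : P ^ 2 * 4 ^ m * (1 / (64 * (w : ℝ))) ^ 2 ≤ 1 := by
    calc _ ≤ P ^ 2 * 4 ^ m * Real.sin (angle * w) ^ 2 := by gcongr
      _ ≤ 1 := by linarith
  rw [le_div_iff₀ (by positivity)]
  rw [one_div, inv_pow, ← div_eq_mul_inv, div_le_iff₀ (by positivity)] at h3
  linarith

/-! ### Operators on states -/

section Operators

set_option linter.unusedSectionVars false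

variable {Q : Type} [DecidableEq Q]

/-- Negation of the bit `q`. -/
def flipBit (q : Q) (b : Q → Bool) : Q → Bool := Function.update b q (!b q)

@[simp] lemma flipBit_same (q : Q) (b : Q → Bool) : flipBit q b q = !b q := by simp [flipBit]

lemma flipBit_ne {q q' : Q} (h : q' ≠ q) (b : Q → Bool) : flipBit q b q' = b q' := by
  simp [flipBit, h]

@[simp] lemma flipBit_flipBit (q : Q) (b : Q → Bool) : flipBit q (flipBit q b) = b := by
  funext x
  by_cases h : x = q
  · subst h; simp
  · simp [flipBit_ne h]

lemma flipBit_comm {q q' : Q} (h : q ≠ q') (b : Q → Bool) :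
    flipBit q (flipBit q' b) = flipBit q' (flipBit q b) := by
  funext x
  by_cases h1 : x = q
  · subst h1; simp [flipBit_ne h]
  · by_cases h2 : x = q'
    · subst h2; simp [flipBit_ne h1]
    · simp [flipBit_ne h1, flipBit_ne h2]

/-- The flip of a bit as a permutation of the basis states. -/
def flipEquiv (q : Q) : (Q → Bool) ≃ (Q → Bool) where
  toFun := flipBit q
  invFun := flipBit q
  left_inv := flipBit_flipBit q
  right_inv := flipBit_flipBit q

/-- The sign `(-1)^x`. -/
def sgn (x : Bool) : ℂ := if x then -1 else 1

@[simp] lemma sgn_false : sgn false = 1 := rfl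
@[simp] lemma sgn_true : sgn true = -1 := rfl
@[simp] lemma sgn_not (x : Bool) : sgn (!x) = -sgn x := by cases x <;> simp
@[simp] lemma sgn_mul_self (x : Bool) : sgn x * sgn x = 1 := by cases x <;> simp
@[simp] lemma conj_sgn (x : Bool) : (starRingEnd ℂ) (sgn x) = sgn x := by cases x <;> simp

/-- The factor `1 / √2`. -/
noncomputable def invSqrtTwo : ℂ := 1 / (Real.sqrt 2 : ℂ)

lemma invSqrtTwo_sq : invSqrtTwo * invSqrtTwo = 1 / 2 := by
  have h : ((Real.sqrt 2 : ℝ) : ℂ) * (Real.sqrt 2 : ℝ) = 2 := by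
    rw [← Complex.ofReal_mul, Real.mul_self_sqrt (by norm_num)]; simp
  rw [invSqrtTwo, div_mul_div_comm, h, one_mul]

lemma conj_invSqrtTwo : (starRingEnd ℂ) invSqrtTwo = invSqrtTwo := by
  simp [invSqrtTwo]

/-- Written with the involution `flipBit`, identities for Hadamard gates become algebra in the two
amplitudes at b and its flip. -/
lemma applyHad_eq (q : Q) (ψ : State Q) (b : Q → Bool) :
    applyHad q ψ b = invSqrtTwo * (sgn (b q) * ψ b + ψ (flipBit q b)) := by
  unfold applyHad invSqrtTwo flipBit
  cases h : b q
  · rw [← h, Function.update_eq_self, h]; simp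
  · have : Function.update b q true = b := by rw [← h, Function.update_eq_self]
    rw [this]; simp [add_comm]

lemma applyHad_applyHad (q : Q) (ψ : State Q) : applyHad q (applyHad q ψ) = ψ := by
  funext b
  simp only [applyHad_eq, flipBit_flipBit, flipBit_same, sgn_not]
  have h1 := invSqrtTwo_sq
  have h2 := sgn_mul_self (b q)
  linear_combination (ψ b * (1 + sgn (b q) * sgn (b q))) * h1 + (ψ b / 2) * h2

lemma applyHad_comm (q q' : Q) (ψ : State Q) :
    applyHad q (applyHad q' ψ) = applyHad q' (applyHad q ψ) := by
  by_cases h : q = q'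
  · rw [h]
  · funext b
    simp only [applyHad_eq, flipBit_ne h, flipBit_ne (Ne.symm h), flipBit_comm h]
    ring

/-- The inner product. -/
noncomputable def inn [Fintype Q] (φ ψ : State Q) : ℂ := ∑ b, (starRingEnd ℂ) (φ b) * ψ b

lemma inn_applyHad [Fintype Q] (q : Q) (φ ψ : State Q) :
    inn (applyHad q φ) ψ = inn φ (applyHad q ψ) := by
  unfold inn
  simp only [applyHad_eq, map_mul, map_add, conj_invSqrtTwo, conj_sgn, mul_add, add_mul,
    Finset.sum_add_distrib]
  congr 1
  · exact Finset.sum_congr rfl fun b _ => by ring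
  · rw [← Equiv.sum_comp (flipEquiv q)]
    refine Finset.sum_congr rfl fun b _ => ?_
    simp only [flipEquiv, Equiv.coe_fn_mk, flipBit_flipBit]
    ring

/-- A family of operators applied one after the other. -/
def opList (O : Q → State Q → State Q) (l : List Q) (ψ : State Q) : State Q :=
  l.foldl (fun φ q => O q φ) ψ

@[simp] lemma opList_cons (O : Q → State Q → State Q) (q : Q) (l : List Q) (ψ : State Q) :
    opList O (q :: l) ψ = opList O l (O q ψ) := rfl

lemma opList_comm {O : Q → State Q → State Q} {A : State Q → State Q} {l : List Q}
    (h : ∀ q ∈ l, ∀ ψ, A (O q ψ) = O q (A ψ)) (ψ : State Q) :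
    A (opList O l ψ) = opList O l (A ψ) := by
  induction l generalizing ψ with
  | nil => rfl
  | cons q l ih =>
    rw [opList_cons, opList_cons, ih (fun q hq => h q (List.mem_cons_of_mem _ hq)),
      h q List.mem_cons_self]

lemma opList_congr {O O' : Q → State Q → State Q} {l : List Q}
    (h : ∀ q ∈ l, ∀ ψ, O q ψ = O' q ψ) (ψ : State Q) : opList O l ψ = opList O' l ψ := by
  induction l generalizing ψ with
  | nil => rfl
  | cons q l ih =>
    rw [opList_cons, opList_cons, h q List.mem_cons_self,
      ih (fun q hq => h q (List.mem_cons_of_mem _ hq))]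

@[simp] lemma opList_nil (O : Q → State Q → State Q) (ψ : State Q) : opList O [] ψ = ψ := rfl

/-- Hadamard gates on all qubits of a list. -/
noncomputable def hadList : List Q → State Q → State Q := opList applyHad

@[simp] lemma hadList_cons (q : Q) (l : List Q) (ψ : State Q) :
    hadList (q :: l) ψ = hadList l (applyHad q ψ) := rfl

lemma applyHad_hadList (q : Q) (l : List Q) (ψ : State Q) :
    applyHad q (hadList l ψ) = hadList l (applyHad q ψ) :=
  opList_comm (fun q' _ ψ => applyHad_comm q q' ψ) ψ

lemma hadList_hadList (l : List Q) (ψ : State Q) : hadList l (hadList l ψ) = ψ := by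
  induction l generalizing ψ with
  | nil => rfl
  | cons q l ih =>
    rw [hadList_cons, hadList_cons, applyHad_hadList, ih, applyHad_applyHad]

lemma inn_hadList [Fintype Q] (l : List Q) (φ ψ : State Q) :
    inn (hadList l φ) ψ = inn φ (hadList l ψ) := by
  induction l generalizing φ ψ with
  | nil => rfl
  | cons q l ih => rw [hadList_cons, ih, inn_applyHad, applyHad_hadList, hadList_cons]

@[simp] lemma hadList_nil (ψ : State Q) : hadList [] ψ = ψ := rfl

/-- Conjugation with Hadamard gates of a product of operators on distinct qubits. -/
lemma hadList_conj {O : Q → State Q → State Q} {l : List Q} (hl : l.Nodup)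
    (h : ∀ q ∈ l, ∀ q' ∈ l, q ≠ q' → ∀ ψ, applyHad q (O q' ψ) = O q' (applyHad q ψ))
    (ψ : State Q) :
    hadList l (opList O l (hadList l ψ)) =
      opList (fun q φ => applyHad q (O q (applyHad q φ))) l ψ := by
  induction l generalizing ψ with
  | nil => rfl
  | cons q l ih =>
    rw [List.nodup_cons] at hl
    have hne : ∀ q' ∈ l, q ≠ q' := fun q' hq' e => hl.1 (e ▸ hq')
    rw [hadList_cons, hadList_cons, opList_cons, opList_cons,
      ← ih hl.2 (fun a ha b hb => h a (List.mem_cons_of_mem _ ha) b (List.mem_cons_of_mem _ hb))]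
    congr 1
    -- The Hadamard gate on q passes the operators of the other qubits, and then the operator of q
    -- passes the Hadamard gates on the other qubits.
    rw [opList_comm (fun q' hq' => h q List.mem_cons_self q' (List.mem_cons_of_mem _ hq')
      (hne q' hq'))]
    congr 1
    rw [← applyHad_hadList q l (O q (applyHad q ψ))]
    congr 1
    exact (opList_comm (fun q' hq' φ => (h q' (List.mem_cons_of_mem _ hq') q List.mem_cons_self
      (hne q' hq').symm φ).symm) _)

/-- Locality: Hadamard gates mix only amplitudes whose assignments agree outside the list. States
can thus be compared with the other qubits held fixed, for instance with all inputs zero. -/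
lemma hadList_congr_on {l : List Q} {ψ ψ' : State Q} {b : Q → Bool}
    (h : ∀ b', (∀ q, q ∉ l → b' q = b q) → ψ b' = ψ' b') : hadList l ψ b = hadList l ψ' b := by
  induction l generalizing ψ ψ' with
  | nil => exact h b (fun _ _ => rfl)
  | cons q l ih =>
    rw [hadList_cons, hadList_cons]
    apply ih
    intro b' hb'
    rw [applyHad_eq, applyHad_eq, h b', h (flipBit q b')]
    · intro x hx
      rw [List.mem_cons, not_or] at hx
      rw [flipBit_ne hx.1, hb' x hx.2]
    · intro x hx
      rw [List.mem_cons, not_or] at hx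
      rw [hb' x hx.2]

/-- Multiplication of the amplitudes with a function. -/
def diag (f : (Q → Bool) → ℂ) (ψ : State Q) : State Q := fun b => f b * ψ b

lemma diag_diag (f g : (Q → Bool) → ℂ) (ψ : State Q) :
    diag f (diag g ψ) = diag (fun b => f b * g b) ψ := by
  funext b; simp [diag, mul_assoc]

lemma applyHad_diag {q : Q} {f : (Q → Bool) → ℂ} (h : ∀ b, f (flipBit q b) = f b)
    (ψ : State Q) : applyHad q (diag f ψ) = diag f (applyHad q ψ) := by
  funext b
  simp only [applyHad_eq, diag, h]
  ring

lemma hadList_diag {l : List Q} {f : (Q → Bool) → ℂ} (h : ∀ q ∈ l, ∀ b, f (flipBit q b) = f b)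
    (ψ : State Q) : hadList l (diag f ψ) = diag f (hadList l ψ) :=
  (opList_comm (A := diag f) (fun q hq ψ => (applyHad_diag (h q hq) ψ).symm) ψ).symm

lemma opList_diag (f : Q → (Q → Bool) → ℂ) (l : List Q) (ψ : State Q) :
    opList (fun q => diag (f q)) l ψ = diag (fun b => (l.map fun q => f q b).prod) ψ := by
  induction l generalizing ψ with
  | nil => funext b; simp [diag]
  | cons q l ih =>
    rw [opList_cons, ih, diag_diag]
    funext b
    simp [diag, mul_comm]

/-- The squared norm is an inner product. -/
lemma sum_norm_sq_eq_inn [Fintype Q] (ψ : State Q) :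
    ((∑ b, ‖ψ b‖ ^ 2 : ℝ) : ℂ) = inn ψ ψ := by
  unfold inn
  push_cast
  refine Finset.sum_congr rfl fun b _ => ?_
  rw [mul_comm, Complex.mul_conj, Complex.normSq_eq_norm_sq]
  norm_cast

lemma sum_norm_sq_hadList [Fintype Q] (l : List Q) (ψ : State Q) :
    ∑ b, ‖hadList l ψ b‖ ^ 2 = ∑ b, ‖ψ b‖ ^ 2 := by
  have h : ((∑ b, ‖hadList l ψ b‖ ^ 2 : ℝ) : ℂ) = ((∑ b, ‖ψ b‖ ^ 2 : ℝ) : ℂ) := by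
    rw [sum_norm_sq_eq_inn, sum_norm_sq_eq_inn, inn_hadList, hadList_hadList]
  exact_mod_cast h

lemma inn_diag [Fintype Q] (f : (Q → Bool) → ℂ) (φ ψ : State Q) :
    inn (diag f φ) ψ = inn φ (diag (fun b => (starRingEnd ℂ) (f b)) ψ) := by
  unfold inn diag
  refine Finset.sum_congr rfl fun b _ => ?_
  rw [map_mul]; ring

/-! ### Products of controlled operations -/

/-- The bits of the list `l` are changed by the functions `p`. -/
def xorOn (l : List Q) (p : Q → (Q → Bool) → Bool) (b : Q → Bool) : Q → Bool :=
  fun q => if q ∈ l then xor (b q) (p q b) else b q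

/-- The functions p ignore the bits that are changed, so successive changes amount to a simultaneous
one. In this way fan-outs split into one operator per target, to which `hadList_conj` applies. -/
lemma opList_xor {l : List Q} (hl : l.Nodup) {p : Q → (Q → Bool) → Bool}
    (hp : ∀ q, ∀ q' ∈ l, ∀ b, p q (flipBit q' b) = p q b) (ψ : State Q) :
    opList (fun q φ b => φ (Function.update b q (xor (b q) (p q b)))) l ψ =
      fun b => ψ (xorOn l p b) := by
  have hpu : ∀ q, ∀ q' ∈ l, ∀ b x, p q (Function.update b q' x) = p q b := by
    intro q q' hq' b x
    by_cases h : x = b q'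
    · rw [h, Function.update_eq_self]
    · have : x = !b q' := by cases x <;> cases hb : b q' <;> simp_all
      rw [this]; exact hp q q' hq' b
  have hpx : ∀ q (l' : List Q), l' ⊆ l → ∀ b, p q (xorOn l' p b) = p q b := by
    intro q l'
    induction l' with
    | nil => intro _ b; congr 1
    | cons a l' ih =>
      intro hs b
      have e : xorOn (a :: l') p b = Function.update (xorOn l' p b) a (xorOn (a :: l') p b a) := by
        funext x
        by_cases hx : x = a
        · subst hx; simp
        · simp [hx, xorOn]
      rw [e, hpu q a (hs List.mem_cons_self), ih (fun x hx => hs (List.mem_cons_of_mem _ hx))]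
  clear hp
  induction l generalizing ψ with
  | nil => funext b; exact congrArg ψ (by funext x; simp [xorOn])
  | cons a l ih =>
    rw [List.nodup_cons] at hl
    rw [opList_cons, ih hl.2 _ (fun q q' hq' => hpu q q' (List.mem_cons_of_mem _ hq'))
      (fun q l' h => hpx q l' (fun x hx => List.mem_cons_of_mem _ (h hx)))]
    funext b
    congr 1
    rw [hpx a l (fun x hx => List.mem_cons_of_mem _ hx)]
    funext x
    by_cases hx : x = a
    · subst hx; simp [xorOn, hl.1]
    · simp [hx, xorOn]

/-- Conjugating a controlled negation with Hadamard gates gives a controlled sign. -/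
lemma had_xor_had {q : Q} {p : (Q → Bool) → Bool} (hp : ∀ b, p (flipBit q b) = p b)
    (ψ : State Q) :
    applyHad q (fun b => applyHad q ψ (Function.update b q (xor (b q) (p b)))) =
      diag (fun b => sgn (b q && p b)) ψ := by
  have hu : ∀ b, Function.update b q (xor (b q) (p b)) = if p b then flipBit q b else b := by
    intro b
    cases h : p b <;> simp [flipBit]
  simp only [hu]
  funext b
  rw [applyHad_eq]
  simp only [hp]
  cases h : p b
  · have e := congrFun (applyHad_applyHad q ψ) b
    rw [applyHad_eq] at e
    simpa [diag, h] using e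
  · simp only [applyHad_eq, flipBit_flipBit, flipBit_same, sgn_not, diag, h, Bool.and_true, if_true]
    have h1 := invSqrtTwo_sq
    have h2 := sgn_mul_self (b q)
    linear_combination (2 * ψ b * sgn (b q) ) * h1 -
      (invSqrtTwo * invSqrtTwo * ψ (flipBit q b)) * h2

/-- Conjugating a controlled sign with Hadamard gates gives a controlled negation. -/
lemma had_sgn_had {q : Q} {p : (Q → Bool) → Bool} (hp : ∀ b, p (flipBit q b) = p b)
    (ψ : State Q) :
    applyHad q (diag (fun b => sgn (b q && p b)) (applyHad q ψ)) =
      fun b => ψ (Function.update b q (xor (b q) (p b))) := by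
  rw [← had_xor_had hp]
  simp only [applyHad_applyHad]

end Operators

/-! ### Layers given by predicates -/

/-- A layer that consists of the same gate on all qubits with a property `P`; for a fan-out, the
targets of the control `a` are the qubits `t` with `R a t`. -/
inductive LayerSpec (Q : Type) : Type
  | had (P : Q → Bool)
  | rot (P : Q → Bool)
  | rotInv (P : Q → Bool)
  | fan (P : Q → Bool) (R : Q → Q → Bool)

namespace LayerSpec

variable {Q : Type}

/-- The layer, where `u` enumerates the qubits. -/
def toLayer (u : List Q) : LayerSpec Q → Layer Q
  | had P => (u.filter P).map Gate.had
  | rot P => (u.filter P).map Gate.rot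
  | rotInv P => (u.filter P).map Gate.rotInv
  | fan P R => (u.filter P).map fun a => Gate.fanout a (u.filter (R a))

/-- Controls are not targets, and every target has one control. -/
def WF : LayerSpec Q → Prop
  | fan P R => (∀ a t, P a = true → R a t = true → P t = false) ∧
      ∀ a a' t, P a = true → P a' = true → R a t = true → R a' t = true → a = a'
  | _ => True

/-- The qubits that may occur in the layer. -/
def support : LayerSpec Q → Q → Prop
  | had P, q => P q = true
  | rot P, q => P q = true
  | rotInv P, q => P q = true
  | fan P R, q => P q = true ∨ ∃ a, P a = true ∧ R a q = true

lemma flatMap_singleton_map (l : List Q) (g : Q → Gate Q) (h : ∀ q, (g q).qubits = [q]) :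
    (l.map g).flatMap Gate.qubits = l := by
  induction l with
  | nil => rfl
  | cons a l ih => rw [List.map_cons, List.flatMap_cons, ih, h]; rfl

lemma toLayer_valid {u : List Q} (hu : u.Nodup) {s : LayerSpec Q} (hs : s.WF) :
    (s.toLayer u).Valid := by
  unfold Layer.Valid
  cases s with
  | had P => rw [toLayer, flatMap_singleton_map _ _ fun _ => rfl]; exact hu.filter _
  | rot P => rw [toLayer, flatMap_singleton_map _ _ fun _ => rfl]; exact hu.filter _
  | rotInv P => rw [toLayer, flatMap_singleton_map _ _ fun _ => rfl]; exact hu.filter _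
  | fan P R =>
    simp only [toLayer, List.flatMap_map, Gate.qubits]
    obtain ⟨h1, h2⟩ := hs
    rw [List.nodup_flatMap]
    constructor
    · intro a ha
      rw [List.mem_filter] at ha
      rw [List.nodup_cons]
      refine ⟨fun h => ?_, hu.filter _⟩
      rw [List.mem_filter] at h
      have := h1 a a ha.2 h.2
      simp [ha.2] at this
    · refine List.Pairwise.imp_of_mem ?_ (hu.filter P)
      intro a a' ha ha' hne
      rw [List.mem_filter] at ha ha'
      intro t ht ht'
      simp only [List.mem_cons, List.mem_filter] at ht ht'
      rcases ht with rfl | ht <;> rcases ht' with rfl | ht'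
      · exact hne rfl
      · have := h1 _ _ ha'.2 ht'.2; simp [ha.2] at this
      · have := h1 _ _ ha.2 ht.2; simp [ha'.2] at this
      · exact hne (h2 _ _ _ ha.2 ha'.2 ht.2 ht'.2)

lemma support_of_mem {u : List Q} {s : LayerSpec Q} {q : Q}
    (h : q ∈ (s.toLayer u).flatMap Gate.qubits) : s.support q := by
  cases s with
  | had P =>
    rw [toLayer, flatMap_singleton_map _ _ fun _ => rfl, List.mem_filter] at h; exact h.2
  | rot P =>
    rw [toLayer, flatMap_singleton_map _ _ fun _ => rfl, List.mem_filter] at h; exact h.2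
  | rotInv P =>
    rw [toLayer, flatMap_singleton_map _ _ fun _ => rfl, List.mem_filter] at h; exact h.2
  | fan P R =>
    simp only [toLayer, List.flatMap_map, Gate.qubits, List.mem_flatMap, List.mem_filter,
      List.mem_cons] at h
    obtain ⟨a, ha, rfl | h⟩ := h
    · exact Or.inl ha.2
    · exact Or.inr ⟨a, ha.2, h.2⟩

end LayerSpec

lemma layer_size_eq {Q : Type} (l : Layer Q) :
    (l.map Gate.size).sum = (l.flatMap Gate.qubits).length := by
  induction l with
  | nil => rfl
  | cons g l ih => simp [ih, Gate.size]

/-- A valid layer mentions each qubit at most once. Summed over the layers this bounds the size by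
depth times the number of qubits used, which is all that the size estimates need. -/
lemma layer_size_le {Q : Type} [Fintype Q] [DecidableEq Q] {l : Layer Q} (hl : l.Valid)
    (A : Finset Q) (h : ∀ q ∈ l.flatMap Gate.qubits, q ∈ A) : (l.map Gate.size).sum ≤ A.card := by
  rw [layer_size_eq, ← List.toFinset_card_of_nodup hl]
  exact Finset.card_le_card fun q hq => h q (List.mem_toFinset.1 hq)

lemma circuit_size_le {Q : Type} [Fintype Q] [DecidableEq Q] {u : List Q} (hu : u.Nodup)
    (specs : List (LayerSpec Q)) (hs : ∀ s ∈ specs, s.WF) (A : Finset Q)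
    (hA : ∀ s ∈ specs, ∀ q, s.support q → q ∈ A) :
    Circuit.size (specs.map (LayerSpec.toLayer u)) ≤ specs.length * A.card := by
  unfold Circuit.size
  induction specs with
  | nil => simp
  | cons s specs ih =>
    rw [List.map_cons, List.flatten_cons, List.map_append, List.sum_append, List.length_cons,
      Nat.succ_mul, add_comm (specs.length * _)]
    refine Nat.add_le_add ?_ (ih (fun s hs' => hs s (List.mem_cons_of_mem _ hs'))
      (fun s hs' => hA s (List.mem_cons_of_mem _ hs')))
    exact layer_size_le (LayerSpec.toLayer_valid hu (hs s List.mem_cons_self)) A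
      fun q hq => hA s List.mem_cons_self q (LayerSpec.support_of_mem hq)

/-! ### The operators of layers given by predicates -/

section Run

variable {Q : Type} [DecidableEq Q] [Fintype Q]

/-- The operator of a layer. -/
noncomputable def applySpec (θ : ℝ) (u : List Q) (ψ : State Q) (s : LayerSpec Q) : State Q :=
  (s.toLayer u).foldl (fun φ g => Gate.apply θ g φ) ψ

omit [Fintype Q] in
lemma run_specs (θ : ℝ) (u : List Q) (specs : List (LayerSpec Q)) (ψ : State Q) :
    Circuit.run θ (specs.map (LayerSpec.toLayer u)) ψ = specs.foldl (applySpec θ u) ψ := by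
  unfold Circuit.run
  induction specs generalizing ψ with
  | nil => rfl
  | cons s specs ih =>
    rw [List.map_cons, List.flatten_cons, List.foldl_append, ih]
    rfl

/-- The factor of the rotation by `θ` on a bit. -/
noncomputable def rzFactor (θ : ℝ) (x : Bool) : ℂ := if x then Complex.exp (θ * Complex.I) else 1

/-- The factor of the rotations by `θ` on all qubits with the property `P`. -/
noncomputable def rzProd (θ : ℝ) (P : Q → Bool) (b : Q → Bool) : ℂ :=
  ∏ q with P q = true, rzFactor θ (b q)

/-- The action of a layer of fan-outs on basis states. -/
def fanMap (P : Q → Bool) (R : Q → Q → Bool) (b : Q → Bool) : Q → Bool :=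
  fun t => xor (b t) (decide (∃ a, P a = true ∧ R a t = true ∧ b a = true))

omit [Fintype Q] in
lemma applySpec_had (θ : ℝ) (u : List Q) (P : Q → Bool) (ψ : State Q) :
    applySpec θ u ψ (.had P) = hadList (u.filter P) ψ := by
  simp only [applySpec, LayerSpec.toLayer, List.foldl_map]
  rfl

lemma prod_filter_map {u : List Q} (hu : u.Nodup) (hm : ∀ q, q ∈ u) (P : Q → Bool)
    {M : Type} [CommMonoid M] (f : Q → M) :
    ((u.filter P).map f).prod = ∏ q with P q = true, f q := by
  rw [← List.prod_toFinset f (hu.filter _)]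
  congr 1
  ext q
  simp [hm]

lemma foldl_applyRz (α : ℝ) {u : List Q} (hu : u.Nodup) (hm : ∀ q, q ∈ u) (P : Q → Bool)
    (ψ : State Q) :
    (u.filter P).foldl (fun φ q => applyRz α q φ) ψ = diag (rzProd α P) ψ := by
  have h : (u.filter P).foldl (fun φ q => applyRz α q φ) ψ =
      opList (fun q => diag fun b => rzFactor α (b q)) (u.filter P) ψ := rfl
  rw [h, opList_diag]
  congr 1
  funext b
  exact prod_filter_map hu hm P _

lemma applySpec_rot (θ : ℝ) {u : List Q} (hu : u.Nodup) (hm : ∀ q, q ∈ u) (P : Q → Bool)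
    (ψ : State Q) : applySpec θ u ψ (.rot P) = diag (rzProd θ P) ψ := by
  rw [← foldl_applyRz θ hu hm]
  simp only [applySpec, LayerSpec.toLayer, List.foldl_map]
  rfl

lemma applySpec_rotInv (θ : ℝ) {u : List Q} (hu : u.Nodup) (hm : ∀ q, q ∈ u) (P : Q → Bool)
    (ψ : State Q) : applySpec θ u ψ (.rotInv P) = diag (rzProd (-θ) P) ψ := by
  rw [← foldl_applyRz (-θ) hu hm]
  simp only [applySpec, LayerSpec.toLayer, List.foldl_map]
  rfl

/-- No control is a target and no target has two controls, so performing the fan-outs one by one is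
the same as reading all controls at once. -/
lemma applySpec_fan (θ : ℝ) {u : List Q} (hu : u.Nodup) (hm : ∀ q, q ∈ u) {P : Q → Bool}
    {R : Q → Q → Bool} (hs : (LayerSpec.fan P R).WF) (ψ : State Q) :
    applySpec θ u ψ (.fan P R) = fun b => ψ (fanMap P R b) := by
  obtain ⟨h1, h2⟩ := hs
  have key : ∀ l : List Q, (∀ a ∈ l, P a = true) → l.Nodup → ∀ ψ : State Q,
      (l.map fun a => Gate.fanout a (u.filter (R a))).foldl (fun φ g => Gate.apply θ g φ) ψ =
      fun b => ψ (fun t => xor (b t) (decide (∃ a, a ∈ l ∧ R a t = true ∧ b a = true))) := by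
    intro l hl hlu
    induction l with
    | nil => intro ψ; simp
    | cons a l ih =>
      intro ψ
      rw [List.map_cons, List.foldl_cons, ih (fun x hx => hl x (List.mem_cons_of_mem _ hx))
        (List.nodup_cons.1 hlu).2]
      have hPa := hl a List.mem_cons_self
      funext b
      simp only [Gate.apply]
      congr 1
      funext t
      -- The control a is not a target of any later gate, so its value is still the original one.
      have ha : ¬ ∃ a', a' ∈ l ∧ R a' a = true ∧ b a' = true := by
        rintro ⟨a', ha', hr, _⟩
        have := h1 a' a (hl a' (List.mem_cons_of_mem _ ha')) hr
        simp [hPa] at this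
      simp only [fanoutBits, List.mem_filter, hm t, true_and, ha, decide_false, Bool.xor_false]
      by_cases hR : R a t = true
      · rw [if_pos hR]
        have e1 : (∃ a', a' ∈ a :: l ∧ R a' t = true ∧ b a' = true) ↔ b a = true := by
          constructor
          · rintro ⟨a', ha', hr, hb⟩
            rw [h2 a a' t hPa (hl a' ha') hR hr]; exact hb
          · intro hb; exact ⟨a, List.mem_cons_self, hR, hb⟩
        have hal := (List.nodup_cons.1 hlu).1
        have e3 : ¬ ∃ a', a' ∈ l ∧ R a' t = true ∧ b a' = true := by
          rintro ⟨a', ha', hr, hb⟩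
          exact hal (by rw [h2 a a' t hPa (hl a' (List.mem_cons_of_mem _ ha')) hR hr]; exact ha')
        simp only [e1, e3]
        simp
      · rw [if_neg hR]
        congr 2
        simp only [List.mem_cons, eq_iff_iff]
        constructor
        · rintro ⟨a', ha', h⟩; exact ⟨a', Or.inr ha', h⟩
        · rintro ⟨a', rfl | ha', h⟩
          · exact absurd h.1 hR
          · exact ⟨a', ha', h⟩
  have := key (u.filter P) (fun a ha => (List.mem_filter.1 ha).2) (hu.filter _) ψ
  rw [applySpec, LayerSpec.toLayer, this]
  funext b
  unfold fanMap
  simp only [List.mem_filter, hm, true_and]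

end Run

/-! ### States with clean qubits -/

section Support

set_option linter.unusedSectionVars false

variable {Q : Type} [DecidableEq Q]

/-- The qubits in `S` are in state `|0⟩`. -/
def CleanOn (S : Q → Prop) (ψ : State Q) : Prop := ∀ b, ψ b ≠ 0 → ∀ q, S q → b q = false

lemma CleanOn.diag {S : Q → Prop} {ψ : State Q} (h : CleanOn S ψ) (f : (Q → Bool) → ℂ) :
    CleanOn S (diag f ψ) := fun b hb => h b fun h0 => hb (by simp [QCirc.diag, h0])

lemma CleanOn.mono {S S' : Q → Prop} {ψ : State Q} (h : CleanOn S ψ) (hS : ∀ q, S' q → S q) :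
    CleanOn S' ψ := fun b hb q hq => h b hb q (hS q hq)

lemma CleanOn.applyHad {S : Q → Prop} {ψ : State Q} (h : CleanOn S ψ) {q : Q} (hq : ¬ S q) :
    CleanOn S (applyHad q ψ) := by
  intro b hb x hx
  by_contra hbx
  apply hb
  have hxq : x ≠ q := fun e => hq (e ▸ hx)
  rw [applyHad_eq]
  have h1 : ψ b = 0 := by
    by_contra h0
    exact hbx (h b h0 x hx)
  have h2 : ψ (flipBit q b) = 0 := by
    by_contra h0
    have := h _ h0 x hx
    rw [flipBit_ne hxq] at this
    exact hbx this
  simp [h1, h2]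

lemma CleanOn.hadList {S : Q → Prop} {l : List Q} (hl : ∀ q ∈ l, ¬ S q) {ψ : State Q}
    (h : CleanOn S ψ) : CleanOn S (hadList l ψ) := by
  induction l generalizing ψ with
  | nil => exact h
  | cons q l ih =>
    exact ih (fun q' hq' => hl q' (List.mem_cons_of_mem _ hq')) (h.applyHad (hl q List.mem_cons_self))

/-- Phases need to be computed only for assignments with clean qubits, as all other amplitudes
vanish. -/
lemma diag_congr_clean {S : Q → Prop} {ψ : State Q} (h : CleanOn S ψ) {f g : (Q → Bool) → ℂ}
    (hfg : ∀ b, (∀ q, S q → b q = false) → f b = g b) : diag f ψ = diag g ψ := by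
  funext b
  by_cases h0 : ψ b = 0
  · simp [diag, h0]
  · simp [diag, hfg b (h b h0)]

end Support

/-! ### Layers of fan-outs on basis states -/

section Fan

set_option linter.unusedSectionVars false

variable {Q : Type} [DecidableEq Q] [Fintype Q]

lemma fanMap_of_not_target {P : Q → Bool} {R : Q → Q → Bool} {t : Q}
    (h : ∀ a, P a = true → R a t = false) (b : Q → Bool) : fanMap P R b t = b t := by
  unfold fanMap
  have : ¬ ∃ a, P a = true ∧ R a t = true ∧ b a = true := by
    rintro ⟨a, h1, h2, _⟩
    simp [h a h1] at h2
  simp [this]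

lemma fanMap_of_control {P : Q → Bool} {R : Q → Q → Bool} (hs : (LayerSpec.fan P R).WF)
    {a : Q} (ha : P a = true) (b : Q → Bool) : fanMap P R b a = b a := by
  apply fanMap_of_not_target
  intro a' ha'
  by_contra h
  have := hs.1 a' a ha' (by simpa using h)
  simp [ha] at this

lemma fanMap_of_rel {P : Q → Bool} {R : Q → Q → Bool} (hs : (LayerSpec.fan P R).WF)
    {a t : Q} (ha : P a = true) (hR : R a t = true) (b : Q → Bool) :
    fanMap P R b t = xor (b t) (b a) := by
  unfold fanMap
  congr 1
  have : (∃ a, P a = true ∧ R a t = true ∧ b a = true) ↔ b a = true := by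
    constructor
    · rintro ⟨a', h1, h2, h3⟩
      rwa [hs.2 a a' t ha h1 hR h2]
    · intro h; exact ⟨a, ha, hR, h⟩
  simp [this]

/-- Controls are not altered by the map, so the second application adds the same bits again. -/
lemma fanMap_fanMap {P : Q → Bool} {R : Q → Q → Bool} (hs : (LayerSpec.fan P R).WF)
    (b : Q → Bool) : fanMap P R (fanMap P R b) = b := by
  have h : ∀ t, (∃ a, P a = true ∧ R a t = true ∧ fanMap P R b a = true) ↔
      ∃ a, P a = true ∧ R a t = true ∧ b a = true := by
    intro t
    apply exists_congr
    intro a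
    apply and_congr_right
    intro ha
    rw [fanMap_of_control hs ha]
  funext t
  change xor (fanMap P R b t) (decide (∃ a, P a = true ∧ R a t = true ∧ fanMap P R b a = true)) = _
  simp only [h t]
  simp [fanMap]

/-- A product over the targets of a relation is a product over the controls. -/
lemma prod_fiber {M : Type} [CommMonoid M] {Z C : Q → Bool} {r : Q → Q → Bool}
    (hr : ∀ z c, r z c = true → Z z = true ∧ C c = true)
    (hu : ∀ c, C c = true → ∃! z, r z c = true) (g : Q → M) :
    ∏ c with C c = true, g c = ∏ z with Z z = true, ∏ c with r z c = true, g c := by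
  classical
  rw [Finset.prod_comm' (s' := fun c => Finset.univ.filter fun z => r z c = true)
    (t' := Finset.univ.filter fun c => C c = true)]
  · refine Finset.prod_congr rfl fun c hc => ?_
    rw [Finset.mem_filter] at hc
    obtain ⟨z, hz, hz'⟩ := hu c hc.2
    have : (Finset.univ.filter fun z => r z c = true) = {z} := by
      ext x
      simp only [Finset.mem_filter, Finset.mem_univ, true_and, Finset.mem_singleton]
      exact ⟨fun h => hz' x h, fun h => h ▸ hz⟩
    rw [this, Finset.prod_singleton]
  · intro x y
    simp only [Finset.mem_filter, Finset.mem_univ, true_and]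
    exact ⟨fun h => ⟨h.2, (hr x y h.2).2⟩, fun h => ⟨(hr x y h.1).1, h.1⟩⟩

lemma finset_prod_ite_pow {M : Type} [CommMonoid M] (s : Finset Q) (p : Q → Prop) [DecidablePred p]
    (x : M) : ∏ c ∈ s, (if p c then x else 1) = x ^ (s.filter p).card := by
  rw [Finset.prod_ite, Finset.prod_const, Finset.prod_const_one, mul_one]

end Fan

/-! ### Rotation of qubits by the weight of other qubits -/

/-- The qubits `Z` are rotated by multiples of the weight of the qubits `I`, with the help of the
qubits `C`. -/
structure Stage (Q : Type) : Type where
  I : Q → Bool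
  Z : Q → Bool
  C : Q → Bool
  rI : Q → Q → Bool
  rZ : Q → Q → Bool
  rel_I : ∀ i c, rI i c = true → I i = true ∧ C c = true
  rel_Z : ∀ z c, rZ z c = true → Z z = true ∧ C c = true
  not_IC : ∀ q, I q = true → C q = false
  not_ZC : ∀ q, Z q = true → C q = false
  not_IZ : ∀ q, I q = true → Z q = false
  uniq_I : ∀ i i' c, rI i c = true → rI i' c = true → i = i'
  uniq_Z : ∀ c, C c = true → ∃! z, rZ z c = true

namespace Stage

set_option linter.unusedSectionVars false

variable {Q : Type} (S : Stage Q)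

/-- Each copy in C first holds the bit of its z and is rotated by θ; after its input has been added
it is rotated back. A zero input makes the two rotations cancel. The remaining fan-outs clear the
copies. -/
def specs : List (LayerSpec Q) :=
  [.had S.Z, .fan S.Z S.rZ, .rot S.C, .fan S.I S.rI, .rotInv S.C, .fan S.I S.rI, .fan S.Z S.rZ,
    .had S.Z]

/-- The layers of `specs` in reverse order with inverted rotations; the effect is that of the stage
with -θ. -/
def invSpecs : List (LayerSpec Q) :=
  [.had S.Z, .fan S.Z S.rZ, .fan S.I S.rI, .rot S.C, .fan S.I S.rI, .rotInv S.C, .fan S.Z S.rZ,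
    .had S.Z]

lemma wf_Z : (LayerSpec.fan S.Z S.rZ).WF := by
  refine ⟨fun a t _ hR => ?_, fun a a' t _ _ h1 h2 => ?_⟩
  · have := (S.rel_Z a t hR).2
    by_contra h
    simp [S.not_ZC t (by simpa using h)] at this
  · exact (S.uniq_Z t (S.rel_Z a t h1).2).unique h1 h2

lemma wf_I : (LayerSpec.fan S.I S.rI).WF := by
  refine ⟨fun a t _ hR => ?_, fun a a' t _ _ h1 h2 => S.uniq_I a a' t h1 h2⟩
  have := (S.rel_I a t hR).2
  by_contra h
  simp [S.not_IC t (by simpa using h)] at this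

variable [DecidableEq Q] [Fintype Q]

/-- The number of rotations on copies of `z`. -/
def mult (z : Q) (b : Q → Bool) : ℕ :=
  (Finset.univ.filter fun c => S.rZ z c = true ∧ ∃ i, S.rI i c = true ∧ b i = true).card

/-- The phase of a rotated qubit. -/
noncomputable def qPhase (θ : ℝ) (z : Q) (b : Q → Bool) : ℂ :=
  Complex.exp ((if b z then θ * S.mult z b else -(θ * S.mult z b) : ℝ) * Complex.I)

noncomputable def phase (θ : ℝ) (b : Q → Bool) : ℂ := ∏ z with S.Z z = true, S.qPhase θ z b

/-- The operator of the stage if the qubits `C` are clean. -/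
noncomputable def op (u : List Q) (θ : ℝ) (ψ : State Q) : State Q :=
  hadList (u.filter S.Z) (diag (S.phase θ) (hadList (u.filter S.Z) ψ))

lemma phase_mul_neg (θ : ℝ) (b : Q → Bool) : S.phase (-θ) b * S.phase θ b = 1 := by
  rw [phase, phase, ← Finset.prod_mul_distrib]
  apply Finset.prod_eq_one
  intro z _
  rw [qPhase, qPhase, ← Complex.exp_add, ← add_mul]
  split_ifs <;> simp

lemma op_neg_op (u : List Q) (θ : ℝ) (ψ : State Q) : S.op u (-θ) (S.op u θ ψ) = ψ := by
  unfold op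
  rw [hadList_hadList, diag_diag]
  have : (fun b => S.phase (-θ) b * S.phase θ b) = fun _ => 1 := by
    funext b; exact S.phase_mul_neg θ b
  rw [this]
  have h1 : ∀ φ : State Q, diag (fun _ => 1) φ = φ := fun φ => by funext b; simp [diag]
  rw [h1, hadList_hadList]

/-- The phase that the rotations of the copies add up to. -/
lemma phase_eq (θ : ℝ) {b : Q → Bool} (hb : ∀ c, S.C c = true → b c = false) :
    rzProd θ S.C (fanMap S.Z S.rZ b) *
      rzProd (-θ) S.C (fanMap S.I S.rI (fanMap S.Z S.rZ b)) = S.phase θ b := by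
  rw [rzProd, rzProd, ← Finset.prod_mul_distrib, phase, prod_fiber S.rel_Z S.uniq_Z]
  refine Finset.prod_congr rfl fun z hz => ?_
  rw [Finset.mem_filter] at hz
  have hx : ∀ c, S.rZ z c = true → fanMap S.Z S.rZ b c = b z := by
    intro c hc
    rw [fanMap_of_rel S.wf_Z hz.2 hc, hb c (S.rel_Z z c hc).2, Bool.false_xor]
  have hy : ∀ c, S.rZ z c = true → fanMap S.I S.rI (fanMap S.Z S.rZ b) c =
      xor (b z) (decide (∃ i, S.rI i c = true ∧ b i = true)) := by
    intro c hc
    rw [fanMap, hx c hc]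
    congr 2
    rw [eq_iff_iff]
    apply exists_congr
    intro i
    constructor
    · rintro ⟨h1, h2, h3⟩
      rw [fanMap_of_not_target] at h3
      · exact ⟨h2, h3⟩
      · intro a ha
        by_contra h
        have := S.not_IC i h1
        simp [(S.rel_Z a i (by simpa using h)).2] at this
    · rintro ⟨h2, h3⟩
      refine ⟨(S.rel_I i c h2).1, h2, ?_⟩
      rw [fanMap_of_not_target]
      · exact h3
      · intro a ha
        by_contra h
        have := S.not_IC i (S.rel_I i c h2).1
        simp [(S.rel_Z a i (by simpa using h)).2] at this
  -- One copy contributes θ·z - θ·(z ⊕ x): nothing for x = 0, and θ or -θ, according to z, for x =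
  -- 1. The symmetric sign is what later produces a cosine.
  have hfac : ∀ c ∈ Finset.univ.filter (fun c => S.rZ z c = true),
      rzFactor θ (fanMap S.Z S.rZ b c) *
        rzFactor (-θ) (fanMap S.I S.rI (fanMap S.Z S.rZ b) c) =
      if ∃ i, S.rI i c = true ∧ b i = true then
        Complex.exp ((if b z then θ else -θ : ℝ) * Complex.I) else 1 := by
    intro c hc
    rw [Finset.mem_filter] at hc
    rw [hx c hc.2, hy c hc.2]
    unfold rzFactor
    by_cases hi : ∃ i, S.rI i c = true ∧ b i = true <;> cases b z <;> simp [hi, ← Complex.exp_add]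
  rw [Finset.prod_congr rfl hfac, finset_prod_ite_pow, Finset.filter_filter, ← Complex.exp_nat_mul,
    qPhase, mult]
  congr 1
  split_ifs <;> push_cast <;> ring

/-- The fan-outs cancel in pairs. What is left between the Hadamard gates is a diagonal operator,
the rotations evaluated at permuted basis states, and it equals the phase as long as the copies are
clean. -/
lemma foldl_specs (θ : ℝ) {u : List Q} (hu : u.Nodup) (hm : ∀ q, q ∈ u) {ψ : State Q}
    (hψ : CleanOn (fun q => S.C q = true) ψ) :
    S.specs.foldl (applySpec θ u) ψ = S.op u θ ψ := by
  simp only [specs, List.foldl_cons, List.foldl_nil, applySpec_had, applySpec_fan θ hu hm S.wf_Z,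
    applySpec_fan θ hu hm S.wf_I, applySpec_rot θ hu hm, applySpec_rotInv θ hu hm]
  rw [op]
  congr 1
  rw [← diag_congr_clean (CleanOn.hadList _ hψ) (fun b hb => S.phase_eq θ hb)]
  · funext b
    simp only [diag, fanMap_fanMap S.wf_Z, fanMap_fanMap S.wf_I]
    ring
  · intro q hq h
    have := S.not_ZC q (List.mem_filter.1 hq).2
    simp [h] at this

lemma foldl_invSpecs (θ : ℝ) {u : List Q} (hu : u.Nodup) (hm : ∀ q, q ∈ u) {ψ : State Q}
    (hψ : CleanOn (fun q => S.C q = true) ψ) :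
    S.invSpecs.foldl (applySpec θ u) ψ = S.op u (-θ) ψ := by
  simp only [invSpecs, List.foldl_cons, List.foldl_nil, applySpec_had, applySpec_fan θ hu hm S.wf_Z,
    applySpec_fan θ hu hm S.wf_I, applySpec_rot θ hu hm, applySpec_rotInv θ hu hm]
  rw [op]
  congr 1
  rw [← diag_congr_clean (CleanOn.hadList _ hψ) (fun b hb => S.phase_eq (-θ) hb)]
  · funext b
    simp only [diag, fanMap_fanMap S.wf_Z, fanMap_fanMap S.wf_I, neg_neg]
    ring
  · intro q hq h
    have := S.not_ZC q (List.mem_filter.1 hq).2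
    simp [h] at this

/-- `mult` only depends on the qubits `I`. -/
lemma mult_congr {b b' : Q → Bool} (h : ∀ i, S.I i = true → b i = b' i) (z : Q) :
    S.mult z b = S.mult z b' := by
  unfold mult
  congr 1
  apply Finset.filter_congr
  intro c _
  apply and_congr_right
  intro _
  apply exists_congr
  intro i
  apply and_congr_right
  intro hi
  rw [h i (S.rel_I i c hi).1]

lemma mult_flip {q : Q} (hq : S.I q = false) (z : Q) (b : Q → Bool) :
    S.mult z (flipBit q b) = S.mult z b :=
  S.mult_congr (fun i hi => flipBit_ne (fun e => by simp [← e, hi] at hq) b) z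

lemma qPhase_flip (θ : ℝ) {q z : Q} (hq : S.I q = false) (hqz : q ≠ z) (b : Q → Bool) :
    S.qPhase θ z (flipBit q b) = S.qPhase θ z b := by
  rw [qPhase, qPhase, S.mult_flip hq, flipBit_ne (Ne.symm hqz)]

lemma I_of_Z {q : Q} (h : S.Z q = true) : S.I q = false := by
  by_contra h'
  have := S.not_IZ q (by simpa using h')
  simp [h] at this

/-- The amplitude of the states in which all rotated qubits are zero. -/
lemma op_apply_zero (θ : ℝ) {u : List Q} (hu : u.Nodup) (hm : ∀ q, q ∈ u) {ψ : State Q}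
    (hψ : CleanOn (fun q => S.Z q = true) ψ) {b : Q → Bool}
    (hb : ∀ q, S.Z q = true → b q = false) :
    S.op u θ ψ b = (∏ z with S.Z z = true, (Real.cos (θ * S.mult z b) : ℂ)) * ψ b := by
  have hZ : ∀ q ∈ u.filter S.Z, S.Z q = true := fun q hq => (List.mem_filter.1 hq).2
  -- The phase of a rotated qubit does not depend on the other rotated qubits, so the stage is a
  -- product of operators, one for each of them.
  have e1 : S.op u θ ψ = opList (fun q φ => applyHad q (diag (S.qPhase θ q) (applyHad q φ)))
      (u.filter S.Z) ψ := by
    rw [← hadList_conj (O := fun q => diag (S.qPhase θ q)) (hu.filter _)]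
    · rw [op, opList_diag]
      congr 2
      funext b
      exact (prod_filter_map hu hm _ _).symm
    · intro q hq q' hq' hne φ
      exact applyHad_diag (fun b => S.qPhase_flip θ (S.I_of_Z (hZ q hq)) hne b) φ
  rw [e1, ← prod_filter_map hu hm]
  have hnd := hu.filter S.Z
  generalize u.filter S.Z = l at *
  clear e1
  have hsupp : ∀ q ∈ l, ∀ b', b' q = true → ψ b' = 0 := by
    intro q hq b' hb'
    by_contra h0
    have := hψ b' h0 q (hZ q hq)
    simp [hb'] at this
  have hbl : ∀ q ∈ l, b q = false := fun q hq => hb q (hZ q hq)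
  clear hψ hb
  induction l generalizing ψ with
  | nil => simp
  | cons a l ih =>
    rw [List.nodup_cons] at hnd
    have ha := hZ a List.mem_cons_self
    have hval : ∀ b', applyHad a (diag (S.qPhase θ a) (applyHad a ψ)) b' =
        invSqrtTwo * (sgn (b' a) * (S.qPhase θ a b' * (invSqrtTwo * (sgn (b' a) * ψ b' +
          ψ (flipBit a b')))) + S.qPhase θ a (flipBit a b') * (invSqrtTwo *
          (-sgn (b' a) * ψ (flipBit a b') + ψ b'))) := by
      intro b'
      simp only [applyHad_eq, diag, flipBit_same, sgn_not, flipBit_flipBit]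
    rw [opList_cons, ih (fun q hq => hZ q (List.mem_cons_of_mem _ hq)) hnd.2 ?_
      (fun q hq => hbl q (List.mem_cons_of_mem _ hq)), List.map_cons, List.prod_cons]
    · have hba : b a = false := hbl a List.mem_cons_self
      have h1 : ψ (flipBit a b) = 0 := hsupp a List.mem_cons_self _ (by simp [hba])
      rw [hval, h1, hba]
      simp only [qPhase, flipBit_same, S.mult_flip (S.I_of_Z ha), hba]
      simp only [sgn_false, Bool.not_false, if_true, Bool.false_eq_true, if_false]
      -- The two paths from zero to zero carry the phases exp(iα) and exp(-iα); their average is the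
      -- cosine.
      rw [Complex.ofReal_cos, Complex.cos]
      push_cast
      have h2 := invSqrtTwo_sq
      linear_combination ((Complex.exp (-(θ * (S.mult a b : ℂ)) * Complex.I) +
        Complex.exp ((θ * (S.mult a b : ℂ)) * Complex.I)) * ψ b *
        (List.map (fun z => Complex.cos (θ * (S.mult z b : ℂ))) l).prod) * h2
    -- The operator of the qubit a does not move amplitude to assignments in which a remaining qubit
    -- is one, so the induction can continue.
    · intro q hq b' hb'
      have hqa : q ≠ a := fun e => hnd.1 (e ▸ hq)
      have h1 := hsupp q (List.mem_cons_of_mem _ hq) b' hb'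
      have h2 := hsupp q (List.mem_cons_of_mem _ hq) (flipBit a b') (by rw [flipBit_ne hqa, hb'])
      rw [hval, h1, h2]
      simp

/-- The stage does not act if all inputs are zero. -/
lemma op_apply_of_zero (θ : ℝ) (u : List Q) (ψ : State Q) {b : Q → Bool}
    (hb : ∀ q, S.I q = true → b q = false) : S.op u θ ψ b = ψ b := by
  -- The Hadamard gates reach only assignments with the same inputs, and with zero inputs all
  -- multiplicities, hence all phases, are trivial there.
  have h : S.op u θ ψ b = hadList (u.filter S.Z) (hadList (u.filter S.Z) ψ) b := by
    apply hadList_congr_on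
    intro b' hb'
    have : S.phase θ b' = 1 := by
      apply Finset.prod_eq_one
      intro z _
      have : S.mult z b' = 0 := by
        rw [mult, Finset.card_eq_zero, Finset.filter_eq_empty_iff]
        rintro c _ ⟨_, i, hi, hbi⟩
        have hI := (S.rel_I i c hi).1
        rw [hb' i (fun h => by
          have := (List.mem_filter.1 h).2; simp [S.not_IZ i hI] at this), hb i hI] at hbi
        simp at hbi
      simp [qPhase, this]
    rw [diag, this, one_mul]
  rw [h, hadList_hadList]

lemma sum_norm_sq_op (θ : ℝ) (u : List Q) (ψ : State Q) :
    ∑ b, ‖S.op u θ ψ b‖ ^ 2 = ∑ b, ‖ψ b‖ ^ 2 := by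
  rw [op, sum_norm_sq_hadList, ← sum_norm_sq_hadList (u.filter S.Z) ψ]
  refine Finset.sum_congr rfl fun b _ => ?_
  have : ‖S.phase θ b‖ = 1 := by
    rw [phase, norm_prod]
    apply Finset.prod_eq_one
    intro z _
    rw [qPhase, Complex.norm_exp_ofReal_mul_I]
  rw [diag, norm_mul, this, one_mul]

lemma inn_op (θ : ℝ) (u : List Q) (φ ψ : State Q) :
    inn φ (S.op u (-θ) ψ) = inn (S.op u θ φ) ψ := by
  unfold op
  rw [inn_hadList, inn_diag, inn_hadList]
  congr 4
  funext b
  rw [phase, phase, map_prod]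
  refine Finset.prod_congr rfl fun z _ => ?_
  rw [qPhase, qPhase, ← Complex.exp_conj]
  congr 1
  rw [map_mul, Complex.conj_ofReal, Complex.conj_I]
  split_ifs <;> push_cast <;> ring

/-- Applied to the controlled sign of the Or, this carries the target through the stages; applied to
the indicator of nonzero inputs, it shows that the stages preserve the support. -/
lemma op_diag (θ : ℝ) (u : List Q) {f : (Q → Bool) → ℂ}
    (hf : ∀ q, S.Z q = true → ∀ b, f (flipBit q b) = f b) (ψ : State Q) :
    S.op u θ (diag f ψ) = diag f (S.op u θ ψ) := by
  have h : ∀ q ∈ u.filter S.Z, ∀ b, f (flipBit q b) = f b :=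
    fun q hq => hf q (List.mem_filter.1 hq).2
  unfold op
  rw [hadList_diag h, diag_diag, ← hadList_diag h, diag_diag]
  simp only [mul_comm]

lemma cleanOn_op {T : Q → Prop} (hT : ∀ q, S.Z q = true → ¬ T q) (θ : ℝ) (u : List Q)
    {ψ : State Q} (h : CleanOn T ψ) : CleanOn T (S.op u θ ψ) := by
  have hl : ∀ q ∈ u.filter S.Z, ¬ T q := fun q hq => hT q (List.mem_filter.1 hq).2
  exact CleanOn.hadList hl ((CleanOn.hadList hl h).diag _)

end Stage

/-! ### The exact Or of few qubits -/

/-- The parities of the qubits `Y` over the subsets that are given by the targets `E` of the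
qubits `D` control rotations of `o`. -/
structure Parities (Q : Type) : Type where
  o : Q
  Y : Q → Bool
  D : Q → Bool
  E : Q → Bool
  rY : Q → Q → Bool
  rD : Q → Q → Bool
  rel_Y : ∀ y e, rY y e = true → Y y = true ∧ E e = true
  rel_D : ∀ d e, rD d e = true → D d = true ∧ E e = true
  uniq_Y : ∀ y y' e, rY y e = true → rY y' e = true → y = y'
  uniq_D : ∀ e, E e = true → ∃! d, rD d e = true
  not_YE : ∀ q, Y q = true → E q = false
  not_YD : ∀ q, Y q = true → D q = false
  not_DE : ∀ q, D q = true → E q = false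
  not_oD : D o = false
  not_oE : E o = false

namespace Parities

set_option linter.unusedSectionVars false

variable {Q : Type} (F : Parities Q) [DecidableEq Q]

def isO (q : Q) : Bool := decide (q = F.o)

/-- Hadamard gates on both sides reverse the direction of a fan-out: the qubits E become controls,
and each d receives the parity of its qubits E. This is parity in constant depth. -/
def parSpecs : List (LayerSpec Q) := [.had F.D, .had F.E, .fan F.D F.rD, .had F.E, .had F.D]

/-- With v the parity at d, the qubit d holds o, then o ⊕ v, then v at the three rotations, which
are by θ, -θ and θ. Since o + v - (o ⊕ v) = 2ov, the output qubit acquires 2θ for every odd parity.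
-/
def specs : List (LayerSpec Q) :=
  [.fan F.isO (fun _ => F.D), .rot F.D, .fan F.Y F.rY] ++ F.parSpecs ++
  [.rotInv F.D, .fan F.isO (fun _ => F.D), .rot F.D] ++ F.parSpecs ++ [.fan F.Y F.rY]

lemma wf_O : (LayerSpec.fan F.isO (fun _ => F.D)).WF := by
  refine ⟨fun a t _ hR => ?_, fun a a' t h h' _ _ => ?_⟩
  · simp only [isO, decide_eq_false_iff_not]
    rintro rfl
    simp [F.not_oD] at hR
  · simp only [isO, decide_eq_true_eq] at h h'
    rw [h, h']

lemma wf_Y : (LayerSpec.fan F.Y F.rY).WF := by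
  refine ⟨fun a t _ hR => ?_, fun a a' t _ _ h1 h2 => F.uniq_Y a a' t h1 h2⟩
  have := (F.rel_Y a t hR).2
  by_contra h
  simp [F.not_YE t (by simpa using h)] at this

lemma wf_D : (LayerSpec.fan F.D F.rD).WF := by
  refine ⟨fun a t _ hR => ?_, fun a a' t _ _ h1 h2 => ?_⟩
  · have := (F.rel_D a t hR).2
    by_contra h
    simp [F.not_DE t (by simpa using h)] at this
  · exact (F.uniq_D t (F.rel_D a t h1).2).unique h1 h2

variable [Fintype Q]

/-- The parity of the targets of `d`. -/
def par (d : Q) (b : Q → Bool) : Bool :=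
  decide (Odd (Finset.univ.filter fun e => F.rD d e = true ∧ b e = true).card)

/-- The parity of the qubits `Y` that correspond to the targets of `d`. -/
def val (d : Q) (b : Q → Bool) : Bool :=
  decide (Odd (Finset.univ.filter fun e => F.rD d e = true ∧ ∃ y, F.rY y e = true ∧ b y = true).card)

/-- The number of odd parities. -/
def cnt (b : Q → Bool) : ℕ := (Finset.univ.filter fun d => F.D d = true ∧ F.val d b = true).card

def parMap (b : Q → Bool) : Q → Bool := fun q => if F.D q = true then xor (b q) (F.par q b) else b q

noncomputable def phase (θ : ℝ) (b : Q → Bool) : ℂ :=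
  Complex.exp ((if b F.o then 2 * θ * F.cnt b else 0 : ℝ) * Complex.I)

lemma prod_sgn (s : Finset Q) (x : Bool) (p : Q → Bool) :
    ∏ e ∈ s, sgn (x && p e) = sgn (x && decide (Odd (s.filter fun e => p e = true).card)) := by
  cases x
  · simp
  · simp only [Bool.true_and]
    have : ∀ e ∈ s, sgn (p e) = if p e = true then -1 else 1 := fun e _ => by cases p e <;> simp
    rw [Finset.prod_congr rfl this, finset_prod_ite_pow]
    by_cases h : Odd (s.filter fun e => p e = true).card
    · simp [h, h.neg_one_pow]
    · simp [h, (Nat.not_odd_iff_even.1 h).neg_one_pow]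

/-- The inner Hadamard gates turn negations of e controlled by d into signs (-1)^(d·e); the signs of
one d combine to (-1)^(d·parity), and the outer Hadamard gates turn this into a negation of d
controlled by the parity. -/
lemma foldl_parSpecs (θ : ℝ) {u : List Q} (hu : u.Nodup) (hm : ∀ q, q ∈ u) (ψ : State Q) :
    F.parSpecs.foldl (applySpec θ u) ψ = fun b => ψ (F.parMap b) := by
  simp only [parSpecs, List.foldl_cons, List.foldl_nil, applySpec_had,
    applySpec_fan θ hu hm F.wf_D]
  have hD : ∀ q ∈ u.filter F.D, F.D q = true := fun q hq => (List.mem_filter.1 hq).2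
  have hE : ∀ q ∈ u.filter F.E, F.E q = true := fun q hq => (List.mem_filter.1 hq).2
  have hpar : ∀ q, ∀ q' ∈ u.filter F.D, ∀ b, F.par q (flipBit q' b) = F.par q b := by
    intro q q' hq' b
    unfold par
    congr 3
    apply Finset.filter_congr
    intro e _
    apply and_congr_right
    intro he
    rw [flipBit_ne]
    rintro rfl
    have := (F.rel_D q e he).2
    simp [F.not_DE e (hD e hq')] at this
  let p : Q → (Q → Bool) → Bool := fun e b => decide (∃ d, F.D d = true ∧ F.rD d e = true ∧ b d = true)
  have hp : ∀ q, ∀ q' ∈ u.filter F.E, ∀ b, p q (flipBit q' b) = p q b := by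
    intro q q' hq' b
    simp only [p]
    congr 1
    rw [eq_iff_iff]
    apply exists_congr
    intro d
    apply and_congr_right
    intro hd
    rw [flipBit_ne]
    rintro rfl
    have := F.not_DE d hd
    simp [hE d hq'] at this
  -- The fan-out as a product of one controlled negation for each target, the form required by
  -- `hadList_conj`.
  have hfan : ∀ φ : State Q, (fun b => φ (fanMap F.D F.rD b)) =
      opList (fun q φ b => φ (Function.update b q (xor (b q) (p q b)))) (u.filter F.E) φ := by
    intro φ
    rw [opList_xor (hu.filter _) hp]
    funext b
    congr 1
    funext e
    simp only [xorOn, List.mem_filter, hm, true_and]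
    by_cases he : F.E e = true
    · rw [if_pos he]; rfl
    · rw [if_neg he]
      apply fanMap_of_not_target
      intro a _
      by_contra h
      exact he (F.rel_D a e (by simpa using h)).2
  -- Signs are symmetric in control and target, so they can be regrouped by the control d.
  have hmid : ∀ φ : State Q, hadList (u.filter F.E)
      (fun b => hadList (u.filter F.E) φ (fanMap F.D F.rD b)) =
      opList (fun d => diag fun b => sgn (b d && F.par d b)) (u.filter F.D) φ := by
    intro φ
    rw [hfan, hadList_conj (hu.filter _)]
    · rw [opList_congr (O' := fun q => diag fun b => sgn (b q && p q b))
        (fun q hq φ => had_xor_had (hp q q hq) φ)]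
      rw [opList_diag, opList_diag]
      congr 1
      funext b
      rw [prod_filter_map hu hm, prod_filter_map hu hm, prod_fiber F.rel_D F.uniq_D]
      refine Finset.prod_congr rfl fun d _ => ?_
      have : ∀ e ∈ Finset.univ.filter (fun e => F.rD d e = true),
          sgn (b e && p e b) = sgn (b d && b e) := by
        intro e he
        rw [Finset.mem_filter] at he
        have : p e b = b d := by
          simp only [p]
          have h : (∃ d, F.D d = true ∧ F.rD d e = true ∧ b d = true) ↔ b d = true := by
            constructor
            · rintro ⟨d', _, h2, h3⟩
              rwa [(F.uniq_D e (F.rel_D d e he.2).2).unique he.2 h2]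
            · intro h; exact ⟨d, (F.rel_D d e he.2).1, he.2, h⟩
          simp [h]
        rw [this, Bool.and_comm]
      rw [Finset.prod_congr rfl this, prod_sgn, Finset.filter_filter]
      rfl
    · intro q hq q' hq' hne φ
      funext b
      have hqq : ∀ b, Function.update (flipBit q b) q' (xor (flipBit q b q') (p q' (flipBit q b))) =
          flipBit q (Function.update b q' (xor (b q') (p q' b))) := by
        intro b
        rw [hp q' q hq, flipBit_ne (Ne.symm hne)]
        funext x
        by_cases h1 : x = q'
        · subst h1; simp [flipBit_ne (Ne.symm hne)]
        · by_cases h2 : x = q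
          · subst h2; simp [h1]
          · simp [h1, flipBit_ne h2]
      simp only [applyHad_eq, hqq]
      rw [Function.update_of_ne hne]
  -- The parity of d does not involve any qubit of D, so the outer Hadamard gates again act
  -- separately for each d.
  rw [hmid, hadList_conj (hu.filter _)]
  · rw [opList_congr (fun q hq φ => had_sgn_had (hpar q q hq) φ), opList_xor (hu.filter _) hpar]
    funext b
    congr 1
    funext q
    simp only [xorOn, parMap, List.mem_filter, hm, true_and]
  · intro q hq q' hq' hne φ
    apply applyHad_diag
    intro b
    rw [hpar q' q hq, flipBit_ne (Ne.symm hne)]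

lemma not_rel_of_D {q : Q} (hq : F.D q = true) (a : Q) : F.rY a q = false := by
  by_contra h
  have := (F.rel_Y a q (by simpa using h)).2
  simp [F.not_DE q hq] at this

lemma fanMap_O (b : Q → Bool) (q : Q) :
    fanMap F.isO (fun _ => F.D) b q = if F.D q = true then xor (b q) (b F.o) else b q := by
  have ho : F.isO F.o = true := by simp [isO]
  split_ifs with h
  · exact fanMap_of_rel F.wf_O ho h b
  · exact fanMap_of_not_target (fun _ _ => by simpa using h) b

lemma par_congr {d : Q} {b b' : Q → Bool} (h : ∀ e, F.E e = true → b e = b' e) :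
    F.par d b = F.par d b' := by
  unfold par
  congr 3
  apply Finset.filter_congr
  intro e _
  apply and_congr_right
  intro he
  rw [h e (F.rel_D d e he).2]

lemma fanMap_O_of_E (b : Q → Bool) {e : Q} (he : F.E e = true) :
    fanMap F.isO (fun _ => F.D) b e = b e := by
  rw [fanMap_O, if_neg]
  intro h
  simp [F.not_DE e h] at he

/-- Adding o to the qubits D affects neither the qubits E nor o itself, so the parities added before
and after cancel. -/
lemma par_par_O (b : Q → Bool) :
    F.parMap (fanMap F.isO (fun _ => F.D) (F.parMap b)) = fanMap F.isO (fun _ => F.D) b := by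
  have hE : ∀ b e, F.E e = true → F.parMap b e = b e := by
    intro b e he
    rw [parMap, if_neg]
    intro h
    simp [F.not_DE e h] at he
  have ho : F.parMap b F.o = b F.o := by simp [parMap, F.not_oD]
  funext q
  rw [fanMap_O]
  conv_lhs => unfold parMap
  have h1 : F.par q (fanMap F.isO (fun _ => F.D) (F.parMap b)) = F.par q b :=
    F.par_congr fun e he => by rw [F.fanMap_O_of_E _ he, hE b e he]
  change (if F.D q = true then xor (fanMap F.isO (fun _ => F.D) (F.parMap b) q)
    (F.par q (fanMap F.isO (fun _ => F.D) (F.parMap b))) else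
    fanMap F.isO (fun _ => F.D) (F.parMap b) q) = _
  rw [h1, fanMap_O, ho]
  by_cases h : F.D q = true
  · simp only [h, if_true, parMap]
    cases b q <;> cases F.par q b <;> cases b F.o <;> rfl
  · simp [h, parMap]

lemma fan_O_fan (b : Q → Bool) :
    fanMap F.Y F.rY (fanMap F.isO (fun _ => F.D) (fanMap F.Y F.rY b)) =
      fanMap F.isO (fun _ => F.D) b := by
  have ho : fanMap F.Y F.rY b F.o = b F.o := by
    apply fanMap_of_not_target
    intro a _
    by_contra h
    have := (F.rel_Y a F.o (by simpa using h)).2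
    simp [F.not_oE] at this
  have hc : fanMap F.isO (fun _ => F.D) (fanMap F.Y F.rY b) =
      fanMap F.Y F.rY (fanMap F.isO (fun _ => F.D) b) := by
    funext q
    rw [fanMap_O, ho]
    by_cases h : F.D q = true
    · rw [if_pos h, fanMap_of_not_target (fun a _ => F.not_rel_of_D h a),
        fanMap_of_not_target (fun a _ => F.not_rel_of_D h a), fanMap_O, if_pos h]
    · rw [if_neg h]
      unfold fanMap
      have : ¬ ∃ a, F.isO a = true ∧ F.D q = true ∧ b a = true := by
        rintro ⟨_, _, h', _⟩; exact h h'
      simp only [this, decide_false, Bool.xor_false]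
      congr 2
      rw [eq_iff_iff]
      apply exists_congr
      intro a
      apply and_congr_right
      intro ha
      have : ¬ ∃ a', F.isO a' = true ∧ F.D a = true ∧ b a' = true := by
        rintro ⟨_, _, h', _⟩; simp [F.not_YD a ha] at h'
      simp only [this, decide_false, Bool.xor_false]
  rw [hc, fanMap_fanMap F.wf_Y]

/-- For each d the exponents are v, -(v ⊕ o) and o times θ, with sum 2θ·v·o. -/
lemma phase_eq (θ : ℝ) {b : Q → Bool} (hD : ∀ q, F.D q = true → b q = false)
    (hE : ∀ q, F.E q = true → b q = false) :
    rzProd θ F.D (F.parMap (fanMap F.Y F.rY b)) *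
      (rzProd (-θ) F.D (fanMap F.isO (fun _ => F.D) (F.parMap (fanMap F.Y F.rY b))) *
        rzProd θ F.D (fanMap F.isO (fun _ => F.D) b)) = F.phase θ b := by
  rw [rzProd, rzProd, rzProd, ← Finset.prod_mul_distrib, ← Finset.prod_mul_distrib]
  have hv : ∀ d, F.D d = true → F.parMap (fanMap F.Y F.rY b) d = F.val d b := by
    intro d hd
    rw [parMap, if_pos hd, fanMap_of_not_target (fun a _ => F.not_rel_of_D hd a), hD d hd,
      Bool.false_xor, par, val]
    congr 3
    apply Finset.filter_congr
    intro e _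
    apply and_congr_right
    intro he
    rw [fanMap, hE e (F.rel_D d e he).2]
    simp only [Bool.false_xor, decide_eq_true_eq]
    apply exists_congr
    intro y
    constructor
    · rintro ⟨_, h2, h3⟩; exact ⟨h2, h3⟩
    · rintro ⟨h2, h3⟩; exact ⟨(F.rel_Y y e h2).1, h2, h3⟩
  have ho : F.parMap (fanMap F.Y F.rY b) F.o = b F.o := by
    rw [parMap, if_neg (by simp [F.not_oD])]
    apply fanMap_of_not_target
    intro a _
    by_contra h
    have := (F.rel_Y a F.o (by simpa using h)).2
    simp [F.not_oE] at this
  have hfac : ∀ d ∈ Finset.univ.filter (fun d => F.D d = true),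
      rzFactor θ (F.parMap (fanMap F.Y F.rY b) d) *
        (rzFactor (-θ) (fanMap F.isO (fun _ => F.D) (F.parMap (fanMap F.Y F.rY b)) d) *
        rzFactor θ (fanMap F.isO (fun _ => F.D) b d)) =
      if F.val d b = true then Complex.exp ((if b F.o then 2 * θ else 0 : ℝ) * Complex.I) else 1 := by
    intro d hd
    have hd := (Finset.mem_filter.1 hd).2
    rw [fanMap_O, fanMap_O, if_pos hd, if_pos hd, hv d hd, ho, hD d hd]
    unfold rzFactor
    cases F.val d b <;> cases b F.o <;> simp [← Complex.exp_add]
    ring_nf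
  rw [Finset.prod_congr rfl hfac, finset_prod_ite_pow, Finset.filter_filter, ← Complex.exp_nat_mul,
    phase, cnt]
  congr 1
  split_ifs <;> push_cast <;> ring

lemma foldl_specs (θ : ℝ) {u : List Q} (hu : u.Nodup) (hm : ∀ q, q ∈ u) {ψ : State Q}
    (hψ : CleanOn (fun q => F.D q = true ∨ F.E q = true) ψ) :
    F.specs.foldl (applySpec θ u) ψ = diag (F.phase θ) ψ := by
  rw [← diag_congr_clean hψ (fun b hb => F.phase_eq θ (fun q hq => hb q (Or.inl hq))
    (fun q hq => hb q (Or.inr hq)))]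
  simp only [specs, List.foldl_append, F.foldl_parSpecs θ hu hm]
  simp only [List.foldl_cons, List.foldl_nil, applySpec_fan θ hu hm F.wf_Y,
    applySpec_fan θ hu hm F.wf_O, applySpec_rot θ hu hm, applySpec_rotInv θ hu hm]
  funext b
  simp only [diag, par_par_O, fan_O_fan, fanMap_fanMap F.wf_O]
  ring

/-- With y = 0 there is exactly no phase, as one-sided error demands. -/
lemma cnt_eq_zero {b : Q → Bool} (hb : ∀ q, F.Y q = true → b q = false) : F.cnt b = 0 := by
  rw [cnt, Finset.card_eq_zero, Finset.filter_eq_empty_iff]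
  rintro d _ ⟨_, h⟩
  have : (Finset.univ.filter fun e => F.rD d e = true ∧ ∃ y, F.rY y e = true ∧ b y = true) = ∅ := by
    rw [Finset.filter_eq_empty_iff]
    rintro e _ ⟨_, y, hy, hby⟩
    rw [hb y (F.rel_Y y e hy).1] at hby
    simp at hby
  rw [val, this] at h
  simp at h

end Parities

/-! ### The Or circuit -/

/-- The qubits of the Or circuit: two stages of rotations, and the exact Or of the qubits of the
second stage. -/
structure OrLayout (Q : Type) : Type where
  A : Stage Q
  B : Stage Q
  F : Parities Q
  B_I : B.I = A.Z
  F_Y : F.Y = B.Z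
  not_o_AI : A.I F.o = false
  not_o_AZ : A.Z F.o = false
  not_o_AC : A.C F.o = false
  not_o_BZ : B.Z F.o = false
  not_o_BC : B.C F.o = false
  not_AI_BZ : ∀ q, A.I q = true → B.Z q = false
  not_AI_BC : ∀ q, A.I q = true → B.C q = false
  not_AI_D : ∀ q, A.I q = true → F.D q = false
  not_AI_E : ∀ q, A.I q = true → F.E q = false
  not_AZ_D : ∀ q, A.Z q = true → F.D q = false
  not_AZ_E : ∀ q, A.Z q = true → F.E q = false
  not_BZ_AC : ∀ q, B.Z q = true → A.C q = false

namespace OrLayout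

set_option linter.unusedSectionVars false

variable {Q : Type} (O : OrLayout Q) [DecidableEq Q]

/-- Compute the two stages, apply the phase of the exact Or, uncompute; the outer Hadamard gates on
the output qubit turn its phase into a negation. -/
def specs : List (LayerSpec Q) :=
  [.had O.F.isO] ++ O.A.specs ++ O.B.specs ++ O.F.specs ++ O.B.invSpecs ++ O.A.invSpecs ++
    [.had O.F.isO]

lemma specs_wf : ∀ s ∈ O.specs, s.WF := by
  intro s hs
  simp only [specs, Stage.specs, Stage.invSpecs, Parities.specs, Parities.parSpecs,
    List.cons_append, List.nil_append, List.mem_cons, List.not_mem_nil, or_false] at hs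
  have h1 := O.A.wf_Z
  have h2 := O.A.wf_I
  have h3 := O.B.wf_Z
  have h4 := O.B.wf_I
  have h5 := O.F.wf_O
  have h6 := O.F.wf_Y
  have h7 := O.F.wf_D
  rcases hs with h | h | h | h | h | h | h | h | h | h | h | h | h | h | h | h | h | h | h | h | h |
    h | h | h | h | h | h | h | h | h | h | h | h | h | h | h | h | h | h | h | h | h | h | h | h |
    h | h | h | h | h | h <;> rw [h] <;> trivial

variable [Fintype Q]

/-- The Or of the input qubits. -/
def or (b : Q → Bool) : Bool := decide (∃ q, O.A.I q = true ∧ b q = true)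

/-- The ancilla qubits. -/
def anc (q : Q) : Prop := q ≠ O.F.o ∧ O.A.I q = false

/-- The qubits that are clean between the stages. -/
def copy (q : Q) : Prop := O.A.C q = true ∨ O.B.C q = true ∨ O.F.D q = true ∨ O.F.E q = true

lemma not_copy_AZ {q : Q} (h : O.A.Z q = true) : ¬ O.copy q := by
  have h1 := O.A.not_ZC q h
  have h2 := O.B.not_IC q (by rw [O.B_I]; exact h)
  have h3 := O.not_AZ_D q h
  have h4 := O.not_AZ_E q h
  simp [copy, h1, h2, h3, h4]

lemma not_copy_BZ {q : Q} (h : O.B.Z q = true) : ¬ O.copy q := by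
  have h1 := O.not_BZ_AC q h
  have h2 := O.B.not_ZC q h
  have h3 := O.F.not_YD q (by rw [O.F_Y]; exact h)
  have h4 := O.F.not_YE q (by rw [O.F_Y]; exact h)
  simp [copy, h1, h2, h3, h4]

lemma not_copy_o : ¬ O.copy O.F.o := by
  simp [copy, O.not_o_AC, O.not_o_BC, O.F.not_oD, O.F.not_oE]

lemma not_BZ_of_AZ {q : Q} (h : O.A.Z q = true) : O.B.Z q = false :=
  O.B.not_IZ q (by rw [O.B_I]; exact h)

lemma anc_of_copy {q : Q} (h : O.copy q) : O.anc q := by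
  refine ⟨fun e => O.not_copy_o (e ▸ h), ?_⟩
  by_contra hI
  have hI : O.A.I q = true := by simpa using hI
  simp [copy, O.A.not_IC q hI, O.not_AI_BC q hI, O.not_AI_D q hI, O.not_AI_E q hI] at h

lemma anc_of_AZ {q : Q} (h : O.A.Z q = true) : O.anc q := by
  refine ⟨fun e => ?_, O.A.I_of_Z h⟩
  rw [e, O.not_o_AZ] at h
  simp at h

lemma anc_of_BZ {q : Q} (h : O.B.Z q = true) : O.anc q := by
  refine ⟨fun e => ?_, ?_⟩
  · rw [e, O.not_o_BZ] at h
    simp at h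
  · by_contra hI
    have := O.not_AI_BZ q (by simpa using hI)
    simp [h] at this

lemma applySpec_isO (θ : ℝ) {u : List Q} (hu : u.Nodup) (hm : ∀ q, q ∈ u) (ψ : State Q) :
    applySpec θ u ψ (.had O.F.isO) = applyHad O.F.o ψ := by
  have : u.filter O.F.isO = [O.F.o] := by
    have h1 : u.filter O.F.isO = u.filter (· == O.F.o) := by
      congr 1
    rw [h1, List.filter_beq, List.count_eq_one_of_mem hu (hm _)]
    rfl
  rw [applySpec_had, this]
  rfl

variable (θ : ℝ) {u : List Q} (hu : u.Nodup) (hm : ∀ q, q ∈ u)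

/-- The state after both stages. -/
noncomputable def mid (u : List Q) (ψ : State Q) : State Q :=
  O.B.op u θ (O.A.op u θ (applyHad O.F.o ψ))

include hu hm in
-- The stage lemmas require clean copies. Cleanness holds at the start and persists, because the
-- stages act on no copy once their own copies have been cleared.
lemma foldl_specs {ψ : State Q} (hψ : CleanOn O.anc ψ) :
    O.specs.foldl (applySpec θ u) ψ =
      applyHad O.F.o (O.A.op u (-θ) (O.B.op u (-θ) (diag (O.F.phase θ) (O.mid θ u ψ)))) := by
  have hc1 : CleanOn O.copy (applyHad O.F.o ψ) :=
    (hψ.mono fun q => O.anc_of_copy).applyHad O.not_copy_o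
  have hc2 : CleanOn O.copy (O.A.op u θ (applyHad O.F.o ψ)) :=
    O.A.cleanOn_op (fun q => O.not_copy_AZ) θ u hc1
  have hc3 : CleanOn O.copy (O.mid θ u ψ) := O.B.cleanOn_op (fun q => O.not_copy_BZ) θ u hc2
  have hc4 : CleanOn O.copy (diag (O.F.phase θ) (O.mid θ u ψ)) := hc3.diag _
  have hc5 : CleanOn O.copy (O.B.op u (-θ) (diag (O.F.phase θ) (O.mid θ u ψ))) :=
    O.B.cleanOn_op (fun q => O.not_copy_BZ) _ u hc4
  simp only [specs, List.foldl_append, List.foldl_cons, List.foldl_nil,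
    O.applySpec_isO θ hu hm]
  rw [O.A.foldl_specs θ hu hm (hc1.mono fun q h => Or.inl h),
    O.B.foldl_specs θ hu hm (hc2.mono fun q h => Or.inr (Or.inl h))]
  change applyHad O.F.o (O.A.invSpecs.foldl _ (O.B.invSpecs.foldl _ (O.F.specs.foldl _ (O.mid θ u ψ))))
    = _
  rw [O.F.foldl_specs θ hu hm (hc3.mono fun q h => Or.inr (Or.inr h)),
    O.B.foldl_invSpecs θ hu hm (hc4.mono fun q h => Or.inr (Or.inl h)),
    O.A.foldl_invSpecs θ hu hm (hc5.mono fun q h => Or.inl h)]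

/-- Both stages act trivially if all inputs are zero. -/
lemma mid_apply_of_zero {ψ : State Q} (hψ : CleanOn O.anc ψ) {b : Q → Bool}
    (hb : O.or b = false) : O.mid θ u ψ b = applyHad O.F.o ψ b := by
  have hI : ∀ q, O.A.I q = true → b q = false := by
    intro q hq
    by_contra h
    simp only [or, decide_eq_false_iff_not] at hb
    exact hb ⟨q, hq, by simpa using h⟩
  have hA : ∀ b' : Q → Bool, (∀ q, O.A.I q = true → b' q = false) →
      O.A.op u θ (applyHad O.F.o ψ) b' = applyHad O.F.o ψ b' :=
    fun b' h => O.A.op_apply_of_zero θ u _ h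
  by_cases hz : ∀ q, O.A.Z q = true → b q = false
  · rw [mid, O.B.op_apply_of_zero θ u _ (by rw [O.B_I]; exact hz), hA b hI]
  -- Here some qubit of the first stage is one, so stage B might act on b. It has nothing to act on:
  -- stage A left these qubits zero, so all amplitudes that stage B could mix into b vanish.
  · push Not at hz
    obtain ⟨q, hq, hbq⟩ := hz
    have hcl : CleanOn (fun q => O.A.Z q = true) (applyHad O.F.o ψ) :=
      (hψ.mono fun q => O.anc_of_AZ).applyHad (by simp [O.not_o_AZ])
    have hzero : ∀ b' : Q → Bool, b' q = true → applyHad O.F.o ψ b' = 0 := by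
      intro b' hb'
      by_contra h0
      have := hcl b' h0 q hq
      simp [hb'] at this
    rw [hzero b (by simpa using hbq), mid, Stage.op]
    have h1 : ∀ b' : Q → Bool, (∀ q, q ∉ u.filter O.B.Z → b' q = b q) →
        O.A.op u θ (applyHad O.F.o ψ) b' = 0 := by
      intro b' hb'
      rw [hA b', hzero b']
      · rw [hb' q]
        · simpa using hbq
        · intro h
          have := (List.mem_filter.1 h).2
          simp [O.not_BZ_of_AZ hq] at this
      · intro i hi
        rw [hb' i, hI i hi]
        intro h
        have := (List.mem_filter.1 h).2
        simp [O.not_AI_BZ i hi] at this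
    have h0 : ∀ b'' : Q → Bool, hadList (u.filter O.B.Z) (fun _ => (0 : ℂ)) b'' = 0 := by
      intro b''
      have h2 : ∀ l : List Q, hadList l (fun _ => (0 : ℂ)) = fun _ => 0 := by
        intro l
        induction l with
        | nil => rfl
        | cons a l ih =>
          have : applyHad a (fun _ => (0 : ℂ)) = fun _ => 0 := by
            funext x; simp [applyHad_eq]
          rw [hadList_cons, this, ih]
      rw [h2]
    rw [← h0 b]
    apply hadList_congr_on
    intro b' hb'
    simp only [diag]
    rw [← mul_zero (O.B.phase θ b'), ← h0 b']
    congr 1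
    apply hadList_congr_on
    intro b'' hb''
    exact h1 b'' fun q hq => (hb'' q hq).trans (hb' q hq)

lemma or_flip {q : Q} (hq : O.A.I q = false) (b : Q → Bool) : O.or (flipBit q b) = O.or b := by
  unfold or
  congr 1
  rw [eq_iff_iff]
  apply exists_congr
  intro i
  apply and_congr_right
  intro hi
  rw [flipBit_ne]
  rintro rfl
  simp [hq] at hi

include hu hm in
/-- The circuit acts as the identity if all inputs are zero. -/
lemma foldl_specs_of_zero {ψ : State Q} (hψ : CleanOn O.anc ψ)
    (hor : ∀ b, ψ b ≠ 0 → O.or b = false) : O.specs.foldl (applySpec θ u) ψ = ψ := by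
  have hH : ∀ b, O.or b = true → applyHad O.F.o ψ b = 0 := by
    intro b hb
    have h1 : ∀ b', O.or b' = true → ψ b' = 0 := fun b' hb' => by
      by_contra h0
      simp [hor b' h0] at hb'
    rw [applyHad_eq, h1 b hb, h1 (flipBit _ b) (by rw [O.or_flip O.not_o_AI]; exact hb)]
    simp
  -- A state supported on zero inputs is fixed by multiplication with the indicator of zero inputs,
  -- which commutes with the stage.
  have hloc : ∀ (S : Stage Q) (φ : State Q), (∀ q, S.Z q = true → O.A.I q = false) →
      (∀ b, O.or b = true → φ b = 0) → ∀ b, O.or b = true → S.op u θ φ b = 0 := by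
    intro S φ hS hφ b hb
    have e : φ = diag (fun b => if O.or b then 0 else 1) φ := by
      funext b'
      by_cases h : O.or b' = true
      · simp [diag, h, hφ b' h]
      · simp [diag, h]
    rw [e, S.op_diag]
    · simp [diag, hb]
    · intro q hq b'
      rw [O.or_flip (hS q hq)]
  have hmid : O.mid θ u ψ = applyHad O.F.o ψ := by
    funext b
    by_cases hb : O.or b = true
    · rw [hH b hb, mid]
      refine hloc O.B _ (fun q h => (O.anc_of_BZ h).2) (fun b' hb' => ?_) b hb
      exact hloc O.A _ (fun q h => (O.anc_of_AZ h).2) hH b' hb'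
    · exact O.mid_apply_of_zero θ hψ (by simpa using hb)
  have hcl : CleanOn (fun q => O.B.Z q = true) (applyHad O.F.o ψ) :=
    (hψ.mono fun q => O.anc_of_BZ).applyHad (by simp [O.not_o_BZ])
  -- The qubits of the second stage are still clean, so there is no phase, and the uncomputation
  -- returns the initial state exactly.
  have hdiag : diag (O.F.phase θ) (O.mid θ u ψ) = O.mid θ u ψ := by
    rw [hmid, diag_congr_clean hcl (g := fun _ => 1)]
    · funext b; simp [diag]
    · intro b hb
      rw [Parities.phase, O.F.cnt_eq_zero (by rw [O.F_Y]; exact hb)]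
      simp
  rw [O.foldl_specs θ hu hm hψ, hdiag, mid, Stage.op_neg_op, Stage.op_neg_op, applyHad_applyHad]

lemma had_target {ψ : State Q} :
    applyHad O.F.o (fun b => ψ (Function.update b O.F.o (xor (b O.F.o) (O.or b)))) =
      diag (fun b => sgn (b O.F.o && O.or b)) (applyHad O.F.o ψ) := by
  rw [← had_xor_had (fun b => O.or_flip O.not_o_AI b)]
  simp only [applyHad_applyHad]

lemma sgn_or_flip {q : Q} (hq : O.anc q) (b : Q → Bool) :
    sgn (flipBit q b O.F.o && O.or (flipBit q b)) = sgn (b O.F.o && O.or b) := by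
  rw [O.or_flip hq.2, flipBit_ne (Ne.symm hq.1)]

include hu hm in
/-- The overlap of the final state and the correct state. -/
lemma inn_target {ψ : State Q} (hψ : CleanOn O.anc ψ) :
    inn (fun b => ψ (Function.update b O.F.o (xor (b O.F.o) (O.or b))))
      (O.specs.foldl (applySpec θ u) ψ) =
    ∑ b, sgn (b O.F.o && O.or b) * O.F.phase θ b * (‖O.mid θ u ψ b‖ ^ 2 : ℝ) := by
  -- The uncomputation moves to the other side of the inner product, where it becomes the
  -- computation. The ideal operation is a controlled sign, which commutes with both stages, so both
  -- sides are diagonal operators applied to the same state.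
  rw [O.foldl_specs θ hu hm hψ, ← inn_applyHad, Stage.inn_op, Stage.inn_op, had_target,
    Stage.op_diag, Stage.op_diag]
  · change inn (diag _ (O.mid θ u ψ)) _ = _
    unfold inn diag
    refine Finset.sum_congr rfl fun b _ => ?_
    rw [map_mul, conj_sgn]
    have : ((‖O.mid θ u ψ b‖ ^ 2 : ℝ) : ℂ) = (starRingEnd ℂ) (O.mid θ u ψ b) * O.mid θ u ψ b := by
      rw [mul_comm, Complex.mul_conj, Complex.normSq_eq_norm_sq]
    rw [this]
    ring
  · exact fun q hq b => O.sgn_or_flip (O.anc_of_BZ hq) b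
  · exact fun q hq b => O.sgn_or_flip (O.anc_of_AZ hq) b

include hu hm in
/-- The probability that all qubits of the second stage are zero. -/
lemma prob_zero_le {ψ : State Q} (hψ : CleanOn O.anc ψ) (h1 : ∑ b, ‖ψ b‖ ^ 2 = 1) {εA εB : ℝ}
    (hεB : 0 ≤ εB) (hεA : 0 ≤ εA)
    (hA : ∀ b : Q → Bool, (∃ q, O.A.I q = true ∧ b q = true) →
      ∏ z with O.A.Z z = true, Real.cos (θ * O.A.mult z b) ^ 2 ≤ εA)
    (hB : ∀ b : Q → Bool, (∃ q, O.A.Z q = true ∧ b q = true) →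
      ∏ z with O.B.Z z = true, Real.cos (θ * O.B.mult z b) ^ 2 ≤ εB) :
    ∑ b, (if O.or b = true ∧ ∀ q, O.B.Z q = true → b q = false then ‖O.mid θ u ψ b‖ ^ 2 else 0) ≤
      εA + εB := by
  obtain ⟨χ, hχ⟩ : ∃ χ, χ = applyHad O.F.o ψ := ⟨_, rfl⟩
  obtain ⟨φ, hφ⟩ : ∃ φ, φ = O.A.op u θ χ := ⟨_, rfl⟩
  have hχ1 : ∑ b, ‖χ b‖ ^ 2 = 1 := by
    rw [← h1, hχ]
    exact sum_norm_sq_hadList [O.F.o] ψ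
  have hφ1 : ∑ b, ‖φ b‖ ^ 2 = 1 := by rw [hφ, Stage.sum_norm_sq_op, hχ1]
  have hclA : CleanOn (fun q => O.A.Z q = true) χ := by
    rw [hχ]; exact (hψ.mono fun q => O.anc_of_AZ).applyHad (by simp [O.not_o_AZ])
  have hclB : CleanOn (fun q => O.B.Z q = true) φ := by
    rw [hφ]
    refine O.A.cleanOn_op (fun q hq => by simp [O.not_BZ_of_AZ hq]) θ u ?_
    rw [hχ]; exact (hψ.mono fun q => O.anc_of_BZ).applyHad (by simp [O.not_o_BZ])
  have hprod : ∀ (S : Stage Q) (b : Q → Bool),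
      ‖∏ z with S.Z z = true, (Real.cos (θ * S.mult z b) : ℂ)‖ ^ 2 =
        ∏ z with S.Z z = true, Real.cos (θ * S.mult z b) ^ 2 := by
    intro S b
    rw [← Complex.ofReal_prod, Complex.norm_real, Real.norm_eq_abs, sq_abs, Finset.prod_pow]
  have hle1 : ∀ (S : Stage Q) (b : Q → Bool),
      ∏ z with S.Z z = true, Real.cos (θ * S.mult z b) ^ 2 ≤ 1 := fun S b =>
    Finset.prod_le_one (fun _ _ => sq_nonneg _) fun _ _ => Real.cos_sq_le_one _
  calc _ ≤ ∑ b, (εA * ‖χ b‖ ^ 2 + εB * ‖φ b‖ ^ 2) := by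
        refine Finset.sum_le_sum fun b _ => ?_
        split_ifs with h
        · obtain ⟨hor, hy⟩ := h
          have e : O.mid θ u ψ b = O.B.op u θ φ b := by rw [hφ, hχ]; rfl
          rw [e, O.B.op_apply_zero θ hu hm hclB hy, norm_mul, mul_pow, hprod]
          -- Either some qubit of the first stage is one and stage B failed, or all are zero and
          -- stage A failed. The squared amplitudes before the failing stage sum to 1.
          by_cases hz : ∃ q, O.A.Z q = true ∧ b q = true
          · have := mul_le_mul_of_nonneg_right (hB b hz) (sq_nonneg ‖φ b‖)
            have : 0 ≤ εA * ‖χ b‖ ^ 2 := by positivity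
            linarith
          · have hz' : ∀ q, O.A.Z q = true → b q = false := by
              intro q hq
              by_contra h
              exact hz ⟨q, hq, by simpa using h⟩
            have h2 := mul_le_mul_of_nonneg_right (hle1 O.B b) (sq_nonneg ‖φ b‖)
            have h3 : ‖φ b‖ ^ 2 ≤ εA * ‖χ b‖ ^ 2 := by
              rw [hφ, O.A.op_apply_zero θ hu hm hclA hz', norm_mul, mul_pow, hprod]
              exact mul_le_mul_of_nonneg_right (hA b (by simpa [or] using hor)) (sq_nonneg _)
            have : 0 ≤ εB * ‖φ b‖ ^ 2 := by positivity
            linarith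
        · positivity
    _ = εA + εB := by
        rw [Finset.sum_add_distrib, ← Finset.mul_sum, ← Finset.mul_sum, hχ1, hφ1, mul_one, mul_one]

include hu hm in
/-- The circuit computes the Or up to a small error. -/
theorem overlap_ge {ψ : State Q} (hψ : CleanOn O.anc ψ) (h1 : ∑ b, ‖ψ b‖ ^ 2 = 1) {εA εB η : ℝ}
    (hεB : 0 ≤ εB) (hεA : 0 ≤ εA) (hη : 0 ≤ η)
    (hA : ∀ b : Q → Bool, (∃ q, O.A.I q = true ∧ b q = true) →
      ∏ z with O.A.Z z = true, Real.cos (θ * O.A.mult z b) ^ 2 ≤ εA)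
    (hB : ∀ b : Q → Bool, (∃ q, O.A.Z q = true ∧ b q = true) →
      ∏ z with O.B.Z z = true, Real.cos (θ * O.B.mult z b) ^ 2 ≤ εB)
    (hF : ∀ b : Q → Bool, (∃ q, O.B.Z q = true ∧ b q = true) →
      Real.cos (2 * θ * O.F.cnt b) ≤ -1 + η) :
    1 - η - 2 * (εA + εB) ≤ ‖inn (fun b => ψ (Function.update b O.F.o (xor (b O.F.o) (O.or b))))
      (O.specs.foldl (applySpec θ u) ψ)‖ := by
  refine le_trans ?_ (Complex.re_le_norm _)
  rw [O.inn_target θ hu hm hψ, Complex.re_sum]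
  have hp := O.prob_zero_le θ hu hm hψ h1 hεB hεA hA hB
  have hmid1 : ∑ b, ‖O.mid θ u ψ b‖ ^ 2 = 1 := by
    rw [mid, Stage.sum_norm_sq_op, Stage.sum_norm_sq_op, ← h1]
    exact sum_norm_sq_hadList [O.F.o] ψ
  have hcl : CleanOn (fun q => O.B.Z q = true) (applyHad O.F.o ψ) :=
    (hψ.mono fun q => O.anc_of_BZ).applyHad (by simp [O.not_o_BZ])
  -- Term by term: an outcome with nonzero input and y = 0 loses at most 2 by a wrong sign, and
  -- every other outcome loses at most η.
  have key : ∀ b, (1 - η) * ‖O.mid θ u ψ b‖ ^ 2 -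
      2 * (if O.or b = true ∧ ∀ q, O.B.Z q = true → b q = false then ‖O.mid θ u ψ b‖ ^ 2 else 0) ≤
      (sgn (b O.F.o && O.or b) * O.F.phase θ b * (‖O.mid θ u ψ b‖ ^ 2 : ℝ)).re := by
    intro b
    have hn : 0 ≤ ‖O.mid θ u ψ b‖ ^ 2 := sq_nonneg _
    have hηn : 0 ≤ η * ‖O.mid θ u ψ b‖ ^ 2 := mul_nonneg hη hn
    rw [Complex.re_mul_ofReal]
    by_cases hy : ∀ q, O.B.Z q = true → b q = false
    · have hph : O.F.phase θ b = 1 := by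
        rw [Parities.phase, O.F.cnt_eq_zero (by rw [O.F_Y]; exact hy)]
        simp
      rw [hph]
      by_cases hor : O.or b = true
      · rw [if_pos ⟨hor, hy⟩]
        have : -1 ≤ (sgn (b O.F.o && O.or b) * 1).re := by
          cases b O.F.o && O.or b <;> simp
        nlinarith
      · rw [if_neg (fun h => hor h.1)]
        have hor : O.or b = false := by simpa using hor
        simp only [hor, Bool.and_false, sgn_false, mul_one, Complex.one_re, one_mul]
        linarith
    · rw [if_neg (fun h => hy h.2)]
      have hy' : ∃ q, O.B.Z q = true ∧ b q = true := by
        push Not at hy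
        obtain ⟨q, h1, h2⟩ := hy
        exact ⟨q, h1, by simpa using h2⟩
      by_cases hor : O.or b = true
      · have hre : 1 - η ≤ (sgn (b O.F.o && O.or b) * O.F.phase θ b).re := by
          rw [hor, Bool.and_true, Parities.phase]
          cases hbo : b O.F.o
          · simpa using hη
          · have := hF b hy'
            simp only [if_true, sgn_true, neg_mul, one_mul, Complex.neg_re,
              Complex.exp_ofReal_mul_I_re]
            linarith
        nlinarith
      -- A nonzero y with zero input has amplitude zero, so the phase it would receive does not
      -- matter.
      · have h0 : O.mid θ u ψ b = 0 := by
          rw [O.mid_apply_of_zero θ hψ (by simpa using hor)]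
          by_contra h0
          exact hy fun q hq => hcl b h0 q hq
        simp [h0]
  calc 1 - η - 2 * (εA + εB) ≤ ∑ b, ((1 - η) * ‖O.mid θ u ψ b‖ ^ 2 -
      2 * (if O.or b = true ∧ ∀ q, O.B.Z q = true → b q = false then
        ‖O.mid θ u ψ b‖ ^ 2 else 0)) := by
        rw [Finset.sum_sub_distrib, ← Finset.mul_sum, ← Finset.mul_sum, hmid1]
        linarith
    _ ≤ _ := Finset.sum_le_sum fun b _ => key b

end OrLayout

/-! ### Fields of addresses -/

/-- The fields of an address: `0` is the number of an input qubit, `1`, `2` and `3` are the other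
parameters of an ancilla qubit, and the others are tags. -/
abbrev Kind : Type := Fin 10

/-- The label of a bit position of the addresses: the field, and, for the field `0`, a bit of the
number of input qubits. -/
abbrev Lab : Type := Kind × Bool

/-- The lowest bit. -/
def bitOf (v : ℕ) : Bool := decide (v % 2 = 1)

lemma toNat_bitOf (v : ℕ) : (bitOf v).toNat = v % 2 := by
  unfold bitOf
  rcases Nat.mod_two_eq_zero_or_one v with h | h <;> simp [h]

/-- The content of the field `κ` of the address `v`. -/
def fld (κ : Kind) : List Lab → ℕ → ℕ
  | [], _ => 0
  | l :: ls, v => if l.1 = κ then (bitOf v).toNat + 2 * fld κ ls (v / 2) else fld κ ls (v / 2)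

/-- The length of the field `κ`. -/
def flen (κ : Kind) : List Lab → ℕ
  | [] => 0
  | l :: ls => if l.1 = κ then flen κ ls + 1 else flen κ ls

/-- The number that is stored in the labels of the field `0`. -/
def nval : List Lab → ℕ
  | [] => 0
  | l :: ls => if l.1 = 0 then l.2.toNat + 2 * nval ls else nval ls

/-- The address with given fields. -/
def mkAddr : List Lab → (Kind → ℕ) → ℕ
  | [], _ => 0
  | l :: ls, f => f l.1 % 2 + 2 * mkAddr ls (Function.update f l.1 (f l.1 / 2))

lemma fld_lt (κ : Kind) (labs : List Lab) (v : ℕ) : fld κ labs v < 2 ^ flen κ labs := by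
  induction labs generalizing v with
  | nil => simp [fld, flen]
  | cons l ls ih =>
    have := ih (v / 2)
    simp only [fld, flen, toNat_bitOf]
    split_ifs
    · rw [pow_succ]; omega
    · exact this

/-- Together with `fld_mkAddr` this identifies addresses with tuples of field contents; qubits can
then be counted and matched by their fields. -/
lemma fld_ext {labs : List Lab} {v v' : ℕ} (hv : v < 2 ^ labs.length) (hv' : v' < 2 ^ labs.length)
    (h : ∀ κ, fld κ labs v = fld κ labs v') : v = v' := by
  induction labs generalizing v v' with
  | nil => simp at hv hv'; omega
  | cons l ls ih =>
    rw [List.length_cons, pow_succ] at hv hv'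
    have h0 := h l.1
    simp only [fld, if_true, toNat_bitOf] at h0
    have : v / 2 = v' / 2 := by
      apply ih (by omega) (by omega)
      intro κ
      by_cases hκ : l.1 = κ
      · subst hκ; omega
      · have := h κ
        simpa only [fld, if_neg hκ] using this
    omega

lemma mkAddr_lt (labs : List Lab) (f : Kind → ℕ) : mkAddr labs f < 2 ^ labs.length := by
  induction labs generalizing f with
  | nil => simp [mkAddr]
  | cons l ls ih =>
    have := ih (Function.update f l.1 (f l.1 / 2))
    simp only [mkAddr, List.length_cons, pow_succ]
    omega

lemma fld_mkAddr (κ : Kind) (labs : List Lab) (f : Kind → ℕ) (hf : f κ < 2 ^ flen κ labs) :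
    fld κ labs (mkAddr labs f) = f κ := by
  induction labs generalizing f with
  | nil => simp only [flen, pow_zero] at hf; simp only [fld]; omega
  | cons l ls ih =>
    have h2 : (f l.1 % 2 + 2 * mkAddr ls (Function.update f l.1 (f l.1 / 2))) / 2 =
        mkAddr ls (Function.update f l.1 (f l.1 / 2)) := by omega
    simp only [fld, mkAddr, h2, toNat_bitOf]
    simp only [flen] at hf
    split_ifs with hκ
    · subst hκ
      rw [if_pos rfl, pow_succ] at hf
      rw [ih _ (by rw [Function.update_self]; omega), Function.update_self]
      omega
    · rw [if_neg hκ] at hf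
      rw [ih _ (by rwa [Function.update_of_ne (Ne.symm hκ)]), Function.update_of_ne (Ne.symm hκ)]

lemma fld_append (κ : Kind) (l₁ l₂ : List Lab) (v : ℕ) :
    fld κ (l₁ ++ l₂) v = fld κ l₁ v + 2 ^ flen κ l₁ * fld κ l₂ (v / 2 ^ l₁.length) := by
  induction l₁ generalizing v with
  | nil => simp [fld, flen]
  | cons l ls ih =>
    have e : v / 2 ^ (ls.length + 1) = v / 2 / 2 ^ ls.length := by
      rw [Nat.div_div_eq_div_mul, pow_succ, mul_comm]
    simp only [List.cons_append, fld, flen, List.length_cons, ih, e]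
    split_ifs
    · rw [pow_succ]; ring
    · rfl

lemma flen_append (κ : Kind) (l₁ l₂ : List Lab) :
    flen κ (l₁ ++ l₂) = flen κ l₁ + flen κ l₂ := by
  induction l₁ with
  | nil => simp [flen]
  | cons l ls ih => simp only [List.cons_append, flen, ih]; split_ifs <;> omega

lemma flen_replicate (κ : Kind) (k : ℕ) (l : Lab) :
    flen κ (List.replicate k l) = if l.1 = κ then k else 0 := by
  induction k with
  | zero => simp [flen]
  | succ k ih => rw [List.replicate_succ, flen, ih]; split_ifs <;> rfl

/-! ### Finite monitors of the fields -/

/-- What a finite automaton finds out about the fields of an address: which fields are zero or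
powers of two, the comparison of the field `0` with the stored number, the last bit of the
field `2`, and whether the fields `2` and `3` have a common bit. -/
structure Track : Type where
  cnt : Kind → Fin 3
  cmp : Option Bool
  lastR : Bool
  hit : Bool
deriving Fintype

namespace Track

def init : Track := ⟨fun _ => 0, none, false, false⟩

/-- The number of ones in a field is counted up to 2, which distinguishes zero, powers of two and
the rest. The bit `lastR` holds the latest digit of field 2, for comparison with the adjacent digit
of field 3. -/
def step (t : Track) (l : Lab) (x : Bool) : Track where
  cnt := Function.update t.cnt l.1 (if x then (if t.cnt l.1 = 0 then 1 else 2) else t.cnt l.1)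
  cmp := if l.1 = 0 ∧ x ≠ l.2 then some l.2 else t.cmp
  lastR := if l.1 = 2 then x else t.lastR
  hit := t.hit || (decide (l.1 = 3) && t.lastR && x)

/-- The automaton reads the digits of an address. -/
def run : Track → List Lab → ℕ → Track
  | t, [], _ => t
  | t, l :: ls, v => run (t.step l (bitOf v)) ls (v / 2)

lemma two_pow_or {x : ℕ} {b : Bool} (h : b.toNat + 2 * x = 1 ∨ ∃ j, b.toNat + 2 * x = 2 ^ (j + 1)) :
    (b = true ∧ x = 0) ∨ (b = false ∧ ∃ j, x = 2 ^ j) := by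
  rcases h with h | ⟨j, h⟩
  · left; cases b
    · simp at h
    · simp at h; simp [h]
  · right
    rw [pow_succ] at h
    cases b
    · exact ⟨rfl, j, by simp at h; omega⟩
    · simp at h; omega

lemma exists_two_pow_iff (x : ℕ) (b : Bool) :
    (∃ j, b.toNat + 2 * x = 2 ^ j) ↔ (b = true ∧ x = 0) ∨ (b = false ∧ ∃ j, x = 2 ^ j) := by
  constructor
  · rintro ⟨j, hj⟩
    apply two_pow_or
    cases j with
    | zero => left; simpa using hj
    | succ j => right; exact ⟨j, hj⟩
  · rintro (⟨rfl, rfl⟩ | ⟨rfl, j, rfl⟩)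
    · exact ⟨0, rfl⟩
    · exact ⟨j + 1, by simp [pow_succ]; ring⟩

lemma run_cnt (κ : Kind) (labs : List Lab) (t : Track) (v : ℕ) :
    ((t.run labs v).cnt κ = 0 ↔ t.cnt κ = 0 ∧ fld κ labs v = 0) ∧
    ((t.run labs v).cnt κ = 1 ↔ (t.cnt κ = 1 ∧ fld κ labs v = 0) ∨
      (t.cnt κ = 0 ∧ ∃ j, fld κ labs v = 2 ^ j)) := by
  induction labs generalizing t v with
  | nil =>
    have : ¬ ∃ j, (0 : ℕ) = 2 ^ j := by
      rintro ⟨j, hj⟩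
      have : 0 < 2 ^ j := by positivity
      omega
    simp [run, fld, this]
  | cons l ls ih =>
    obtain ⟨h1, h2⟩ := ih (t.step l (bitOf v)) (v / 2)
    simp only [run, h1, h2, fld]
    by_cases hκ : l.1 = κ
    · subst hκ
      rw [if_pos rfl, exists_two_pow_iff]
      generalize fld l.1 ls (v / 2) = x
      simp only [step, Function.update_self]
      generalize bitOf v = b
      generalize t.cnt l.1 = c
      cases b
      · fin_cases c <;> simp
      · fin_cases c <;> simp
    · rw [if_neg hκ]
      simp only [step, Function.update_of_ne (Ne.symm hκ), and_self]

/-- The result of a comparison, `d` in case of equality. -/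
def compareNat (x y : ℕ) (d : Option Bool) : Option Bool :=
  if x < y then some true else if y < x then some false else d

/-- Digits come with the least significant one first, so a later difference overrules the earlier
ones. -/
lemma run_cmp (labs : List Lab) (t : Track) (v : ℕ) :
    (t.run labs v).cmp = compareNat (fld 0 labs v) (nval labs) t.cmp := by
  induction labs generalizing t v with
  | nil => simp [run, fld, nval, compareNat]
  | cons l ls ih =>
    simp only [run, ih, fld, nval]
    by_cases h0 : l.1 = 0
    · rw [if_pos h0, if_pos h0]
      generalize fld 0 ls (v / 2) = x
      generalize nval ls = y
      simp only [step, h0, true_and, compareNat]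
      generalize bitOf v = b
      rcases lt_trichotomy x y with h | h | h
      · rw [if_pos h, if_pos]
        cases b <;> cases l.2 <;> simp <;> omega
      · subst h
        cases b <;> cases l.2 <;> simp
      · have h3 : ¬ x < y := by omega
        rw [if_neg h3, if_pos h, if_neg, if_pos] <;> cases b <;> cases l.2 <;> simp <;> omega
    · rw [if_neg h0, if_neg h0]
      simp [step, h0]

end Track

/-- In the list of labels, the fields `2` and `3` alternate in adjacent positions. -/
inductive Paired : List Lab → Prop
  | nil : Paired []
  | other (l : Lab) (ls : List Lab) : l.1 ≠ 2 → l.1 ≠ 3 → Paired ls → Paired (l :: ls)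
  | pair (x y : Bool) (ls : List Lab) : Paired ls → Paired ((2, x) :: (3, y) :: ls)

lemma Paired.append {l₁ l₂ : List Lab} (h₁ : Paired l₁) (h₂ : Paired l₂) : Paired (l₁ ++ l₂) := by
  induction h₁ with
  | nil => exact h₂
  | other l ls h2 h3 _ ih => exact .other l _ h2 h3 ih
  | pair x y ls _ ih => exact .pair x y _ ih

lemma exists_testBit_iff (x y : ℕ) (b c : Bool) :
    (∃ p, (b.toNat + 2 * x).testBit p = true ∧ (c.toNat + 2 * y).testBit p = true) ↔
      (b && c) = true ∨ ∃ p, x.testBit p = true ∧ y.testBit p = true := by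
  have h0 : ∀ (z : ℕ) (d : Bool), (d.toNat + 2 * z).testBit 0 = d := by
    intro z d; cases d <;> simp
  have h1 : ∀ (z p : ℕ) (d : Bool), (d.toNat + 2 * z).testBit (p + 1) = z.testBit p := by
    intro z p d
    rw [Nat.testBit_succ]
    congr 1
    cases d
    · simp
    · simp; omega
  constructor
  · rintro ⟨p, hp1, hp2⟩
    cases p with
    | zero => rw [h0] at hp1 hp2; left; simp [hp1, hp2]
    | succ p => rw [h1] at hp1 hp2; exact Or.inr ⟨p, hp1, hp2⟩
  · rintro (h | ⟨p, hp1, hp2⟩)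
    · rw [Bool.and_eq_true] at h
      exact ⟨0, by rw [h0]; exact h.1, by rw [h0]; exact h.2⟩
    · exact ⟨p + 1, by rw [h1]; exact hp1, by rw [h1]; exact hp2⟩

lemma Track.run_hit {labs : List Lab} (h : Paired labs) (t : Track) (v : ℕ) :
    (t.run labs v).hit = true ↔ t.hit = true ∨
      ∃ p, (fld 2 labs v).testBit p = true ∧ (fld 3 labs v).testBit p = true := by
  induction h generalizing t v with
  | nil => simp [run, fld]
  | other l ls h2 h3 _ ih => simp [run, ih, fld, h2, h3, step]
  | pair x y ls _ ih =>
    have n1 : ¬ ((2 : Kind) = 3) := by decide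
    have n2 : ¬ ((3 : Kind) = 2) := by decide
    simp only [run, ih, fld, if_true, n1, n2, if_false,
      exists_testBit_iff, step, decide_false, Bool.false_and, Bool.or_false, decide_true,
      Bool.true_and, Bool.or_eq_true]
    rw [or_assoc]

/-- The joint automaton for two addresses: which fields are different, the bit of the first address
at the highest nonzero bit of the second one, and whether the field `3` of the first address is
different from the field `2` of the second one. -/
structure Monitor : Type where
  a : Track
  b : Track
  neq : Kind → Bool
  top : Kind → Bool
  mism : Bool
deriving Fintype

namespace Monitor

def init : Monitor := ⟨Track.init, Track.init, fun _ => false, fun _ => false, false⟩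

/-- The bit `top` is overwritten at every nonzero digit of the second address, so in the end it
belongs to the highest one. Comparing field 3 of one address with field 2 of the other needs only
one remembered digit, because their positions are adjacent. -/
def step (m : Monitor) (l : Lab) (x y : Bool) : Monitor where
  a := m.a.step l x
  b := m.b.step l y
  neq := Function.update m.neq l.1 (m.neq l.1 || xor x y)
  top := Function.update m.top l.1 (if y then x else m.top l.1)
  mism := m.mism || (decide (l.1 = 3) && xor x m.b.lastR)

def run : Monitor → List Lab → ℕ → ℕ → Monitor
  | m, [], _, _ => m
  | m, l :: ls, v, w =>
    run (m.step l (bitOf v) (bitOf w)) ls (v / 2) (w / 2)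

lemma run_a (m : Monitor) (labs : List Lab) (v w : ℕ) : (m.run labs v w).a = m.a.run labs v := by
  induction labs generalizing m v w with
  | nil => rfl
  | cons l ls ih => simp only [run, ih]; rfl

lemma run_b (m : Monitor) (labs : List Lab) (v w : ℕ) : (m.run labs v w).b = m.b.run labs w := by
  induction labs generalizing m v w with
  | nil => rfl
  | cons l ls ih => simp only [run, ih]; rfl

lemma run_neq (κ : Kind) (labs : List Lab) (m : Monitor) (v w : ℕ) :
    (m.run labs v w).neq κ = false ↔ m.neq κ = false ∧ fld κ labs v = fld κ labs w := by
  induction labs generalizing m v w with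
  | nil => simp [run, fld]
  | cons l ls ih =>
    simp only [run, ih, fld]
    by_cases hκ : l.1 = κ
    · subst hκ
      simp only [step, Function.update_self, if_true]
      generalize fld l.1 ls (v / 2) = x
      generalize fld l.1 ls (w / 2) = y
      generalize bitOf v = b
      generalize bitOf w = c
      cases b <;> cases c <;> simp <;> omega
    · simp [step, Function.update_of_ne (Ne.symm hκ), hκ]

/-- If the field of the first address is a power 2^j, this bit says whether j is the binary
logarithm of the field of the second. In this way a finite automaton recognises the numbers between
2^j and 2^(j+1). -/
lemma run_top (κ : Kind) (labs : List Lab) (m : Monitor) (v w : ℕ) :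
    (m.run labs v w).top κ = if fld κ labs w = 0 then m.top κ
      else (fld κ labs v).testBit (Nat.log 2 (fld κ labs w)) := by
  induction labs generalizing m v w with
  | nil => simp [run, fld]
  | cons l ls ih =>
    simp only [run, ih, fld]
    by_cases hκ : l.1 = κ
    · subst hκ
      simp only [step, Function.update_self, if_true]
      generalize fld l.1 ls (v / 2) = x
      generalize fld l.1 ls (w / 2) = y
      generalize bitOf v = b
      generalize bitOf w = c
      by_cases hy : y = 0
      · subst hy
        cases c <;> cases b <;> simp
      · have hlog : Nat.log 2 (c.toNat + 2 * y) = Nat.log 2 y + 1 := by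
          rw [Nat.log_of_one_lt_of_le (by norm_num) (by omega)]
          congr 2
          cases c <;> simp
          omega
        have hxb : (b.toNat + 2 * x) / 2 = x := by
          cases b
          · simp
          · simp; omega
        rw [if_neg hy, if_neg (by omega), hlog, Nat.testBit_succ, hxb]
    · simp [step, Function.update_of_ne (Ne.symm hκ), hκ]

lemma run_mism {labs : List Lab} (h : Paired labs) (m : Monitor) (v w : ℕ) :
    (m.run labs v w).mism = false ↔ m.mism = false ∧ fld 3 labs v = fld 2 labs w := by
  induction h generalizing m v w with
  | nil => simp [run, fld]
  | other l ls h2 h3 _ ih => simp [run, ih, fld, h2, h3, step]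
  | pair x y ls _ ih =>
    have n1 : ¬ ((2 : Kind) = 3) := by decide
    have n2 : ¬ ((3 : Kind) = 2) := by decide
    simp only [run, ih, fld, if_true, n1, n2, if_false, step, Track.step, decide_false, Bool.false_and, Bool.or_false,
      decide_true, Bool.true_and]
    generalize bitOf (v / 2) = b
    generalize bitOf w = c
    generalize fld 3 ls (v / 2 / 2) = x
    generalize fld 2 ls (w / 2 / 2) = y
    cases b <;> cases c <;> simp <;> omega

end Monitor

/-! ### The roles of the qubits -/

/-- A condition on a field of an address. -/
inductive Req : Type
  | zero
  | one
  | pos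
  | any

namespace Req

def test : Req → Fin 3 → Bool
  | zero, c => decide (c = 0)
  | one, c => decide (c = 1)
  | pos, c => decide (c ≠ 0)
  | any, _ => true

def Holds : Req → ℕ → Prop
  | zero, x => x = 0
  | one, x => ∃ j, x = 2 ^ j
  | pos, x => x ≠ 0
  | any, _ => True

lemma test_run (ρ : Req) (κ : Kind) (labs : List Lab) (v : ℕ) :
    ρ.test ((Track.init.run labs v).cnt κ) = true ↔ ρ.Holds (fld κ labs v) := by
  obtain ⟨h1, h2⟩ := Track.run_cnt κ labs Track.init v
  have h0 : Track.init.cnt κ = 0 := rfl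
  simp only [h0, true_and, zero_ne_one, false_and, false_or] at h1 h2
  cases ρ
  · simpa [test, Holds] using h1
  · simpa [test, Holds] using h2
  · simpa [test, Holds] using not_congr h1
  · simp [test, Holds]

end Req

/-- A set of qubits that is given by conditions on their addresses. -/
structure Role : Type where
  tag : Kind
  x : Req
  k : Req
  r : Req
  t : Req
  cmp : Option (Option Bool)
  hit : Bool

namespace Role

def req (ρ : Role) (κ : Kind) : Req :=
  if κ = 0 then ρ.x else if κ = 1 then ρ.k else if κ = 2 then ρ.r else if κ = 3 then ρ.t
  else if κ = ρ.tag then .one else .zero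

def ok (ρ : Role) (s : Track) : Bool :=
  decide (∀ κ, (ρ.req κ).test (s.cnt κ) = true) && decide (∀ c, ρ.cmp = some c → s.cmp = c) &&
    (!ρ.hit || s.hit)

def has (ρ : Role) (labs : List Lab) (v : ℕ) : Bool := ρ.ok (Track.init.run labs v)

/-- The conditions on the first four fields. -/
structure Cond (ρ : Role) (n x k r t : ℕ) : Prop where
  x_holds : ρ.x.Holds x
  k_holds : ρ.k.Holds k
  r_holds : ρ.r.Holds r
  t_holds : ρ.t.Holds t
  cmp_eq : ∀ c, ρ.cmp = some c → Track.compareNat x n none = c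
  hit_imp : ρ.hit = true → ∃ p, r.testBit p = true ∧ t.testBit p = true

end Role

/-- What the circuit of size `n` needs to know about the labels. -/
structure Labels (n L M W : ℕ) (labs : List Lab) : Prop where
  paired : Paired labs
  low : ∀ x < 2 ^ L, fld 0 labs x = x ∧ ∀ κ, κ ≠ 0 → fld κ labs x = 0
  len0 : flen 0 labs = L
  len1 : flen 1 labs = M
  len2 : flen 2 labs = W
  len3 : flen 3 labs = W
  len4 : ∀ κ, 4 ≤ κ → flen κ labs = 1
  nval_eq : nval labs = n
  lt : n < 2 ^ L
  le : L ≤ labs.length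

namespace Labels

variable {n L M W : ℕ} {labs : List Lab} (H : Labels n L M W labs)
include H

/-- The tag fields consist of a single digit, so being a power of two means being 1: an address
carries the tag of its role and no other. -/
lemma has_iff (ρ : Role) (v : ℕ) : ρ.has labs v = true ↔
    ρ.Cond n (fld 0 labs v) (fld 1 labs v) (fld 2 labs v) (fld 3 labs v) ∧
      ∀ κ, 4 ≤ κ → fld κ labs v = if κ = ρ.tag then 1 else 0 := by
  have hr : (∀ κ, (ρ.req κ).test ((Track.init.run labs v).cnt κ) = true) ↔
      ρ.x.Holds (fld 0 labs v) ∧ ρ.k.Holds (fld 1 labs v) ∧ ρ.r.Holds (fld 2 labs v) ∧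
      ρ.t.Holds (fld 3 labs v) ∧ ∀ κ, 4 ≤ κ → fld κ labs v = if κ = ρ.tag then 1 else 0 := by
    simp only [Req.test_run]
    constructor
    · intro h
      refine ⟨h 0, h 1, h 2, h 3, fun κ hκ => ?_⟩
      have h' := h κ
      rw [Role.req, if_neg (by rintro rfl; revert hκ; decide),
        if_neg (by rintro rfl; revert hκ; decide), if_neg (by rintro rfl; revert hκ; decide),
        if_neg (by rintro rfl; revert hκ; decide)] at h'
      split_ifs at h' ⊢ with ht
      · obtain ⟨j, hj⟩ := h'
        have := fld_lt κ labs v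
        rw [H.len4 κ hκ] at this
        have := Nat.one_le_two_pow (n := j)
        omega
      · exact h'
    · rintro ⟨h0, h1, h2, h3, h4⟩ κ
      unfold Role.req
      split_ifs with k0 k1 k2 k3 k4
      · rwa [k0]
      · rwa [k1]
      · rwa [k2]
      · rwa [k3]
      all_goals
        have hκ : 4 ≤ κ := by clear * - k0 k1 k2 k3; revert k0 k1 k2 k3; revert κ; decide
        have := h4 κ hκ
      · rw [if_pos k4] at this
        exact ⟨0, this⟩
      · rw [if_neg k4] at this
        exact this
  have hh := Track.run_hit H.paired Track.init v
  have hc := Track.run_cmp labs Track.init v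
  rw [H.nval_eq] at hc
  simp only [Track.init, Bool.false_eq_true, false_or] at hh hc
  unfold Role.has Role.ok
  rw [Bool.and_eq_true, Bool.and_eq_true, decide_eq_true_iff, decide_eq_true_iff, hr]
  simp only [Track.init] at hh hc ⊢
  rw [Bool.or_eq_true, hh, hc]
  constructor
  · rintro ⟨⟨⟨a, b, c, d, e⟩, f⟩, g⟩
    refine ⟨⟨a, b, c, d, f, fun h => ?_⟩, e⟩
    rcases g with g | g
    · simp [h] at g
    · exact g
  · rintro ⟨⟨a, b, c, d, f, g⟩, e⟩
    refine ⟨⟨⟨a, b, c, d, e⟩, f⟩, ?_⟩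
    cases h : ρ.hit
    · simp
    · exact Or.inr (g h)

variable {N : ℕ} (hN : N = 2 ^ labs.length)
include hN

lemma has_ext {ρ : Role} {v v' : Fin N} (h : ρ.has labs v = true) (h' : ρ.has labs v' = true)
    (h0 : fld 0 labs v = fld 0 labs v') (h1 : fld 1 labs v = fld 1 labs v')
    (h2 : fld 2 labs v = fld 2 labs v') (h3 : fld 3 labs v = fld 3 labs v') : v = v' := by
  apply Fin.ext
  apply fld_ext (labs := labs) (hN ▸ v.2) (hN ▸ v'.2)
  intro κ
  by_cases hκ : 4 ≤ κ
  · rw [((H.has_iff ρ v).1 h).2 κ hκ, ((H.has_iff ρ v').1 h').2 κ hκ]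
  · have : κ = 0 ∨ κ = 1 ∨ κ = 2 ∨ κ = 3 := by revert hκ; revert κ; decide
    rcases this with rfl | rfl | rfl | rfl <;> assumption

lemma exists_has {ρ : Role} {x k r t : ℕ} (hx : x < 2 ^ L) (hk : k < 2 ^ M) (hr : r < 2 ^ W)
    (ht : t < 2 ^ W) (h : ρ.Cond n x k r t) :
    ∃ v : Fin N, ρ.has labs v = true ∧ fld 0 labs v = x ∧ fld 1 labs v = k ∧
      fld 2 labs v = r ∧ fld 3 labs v = t := by
  let f : Kind → ℕ := fun κ => if κ = 0 then x else if κ = 1 then k else if κ = 2 then r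
    else if κ = 3 then t else if κ = ρ.tag then 1 else 0
  have f0 := fld_mkAddr 0 labs f (by rw [H.len0]; exact hx)
  have f1 := fld_mkAddr 1 labs f (by rw [H.len1]; exact hk)
  have f2 := fld_mkAddr 2 labs f (by rw [H.len2]; exact hr)
  have f3 := fld_mkAddr 3 labs f (by rw [H.len3]; exact ht)
  refine ⟨⟨mkAddr labs f, hN ▸ mkAddr_lt labs f⟩, ?_, f0, f1, f2, f3⟩
  rw [H.has_iff]
  refine ⟨by simp only [f0, f1, f2, f3]; exact h, fun κ hκ => ?_⟩
  have fk : f κ = if κ = ρ.tag then 1 else 0 := by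
    simp only [f]
    rw [if_neg (by rintro rfl; revert hκ; decide),
        if_neg (by rintro rfl; revert hκ; decide), if_neg (by rintro rfl; revert hκ; decide),
        if_neg (by rintro rfl; revert hκ; decide)]
  rw [← fk]
  apply fld_mkAddr
  rw [H.len4 κ hκ, fk]
  split_ifs <;> norm_num

omit hN in
lemma not_has_of_tag {ρ σ : Role} {v : ℕ} (h : ρ.has labs v = true) (h4 : 4 ≤ ρ.tag)
    (hne : ρ.tag ≠ σ.tag) : σ.has labs v = false := by
  by_contra hσ
  rw [Bool.not_eq_false] at hσ
  have h1 := ((H.has_iff ρ v).1 h).2 _ h4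
  have h2 := ((H.has_iff σ v).1 hσ).2 _ h4
  rw [if_pos rfl] at h1
  rw [if_neg hne] at h2
  omega

omit hN in
lemma not_has_of_tag' {ρ σ : Role} {v : ℕ} (h : ρ.has labs v = true) (h4 : 4 ≤ σ.tag)
    (hne : ρ.tag ≠ σ.tag) : σ.has labs v = false := by
  by_contra hσ
  rw [Bool.not_eq_false] at hσ
  have := H.not_has_of_tag hσ h4 hne.symm
  simp [h] at this

end Labels

namespace Role

/-- The encoding: input x; output qubit n; Z is the qubit with factor 2^j (k = 2^j) in repetition i
(r = 2^i) of stage A; C holds its copies for an input x; Y is the qubit with factor 2^l (t = 2^l) of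
stage B; F holds its copies for a qubit Z; D is a subset with characteristic word t, and E is an
element l of it (r = 2^l). Inputs and output carry no tag. Copies C with x > n or x = n have no
input as control, so their two rotations cancel. -/
def X : Role := ⟨0, .any, .zero, .zero, .zero, some (some true), false⟩
def O : Role := ⟨0, .any, .zero, .zero, .zero, some none, false⟩
def Z : Role := ⟨4, .zero, .one, .one, .zero, none, false⟩
def C : Role := ⟨5, .any, .pos, .one, .zero, none, false⟩
def Y : Role := ⟨6, .zero, .zero, .zero, .one, none, false⟩
def F : Role := ⟨7, .zero, .one, .one, .pos, none, false⟩
def D : Role := ⟨8, .zero, .zero, .zero, .any, none, false⟩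
def E : Role := ⟨9, .zero, .zero, .one, .any, none, true⟩

lemma cond_X {n x k r t : ℕ} : X.Cond n x k r t ↔ x < n ∧ k = 0 ∧ r = 0 ∧ t = 0 := by
  constructor
  · intro h
    refine ⟨?_, h.k_holds, h.r_holds, h.t_holds⟩
    have := h.cmp_eq _ rfl
    by_contra hx
    unfold Track.compareNat at this
    rw [if_neg hx] at this
    split_ifs at this; simp at this
  · rintro ⟨hx, rfl, rfl, rfl⟩
    refine ⟨trivial, rfl, rfl, rfl, fun c hc => ?_, by simp [X]⟩
    simp only [X, Option.some.injEq] at hc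
    rw [Track.compareNat, if_pos hx, hc]

lemma cond_O {n x k r t : ℕ} : O.Cond n x k r t ↔ x = n ∧ k = 0 ∧ r = 0 ∧ t = 0 := by
  constructor
  · intro h
    refine ⟨?_, h.k_holds, h.r_holds, h.t_holds⟩
    have := h.cmp_eq _ rfl
    unfold Track.compareNat at this
    split_ifs at this; omega
  · rintro ⟨rfl, rfl, rfl, rfl⟩
    refine ⟨trivial, rfl, rfl, rfl, fun c hc => ?_, by simp [O]⟩
    simp only [O, Option.some.injEq] at hc
    simpa [Track.compareNat] using hc

lemma cond_Z {n x k r t : ℕ} :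
    Z.Cond n x k r t ↔ x = 0 ∧ (∃ j, k = 2 ^ j) ∧ (∃ i, r = 2 ^ i) ∧ t = 0 :=
  ⟨fun h => ⟨h.x_holds, h.k_holds, h.r_holds, h.t_holds⟩,
    fun ⟨a, b, c, d⟩ => ⟨a, b, c, d, by simp [Z], by simp [Z]⟩⟩

lemma cond_C {n x k r t : ℕ} :
    C.Cond n x k r t ↔ k ≠ 0 ∧ (∃ i, r = 2 ^ i) ∧ t = 0 :=
  ⟨fun h => ⟨h.k_holds, h.r_holds, h.t_holds⟩,
    fun ⟨b, c, d⟩ => ⟨trivial, b, c, d, by simp [C], by simp [C]⟩⟩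

lemma cond_Y {n x k r t : ℕ} :
    Y.Cond n x k r t ↔ x = 0 ∧ k = 0 ∧ r = 0 ∧ ∃ l, t = 2 ^ l :=
  ⟨fun h => ⟨h.x_holds, h.k_holds, h.r_holds, h.t_holds⟩,
    fun ⟨a, b, c, d⟩ => ⟨a, b, c, d, by simp [Y], by simp [Y]⟩⟩

lemma cond_F {n x k r t : ℕ} :
    F.Cond n x k r t ↔ x = 0 ∧ (∃ j, k = 2 ^ j) ∧ (∃ i, r = 2 ^ i) ∧ t ≠ 0 :=
  ⟨fun h => ⟨h.x_holds, h.k_holds, h.r_holds, h.t_holds⟩,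
    fun ⟨a, b, c, d⟩ => ⟨a, b, c, d, by simp [F], by simp [F]⟩⟩

lemma cond_D {n x k r t : ℕ} : D.Cond n x k r t ↔ x = 0 ∧ k = 0 ∧ r = 0 :=
  ⟨fun h => ⟨h.x_holds, h.k_holds, h.r_holds⟩,
    fun ⟨a, b, c⟩ => ⟨a, b, c, trivial, by simp [D], by simp [D]⟩⟩

lemma cond_E {n x k r t : ℕ} :
    E.Cond n x k r t ↔ x = 0 ∧ k = 0 ∧ ∃ l, r = 2 ^ l ∧ t.testBit l = true := by
  constructor
  · intro h
    refine ⟨h.x_holds, h.k_holds, ?_⟩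
    obtain ⟨l, hl⟩ := h.r_holds
    obtain ⟨p, hp1, hp2⟩ := h.hit_imp rfl
    rw [hl, Nat.testBit_two_pow, decide_eq_true_iff] at hp1
    exact ⟨l, hl, by rwa [hp1]⟩
  · rintro ⟨a, b, l, rfl, hl⟩
    exact ⟨a, b, ⟨l, rfl⟩, trivial, by simp [E], fun _ => ⟨l, by simp, hl⟩⟩

end Role

/-- A relation between the qubits of two roles. -/
def relOf (ρ σ : Role) (link : Monitor → Bool) (m : Monitor) : Bool := ρ.ok m.a && σ.ok m.b && link m

/-- The copies of the qubit with factor 2^j for one input are those with 2^j ≤ k < 2^(j+1): there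
are 2^j of them, so j can be recovered from k as its leading bit. The field t plays the same part in
`linkYF`. -/
def linkZC (m : Monitor) : Bool := !m.neq 2 && m.top 1
def linkXC (m : Monitor) : Bool := !m.neq 0
def linkYF (m : Monitor) : Bool := m.top 3
def linkZF (m : Monitor) : Bool := !m.neq 1 && !m.neq 2
def linkYE (m : Monitor) : Bool := !m.mism
def linkDE (m : Monitor) : Bool := !m.neq 3

/-- The relation of the qubits with given labels. -/
def relAt (labs : List Lab) (R : Monitor → Bool) (v w : ℕ) : Bool := R (Monitor.init.run labs v w)

lemma relAt_relOf (labs : List Lab) (ρ σ : Role) (link : Monitor → Bool) (v w : ℕ) :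
    relAt labs (relOf ρ σ link) v w = true ↔
      ρ.has labs v = true ∧ σ.has labs w = true ∧ relAt labs link v w = true := by
  unfold relAt relOf
  rw [Bool.and_eq_true, Bool.and_eq_true, Monitor.run_a, Monitor.run_b, and_assoc]
  rfl

lemma relAt_neq (labs : List Lab) (κ : Kind) (v w : ℕ) :
    relAt labs (fun m => !m.neq κ) v w = true ↔ fld κ labs v = fld κ labs w := by
  unfold relAt
  rw [Bool.not_eq_true', Monitor.run_neq]
  simp [Monitor.init]

lemma relAt_mism {labs : List Lab} (h : Paired labs) (v w : ℕ) :
    relAt labs linkYE v w = true ↔ fld 3 labs v = fld 2 labs w := by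
  unfold relAt linkYE
  rw [Bool.not_eq_true', Monitor.run_mism h]
  simp [Monitor.init]

lemma relAt_top (labs : List Lab) (κ : Kind) (v w : ℕ) {j : ℕ} (hv : fld κ labs v = 2 ^ j)
    (hw : fld κ labs w ≠ 0) :
    relAt labs (fun m => m.top κ) v w = true ↔ j = Nat.log 2 (fld κ labs w) := by
  change (Monitor.init.run labs v w).top κ = true ↔ _
  rw [Monitor.run_top, if_neg hw, hv, Nat.testBit_two_pow, decide_eq_true_iff]

/-! ### The circuit on the labelled addresses -/

namespace Labels

open Role

variable {n L M W : ℕ} {labs : List Lab} (H : Labels n L M W labs)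
include H

lemma fld_X {v : ℕ} (h : X.has labs v = true) :
    fld 0 labs v < n ∧ fld 1 labs v = 0 ∧ fld 2 labs v = 0 ∧ fld 3 labs v = 0 :=
  cond_X.1 ((H.has_iff _ v).1 h).1

lemma fld_Z {v : ℕ} (h : Z.has labs v = true) : fld 0 labs v = 0 ∧
    (∃ j, fld 1 labs v = 2 ^ j) ∧ (∃ i, fld 2 labs v = 2 ^ i) ∧ fld 3 labs v = 0 :=
  cond_Z.1 ((H.has_iff _ v).1 h).1

lemma fld_C {v : ℕ} (h : C.has labs v = true) :
    fld 1 labs v ≠ 0 ∧ (∃ i, fld 2 labs v = 2 ^ i) ∧ fld 3 labs v = 0 :=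
  cond_C.1 ((H.has_iff _ v).1 h).1

lemma fld_Y {v : ℕ} (h : Y.has labs v = true) : fld 0 labs v = 0 ∧
    fld 1 labs v = 0 ∧ fld 2 labs v = 0 ∧ ∃ i, fld 3 labs v = 2 ^ i :=
  cond_Y.1 ((H.has_iff _ v).1 h).1

lemma fld_F {v : ℕ} (h : F.has labs v = true) : fld 0 labs v = 0 ∧
    (∃ j, fld 1 labs v = 2 ^ j) ∧ (∃ i, fld 2 labs v = 2 ^ i) ∧ fld 3 labs v ≠ 0 :=
  cond_F.1 ((H.has_iff _ v).1 h).1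

lemma fld_D {v : ℕ} (h : D.has labs v = true) : fld 0 labs v = 0 ∧
    fld 1 labs v = 0 ∧ fld 2 labs v = 0 :=
  cond_D.1 ((H.has_iff _ v).1 h).1

lemma fld_E {v : ℕ} (h : E.has labs v = true) : fld 0 labs v = 0 ∧
    fld 1 labs v = 0 ∧ ∃ l, fld 2 labs v = 2 ^ l ∧ (fld 3 labs v).testBit l = true :=
  cond_E.1 ((H.has_iff _ v).1 h).1

omit H in
lemma rel_XC {v w : ℕ} : relAt labs (relOf X C linkXC) v w = true ↔
    X.has labs v = true ∧ C.has labs w = true ∧ fld 0 labs v = fld 0 labs w := by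
  rw [relAt_relOf]
  unfold linkXC
  rw [relAt_neq]

omit H in
lemma rel_DE {v w : ℕ} : relAt labs (relOf D E linkDE) v w = true ↔
    D.has labs v = true ∧ E.has labs w = true ∧ fld 3 labs v = fld 3 labs w := by
  rw [relAt_relOf]
  unfold linkDE
  rw [relAt_neq]

lemma rel_YE {v w : ℕ} : relAt labs (relOf Y E linkYE) v w = true ↔
    Y.has labs v = true ∧ E.has labs w = true ∧ fld 3 labs v = fld 2 labs w := by
  rw [relAt_relOf, relAt_mism H.paired]

omit H in
lemma rel_ZF {v w : ℕ} : relAt labs (relOf Z F linkZF) v w = true ↔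
    Z.has labs v = true ∧ F.has labs w = true ∧ fld 1 labs v = fld 1 labs w ∧
      fld 2 labs v = fld 2 labs w := by
  rw [relAt_relOf, ← relAt_neq, ← relAt_neq]
  unfold linkZF relAt
  rw [Bool.and_eq_true]

lemma rel_YF {v w : ℕ} : relAt labs (relOf Y F linkYF) v w = true ↔
    Y.has labs v = true ∧ F.has labs w = true ∧ fld 3 labs v = 2 ^ Nat.log 2 (fld 3 labs w) := by
  rw [relAt_relOf]
  refine and_congr_right fun h => and_congr_right fun h' => ?_
  obtain ⟨-, -, -, j, hj⟩ := H.fld_Y h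
  unfold linkYF
  rw [relAt_top labs 3 v w hj (H.fld_F h').2.2.2, hj]
  exact (Nat.pow_right_injective le_rfl).eq_iff.symm

lemma rel_ZC {v w : ℕ} : relAt labs (relOf Z C linkZC) v w = true ↔
    Z.has labs v = true ∧ C.has labs w = true ∧ fld 2 labs v = fld 2 labs w ∧
      fld 1 labs v = 2 ^ Nat.log 2 (fld 1 labs w) := by
  rw [relAt_relOf]
  refine and_congr_right fun h => and_congr_right fun h' => ?_
  obtain ⟨-, ⟨j, hj⟩, -⟩ := H.fld_Z h
  rw [← relAt_neq]
  have := relAt_top labs 1 v w hj (H.fld_C h').1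
  rw [hj, (Nat.pow_right_injective le_rfl).eq_iff, ← this]
  unfold linkZC relAt
  rw [Bool.and_eq_true]

omit H in
lemma log_lt {x m : ℕ} (h : x < 2 ^ m) (h0 : x ≠ 0) : 2 ^ Nat.log 2 x < 2 ^ m :=
  lt_of_le_of_lt (Nat.pow_log_le_self 2 h0) h

variable {N : ℕ} (hN : N = 2 ^ labs.length)
include hN

lemma existsUnique_Z {c : Fin N} (hc : C.has labs c = true) :
    ∃! z : Fin N, relAt labs (relOf Z C linkZC) z c = true := by
  obtain ⟨h1, h2, h3⟩ := H.fld_C hc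
  have l1 := H.len1 ▸ fld_lt 1 labs c
  have l2 := H.len2 ▸ fld_lt 2 labs c
  obtain ⟨z, hz, z0, z1, z2, z3⟩ := H.exists_has hN (ρ := Z) (x := 0)
    (k := 2 ^ Nat.log 2 (fld 1 labs c)) (r := fld 2 labs c) (t := 0) (by positivity)
    (log_lt l1 h1) l2 (by positivity) (cond_Z.2 ⟨rfl, ⟨_, rfl⟩, h2, rfl⟩)
  refine ⟨z, H.rel_ZC.2 ⟨hz, hc, z2, z1⟩, fun z' hz' => ?_⟩
  obtain ⟨a, -, b, d⟩ := H.rel_ZC.1 hz'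
  exact H.has_ext hN a hz (by rw [z0, (H.fld_Z a).1]) (by rw [z1, d]) (by rw [z2, b])
    (by rw [z3, (H.fld_Z a).2.2.2])

lemma existsUnique_Y {c : Fin N} (hc : F.has labs c = true) :
    ∃! z : Fin N, relAt labs (relOf Y F linkYF) z c = true := by
  obtain ⟨h1, h2, h3, h4⟩ := H.fld_F hc
  have l1 := H.len3 ▸ fld_lt 3 labs c
  obtain ⟨z, hz, z0, z1, z2, z3⟩ := H.exists_has hN (ρ := Y) (x := 0)
    (k := 0) (r := 0) (t := 2 ^ Nat.log 2 (fld 3 labs c)) (by positivity)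
    (by positivity) (by positivity) (log_lt l1 h4) (cond_Y.2 ⟨rfl, rfl, rfl, _, rfl⟩)
  refine ⟨z, H.rel_YF.2 ⟨hz, hc, z3⟩, fun z' hz' => ?_⟩
  obtain ⟨a, -, b⟩ := H.rel_YF.1 hz'
  obtain ⟨a0, a1, a2, -⟩ := H.fld_Y a
  exact H.has_ext hN a hz (by rw [z0, a0]) (by rw [z1, a1]) (by rw [z2, a2]) (by rw [z3, b])

lemma existsUnique_D {c : Fin N} (hc : E.has labs c = true) :
    ∃! z : Fin N, relAt labs (relOf D E linkDE) z c = true := by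
  obtain ⟨z, hz, z0, z1, z2, z3⟩ := H.exists_has hN (ρ := D) (x := 0)
    (k := 0) (r := 0) (t := fld 3 labs c) (by positivity)
    (by positivity) (by positivity) (H.len3 ▸ fld_lt 3 labs c) (cond_D.2 ⟨rfl, rfl, rfl⟩)
  refine ⟨z, rel_DE.2 ⟨hz, hc, z3⟩, fun z' hz' => ?_⟩
  obtain ⟨a, -, b⟩ := rel_DE.1 hz'
  obtain ⟨a0, a1, a2⟩ := H.fld_D a
  exact H.has_ext hN a hz (by rw [z0, a0]) (by rw [z1, a1]) (by rw [z2, a2]) (by rw [z3, b])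

omit hN in
-- Field 0 occupies the lowest positions, so untagged addresses are the numbers of the input qubits
-- themselves, in the order that the circuit model prescribes.
lemma has_X_iff {v : ℕ} (hv : v < 2 ^ labs.length) : X.has labs v = true ↔ v < n := by
  have hle := Nat.pow_le_pow_right (n := 2) (by norm_num) H.le
  rw [H.has_iff, cond_X]
  constructor
  · rintro ⟨⟨h0, h1, h2, h3⟩, h4⟩
    obtain ⟨l0, l1⟩ := H.low (fld 0 labs v) (h0.trans H.lt)
    have : v = fld 0 labs v := by
      apply fld_ext (labs := labs) hv ((h0.trans H.lt).trans_le hle)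
      intro κ
      by_cases hκ : κ = 0
      · rw [hκ, l0]
      · rw [l1 κ hκ]
        by_cases h4' : 4 ≤ κ
        · rw [h4 κ h4']; exact if_neg hκ
        · have : κ = 1 ∨ κ = 2 ∨ κ = 3 := by clear * - hκ h4'; revert hκ h4'; revert κ; decide
          rcases this with rfl | rfl | rfl <;> assumption
    rwa [this]
  · intro h
    obtain ⟨l0, l1⟩ := H.low v (h.trans H.lt)
    refine ⟨⟨by rwa [l0], l1 _ (by decide), l1 _ (by decide), l1 _ (by decide)⟩, fun κ hκ => ?_⟩
    rw [if_neg (by rintro rfl; revert hκ; decide), l1 κ (by rintro rfl; revert hκ; decide)]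

omit hN in
lemma has_O_iff {v : ℕ} (hv : v < 2 ^ labs.length) : O.has labs v = true ↔ v = n := by
  have hle := Nat.pow_le_pow_right (n := 2) (by norm_num) H.le
  rw [H.has_iff, cond_O]
  constructor
  · rintro ⟨⟨h0, h1, h2, h3⟩, h4⟩
    obtain ⟨l0, l1⟩ := H.low n H.lt
    apply fld_ext (labs := labs) hv (H.lt.trans_le hle)
    intro κ
    by_cases hκ : κ = 0
    · rw [hκ, l0, h0]
    · rw [l1 κ hκ]
      by_cases h4' : 4 ≤ κ
      · rw [h4 κ h4']; exact if_neg hκ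
      · have : κ = 1 ∨ κ = 2 ∨ κ = 3 := by clear * - hκ h4'; revert hκ h4'; revert κ; decide
        rcases this with rfl | rfl | rfl <;> assumption
  · rintro rfl
    obtain ⟨l0, l1⟩ := H.low v H.lt
    refine ⟨⟨l0, l1 _ (by decide), l1 _ (by decide), l1 _ (by decide)⟩, fun κ hκ => ?_⟩
    rw [if_neg (by rintro rfl; revert hκ; decide), l1 κ (by rintro rfl; revert hκ; decide)]

lemma n_lt : n < N :=
  hN ▸ H.lt.trans_le (Nat.pow_le_pow_right (by norm_num) H.le)

/-- The first stage: rotations by multiples of the weight of the input. -/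
def stageA : Stage (Fin N) where
  I v := X.has labs v
  Z v := Z.has labs v
  C v := C.has labs v
  rI v w := relAt labs (relOf X C linkXC) v w
  rZ v w := relAt labs (relOf Z C linkZC) v w
  rel_I _ _ h := ⟨(rel_XC.1 h).1, (rel_XC.1 h).2.1⟩
  rel_Z _ _ h := ⟨(H.rel_ZC.1 h).1, (H.rel_ZC.1 h).2.1⟩
  not_IC _ h := H.not_has_of_tag' h (by decide) (by decide)
  not_ZC _ h := H.not_has_of_tag' h (by decide) (by decide)
  not_IZ _ h := H.not_has_of_tag' h (by decide) (by decide)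
  uniq_I i i' c h h' := by
    obtain ⟨a, -, b⟩ := rel_XC.1 h
    obtain ⟨a', -, b'⟩ := rel_XC.1 h'
    obtain ⟨-, a1, a2, a3⟩ := H.fld_X a
    obtain ⟨-, a1', a2', a3'⟩ := H.fld_X a'
    exact H.has_ext hN a a' (by rw [b, b']) (by rw [a1, a1']) (by rw [a2, a2']) (by rw [a3, a3'])
  uniq_Z _ h := H.existsUnique_Z hN h

/-- The second stage: rotations by multiples of the weight of the qubits of the first stage. -/
def stageB : Stage (Fin N) where
  I v := Z.has labs v
  Z v := Y.has labs v
  C v := F.has labs v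
  rI v w := relAt labs (relOf Z F linkZF) v w
  rZ v w := relAt labs (relOf Y F linkYF) v w
  rel_I _ _ h := ⟨(rel_ZF.1 h).1, (rel_ZF.1 h).2.1⟩
  rel_Z _ _ h := ⟨(H.rel_YF.1 h).1, (H.rel_YF.1 h).2.1⟩
  not_IC _ h := H.not_has_of_tag' h (by decide) (by decide)
  not_ZC _ h := H.not_has_of_tag' h (by decide) (by decide)
  not_IZ _ h := H.not_has_of_tag' h (by decide) (by decide)
  uniq_I i i' c h h' := by
    obtain ⟨a, -, b, d⟩ := rel_ZF.1 h
    obtain ⟨a', -, b', d'⟩ := rel_ZF.1 h'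
    obtain ⟨a0, -, -, a3⟩ := H.fld_Z a
    obtain ⟨a0', -, -, a3'⟩ := H.fld_Z a'
    exact H.has_ext hN a a' (by rw [a0, a0']) (by rw [b, b']) (by rw [d, d']) (by rw [a3, a3'])
  uniq_Z _ h := H.existsUnique_Y hN h

/-- The exact Or of the qubits of the second stage. -/
def parities : Parities (Fin N) where
  o := ⟨n, H.n_lt hN⟩
  Y v := Y.has labs v
  D v := D.has labs v
  E v := E.has labs v
  rY v w := relAt labs (relOf Y E linkYE) v w
  rD v w := relAt labs (relOf D E linkDE) v w
  rel_Y _ _ h := ⟨(H.rel_YE.1 h).1, (H.rel_YE.1 h).2.1⟩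
  rel_D _ _ h := ⟨(rel_DE.1 h).1, (rel_DE.1 h).2.1⟩
  uniq_Y y y' c h h' := by
    obtain ⟨a, -, b⟩ := H.rel_YE.1 h
    obtain ⟨a', -, b'⟩ := H.rel_YE.1 h'
    obtain ⟨a0, a1, a2, -⟩ := H.fld_Y a
    obtain ⟨a0', a1', a2', -⟩ := H.fld_Y a'
    exact H.has_ext hN a a' (by rw [a0, a0']) (by rw [a1, a1']) (by rw [a2, a2']) (by rw [b, b'])
  uniq_D _ h := H.existsUnique_D hN h
  not_YE _ h := H.not_has_of_tag' h (by decide) (by decide)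
  not_YD _ h := H.not_has_of_tag' h (by decide) (by decide)
  not_DE _ h := H.not_has_of_tag' h (by decide) (by decide)
  not_oD := H.not_has_of_tag' ((H.has_O_iff (hN ▸ H.n_lt hN)).2 rfl) (by decide) (by decide)
  not_oE := H.not_has_of_tag' ((H.has_O_iff (hN ▸ H.n_lt hN)).2 rfl) (by decide) (by decide)

lemma has_o : O.has labs (H.parities hN).o = true :=
  (H.has_O_iff (hN ▸ H.n_lt hN)).2 rfl

def layout : OrLayout (Fin N) where
  A := H.stageA hN
  B := H.stageB hN
  F := H.parities hN
  B_I := rfl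
  F_Y := rfl
  not_o_AI := by
    by_contra h
    rw [Bool.not_eq_false] at h
    exact lt_irrefl n ((H.has_X_iff (hN ▸ H.n_lt hN)).1 h)
  not_o_AZ := H.not_has_of_tag' (H.has_o hN) (by decide) (by decide)
  not_o_AC := H.not_has_of_tag' (H.has_o hN) (by decide) (by decide)
  not_o_BZ := H.not_has_of_tag' (H.has_o hN) (by decide) (by decide)
  not_o_BC := H.not_has_of_tag' (H.has_o hN) (by decide) (by decide)
  not_AI_BZ _ h := H.not_has_of_tag' h (by decide) (by decide)
  not_AI_BC _ h := H.not_has_of_tag' h (by decide) (by decide)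
  not_AI_D _ h := H.not_has_of_tag' h (by decide) (by decide)
  not_AI_E _ h := H.not_has_of_tag' h (by decide) (by decide)
  not_AZ_D _ h := H.not_has_of_tag' h (by decide) (by decide)
  not_AZ_E _ h := H.not_has_of_tag' h (by decide) (by decide)
  not_BZ_AC _ h := H.not_has_of_tag' h (by decide) (by decide)

end Labels

/-! ### Multiplicities of the rotations -/

/-- Every input that is one meets exactly m copies of z, numbered by the key, and different inputs
meet different copies. -/
lemma Stage.mult_eq {Q : Type} [Fintype Q] [DecidableEq Q] (S : Stage Q) (z : Q) (b : Q → Bool)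
    (key : Q → ℕ) (m : ℕ)
    (h : ∀ i, S.I i = true → Set.BijOn key {c | S.rZ z c = true ∧ S.rI i c = true}
      (Set.Ico m (2 * m))) :
    S.mult z b = (Finset.univ.filter fun i => S.I i = true ∧ b i = true).card * m := by
  have e : (Finset.univ.filter fun c => S.rZ z c = true ∧ ∃ i, S.rI i c = true ∧ b i = true) =
      (Finset.univ.filter fun i => S.I i = true ∧ b i = true).biUnion
        fun i => Finset.univ.filter fun c => S.rZ z c = true ∧ S.rI i c = true := by
    ext c
    simp only [Finset.mem_filter, Finset.mem_univ, true_and, Finset.mem_biUnion]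
    constructor
    · rintro ⟨h1, i, h2, h3⟩
      exact ⟨i, ⟨(S.rel_I i c h2).1, h3⟩, h1, h2⟩
    · rintro ⟨i, ⟨-, h3⟩, h1, h2⟩
      exact ⟨h1, i, h2, h3⟩
  unfold Stage.mult
  rw [e, Finset.card_biUnion, Finset.sum_const_nat]
  · intro i hi
    simp only [Finset.mem_filter, Finset.mem_univ, true_and] at hi
    have := h i hi.1
    have hm : (Finset.Ico m (2 * m)).card = m := by rw [Nat.card_Ico]; omega
    rw [← hm]
    apply Finset.card_nbij key
    · intro c hc
      simp only [Finset.coe_Ico]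
      exact this.mapsTo (by simpa using hc)
    · simpa using this.injOn
    · simpa using this.surjOn
  · intro i _ i' _ hne
    rw [Function.onFun, Finset.disjoint_left]
    intro c hc hc'
    simp only [Finset.mem_filter, Finset.mem_univ, true_and] at hc hc'
    exact hne (S.uniq_I i i' c hc.2 hc'.2)

lemma two_pow_log_eq_iff {x j : ℕ} (hx : x ≠ 0) :
    2 ^ j = 2 ^ Nat.log 2 x ↔ 2 ^ j ≤ x ∧ x < 2 * 2 ^ j := by
  rw [(Nat.pow_right_injective le_rfl).eq_iff, eq_comm, Nat.log_eq_iff (Or.inr ⟨by norm_num, hx⟩),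
    pow_succ, mul_comm 2]

lemma two_mul_pow_le {x j m : ℕ} (hj : 2 ^ j < 2 ^ m) (hx : x < 2 * 2 ^ j) : x < 2 ^ m := by
  have : j < m := (Nat.pow_lt_pow_iff_right (by norm_num)).1 hj
  calc x < 2 * 2 ^ j := hx
    _ = 2 ^ (j + 1) := by rw [pow_succ, mul_comm]
    _ ≤ 2 ^ m := Nat.pow_le_pow_right (by norm_num) this

namespace Labels

open Role

variable {n L M W : ℕ} {labs : List Lab} (H : Labels n L M W labs)
variable {N : ℕ} (hN : N = 2 ^ labs.length)

/-- The copies of z for a given input are numbered by k in [2^j, 2^(j+1)), so z is rotated by θ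
times the weight times 2^j. -/
lemma mult_A {z : Fin N} (hz : Z.has labs z = true) (b : Fin N → Bool) :
    (H.stageA hN).mult z b =
      (Finset.univ.filter fun i : Fin N => X.has labs i = true ∧ b i = true).card *
        2 ^ Nat.log 2 (fld 1 labs z) := by
  obtain ⟨-, ⟨j, hj⟩, hr, -⟩ := H.fld_Z hz
  have hj' : 2 ^ Nat.log 2 (fld 1 labs z) = 2 ^ j := by rw [hj, Nat.log_pow (by norm_num)]
  rw [hj']
  apply Stage.mult_eq _ _ _ (fun c : Fin N => fld 1 labs c)
  intro i hi
  change X.has labs i = true at hi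
  change Set.BijOn _ {c : Fin N | relAt labs (relOf Z C linkZC) z c = true ∧
    relAt labs (relOf X C linkXC) i c = true} _
  simp only [H.rel_ZC, rel_XC]
  refine ⟨?_, ?_, ?_⟩
  · rintro c ⟨⟨-, hc, -, h1⟩, -⟩
    rw [hj, two_pow_log_eq_iff (H.fld_C hc).1] at h1
    exact h1
  · rintro c ⟨⟨-, hc, h2, -⟩, -, -, h0⟩ c' ⟨⟨-, hc', h2', -⟩, -, -, h0'⟩ h1
    exact H.has_ext hN hc hc' (by rw [← h0, h0']) h1 (by rw [← h2, h2'])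
      (by rw [(H.fld_C hc).2.2, (H.fld_C hc').2.2])
  · rintro k ⟨hk, hk'⟩
    have hk0 : k ≠ 0 := by have := Nat.one_le_two_pow (n := j); omega
    obtain ⟨c, hc, c0, c1, c2, c3⟩ := H.exists_has hN (ρ := C) (x := fld 0 labs i)
      (k := k) (r := fld 2 labs z) (t := 0) (H.len0 ▸ fld_lt 0 labs i)
      (two_mul_pow_le (hj ▸ H.len1 ▸ fld_lt 1 labs z) hk') (H.len2 ▸ fld_lt 2 labs z)
      (by positivity) (cond_C.2 ⟨hk0, hr, rfl⟩)
    refine ⟨c, ⟨⟨hz, hc, c2.symm, ?_⟩, hi, hc, c0.symm⟩, c1⟩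
    rw [hj, c1, two_pow_log_eq_iff hk0]
    exact ⟨hk, hk'⟩

lemma mult_B {z : Fin N} (hz : Y.has labs z = true) (b : Fin N → Bool) :
    (H.stageB hN).mult z b =
      (Finset.univ.filter fun i : Fin N => Z.has labs i = true ∧ b i = true).card *
        2 ^ Nat.log 2 (fld 3 labs z) := by
  obtain ⟨-, -, -, ⟨j, hj⟩⟩ := H.fld_Y hz
  have hj' : 2 ^ Nat.log 2 (fld 3 labs z) = 2 ^ j := by rw [hj, Nat.log_pow (by norm_num)]
  rw [hj']
  apply Stage.mult_eq _ _ _ (fun c : Fin N => fld 3 labs c)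
  intro i hi
  change Z.has labs i = true at hi
  change Set.BijOn _ {c : Fin N | relAt labs (relOf Y F linkYF) z c = true ∧
    relAt labs (relOf Z F linkZF) i c = true} _
  simp only [H.rel_YF, rel_ZF]
  refine ⟨?_, ?_, ?_⟩
  · rintro c ⟨⟨-, hc, h1⟩, -⟩
    rw [hj, two_pow_log_eq_iff (H.fld_F hc).2.2.2] at h1
    exact h1
  · rintro c ⟨⟨-, hc, -⟩, -, -, h1, h2⟩ c' ⟨⟨-, hc', -⟩, -, -, h1', h2'⟩ h3
    exact H.has_ext hN hc hc' (by rw [(H.fld_F hc).1, (H.fld_F hc').1]) (by rw [← h1, h1'])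
      (by rw [← h2, h2']) h3
  · rintro k ⟨hk, hk'⟩
    have hk0 : k ≠ 0 := by have := Nat.one_le_two_pow (n := j); omega
    obtain ⟨-, i1, i2, -⟩ := H.fld_Z hi
    obtain ⟨c, hc, c0, c1, c2, c3⟩ := H.exists_has hN (ρ := F) (x := 0)
      (k := fld 1 labs i) (r := fld 2 labs i) (t := k) (by positivity)
      (H.len1 ▸ fld_lt 1 labs i) (H.len2 ▸ fld_lt 2 labs i)
      (two_mul_pow_le (hj ▸ H.len3 ▸ fld_lt 3 labs z) hk')
      (cond_F.2 ⟨rfl, i1, i2, hk0⟩)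
    refine ⟨c, ⟨⟨hz, hc, ?_⟩, hi, hc, c1.symm, c2.symm⟩, c3⟩
    rw [hj, c3, two_pow_log_eq_iff hk0]
    exact ⟨hk, hk'⟩

include H hN

omit H hN in
lemma log_lt_of_eq {x m : ℕ} (h : x < 2 ^ m) (h1 : ∃ j, x = 2 ^ j) : Nat.log 2 x < m := by
  obtain ⟨j, rfl⟩ := h1
  rw [Nat.log_pow (by norm_num)]
  exact (Nat.pow_lt_pow_iff_right (by norm_num)).1 h

omit H hN in
lemma eq_of_log_eq {x y : ℕ} (h1 : ∃ j, x = 2 ^ j) (h2 : ∃ j, y = 2 ^ j)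
    (h : Nat.log 2 x = Nat.log 2 y) : x = y := by
  obtain ⟨j, rfl⟩ := h1
  obtain ⟨k, rfl⟩ := h2
  rw [Nat.log_pow (by norm_num), Nat.log_pow (by norm_num)] at h
  rw [h]

lemma bijOn_Z : Set.BijOn (fun z : Fin N => (Nat.log 2 (fld 2 labs z), Nat.log 2 (fld 1 labs z)))
    {z | Z.has labs z = true} {p | p.1 < W ∧ p.2 < M} := by
  refine ⟨?_, ?_, ?_⟩
  · intro z hz
    obtain ⟨-, h1, h2, -⟩ := H.fld_Z hz
    exact ⟨log_lt_of_eq (H.len2 ▸ fld_lt 2 labs z) h2, log_lt_of_eq (H.len1 ▸ fld_lt 1 labs z) h1⟩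
  · intro z hz z' hz' h
    obtain ⟨h0, h1, h2, h3⟩ := H.fld_Z hz
    obtain ⟨h0', h1', h2', h3'⟩ := H.fld_Z hz'
    simp only [Prod.mk.injEq] at h
    exact H.has_ext hN hz hz' (by rw [h0, h0']) (eq_of_log_eq h1 h1' h.2)
      (eq_of_log_eq h2 h2' h.1) (by rw [h3, h3'])
  · rintro ⟨i, j⟩ ⟨hi, hj⟩
    obtain ⟨c, hc, c0, c1, c2, c3⟩ := H.exists_has hN (ρ := Z) (x := 0)
      (k := 2 ^ j) (r := 2 ^ i) (t := 0) (by positivity)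
      (Nat.pow_lt_pow_right (by norm_num) hj) (Nat.pow_lt_pow_right (by norm_num) hi)
      (by positivity) (cond_Z.2 ⟨rfl, ⟨_, rfl⟩, ⟨_, rfl⟩, rfl⟩)
    refine ⟨c, hc, ?_⟩
    simp only [c1, c2, Nat.log_pow (show 1 < 2 by norm_num)]

lemma bijOn_Y : Set.BijOn (fun z : Fin N => Nat.log 2 (fld 3 labs z))
    {z | Y.has labs z = true} {p | p < W} := by
  refine ⟨?_, ?_, ?_⟩
  · intro z hz
    obtain ⟨-, -, -, h3⟩ := H.fld_Y hz
    exact log_lt_of_eq (H.len3 ▸ fld_lt 3 labs z) h3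
  · intro z hz z' hz' h
    obtain ⟨h0, h1, h2, h3⟩ := H.fld_Y hz
    obtain ⟨h0', h1', h2', h3'⟩ := H.fld_Y hz'
    exact H.has_ext hN hz hz' (by rw [h0, h0']) (by rw [h1, h1']) (by rw [h2, h2'])
      (eq_of_log_eq h3 h3' h)
  · intro l hl
    obtain ⟨c, hc, c0, c1, c2, c3⟩ := H.exists_has hN (ρ := Y) (x := 0)
      (k := 0) (r := 0) (t := 2 ^ l) (by positivity) (by positivity) (by positivity)
      (Nat.pow_lt_pow_right (by norm_num) hl) (cond_Y.2 ⟨rfl, rfl, rfl, _, rfl⟩)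
    refine ⟨c, hc, ?_⟩
    simp only [c3, Nat.log_pow (show 1 < 2 by norm_num)]

lemma card_Z_le (b : Fin N → Bool) :
    (Finset.univ.filter fun i : Fin N => Z.has labs i = true ∧ b i = true).card ≤ W * M := by
  rw [← Finset.card_range W, ← Finset.card_range M, ← Finset.card_product]
  apply Finset.card_le_card_of_injOn
    (fun z : Fin N => (Nat.log 2 (fld 2 labs z), Nat.log 2 (fld 1 labs z)))
  · intro z hz
    simp only [Finset.coe_filter, Finset.mem_univ, true_and, Set.mem_ofPred_eq] at hz
    simpa using (H.bijOn_Z hN).mapsTo hz.1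
  · apply (H.bijOn_Z hN).injOn.mono
    intro z hz
    simp only [Finset.coe_filter, Finset.mem_univ, true_and, Set.mem_ofPred_eq] at hz
    exact hz.1

lemma card_X_le (b : Fin N → Bool) :
    (Finset.univ.filter fun i : Fin N => X.has labs i = true ∧ b i = true).card ≤ n := by
  conv_rhs => rw [← Finset.card_range n]
  apply Finset.card_le_card_of_injOn (fun z : Fin N => (z : ℕ))
  · intro z hz
    simp only [Finset.coe_filter, Finset.mem_univ, true_and, Set.mem_ofPred_eq] at hz
    simpa using (H.has_X_iff (hN ▸ z.2)).1 hz.1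
  · exact Fin.val_injective.injOn

/-- The product runs over W independent repetitions of the M qubits with factors 2^j; with M = L + 7
each repetition contributes at most 1/4. -/
lemma prod_stageA_le (hM : M = L + 7) {b : Fin N → Bool}
    (hb : ∃ q : Fin N, X.has labs q = true ∧ b q = true) :
    ∏ z with (H.stageA hN).Z z = true, Real.cos (angle * (H.stageA hN).mult z b) ^ 2 ≤
      (1 / 4) ^ W := by
  set w := (Finset.univ.filter fun i : Fin N => X.has labs i = true ∧ b i = true).card with hw
  have hw1 : 1 ≤ w := by
    obtain ⟨q, hq⟩ := hb
    exact Finset.card_pos.2 ⟨q, by simpa using hq⟩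
  have hwn : w ≤ n := H.card_X_le hN b
  have e : ∏ z ∈ Finset.univ.filter (fun z : Fin N => Z.has labs z = true), Real.cos (angle * (H.stageA hN).mult z b) ^ 2 =
      ∏ p ∈ Finset.range W ×ˢ Finset.range M, Real.cos (angle * w * 2 ^ p.2) ^ 2 := by
    apply Finset.prod_nbij
      (fun z : Fin N => (Nat.log 2 (fld 2 labs z), Nat.log 2 (fld 1 labs z)))
    · intro z hz
      simpa using (H.bijOn_Z hN).mapsTo (show Z.has labs z = true by simpa using hz)
    · have := (H.bijOn_Z hN).injOn
      simpa using this
    · have := (H.bijOn_Z hN).surjOn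
      rintro ⟨i, j⟩ hij
      obtain ⟨z, hz, hz'⟩ := this (show (i, j).1 < W ∧ (i, j).2 < M by simpa using hij)
      exact ⟨z, by simpa using hz, hz'⟩
    · intro z hz
      rw [H.mult_A hN (show Z.has labs z = true by simpa using hz)]
      push_cast
      rw [mul_assoc]
  refine (le_of_eq e).trans ?_
  rw [Finset.prod_product]
  simp only [Finset.prod_const, Finset.card_range]
  apply pow_le_pow_left₀ (Finset.prod_nonneg fun _ _ => sq_nonneg _)
  refine (prod_cos_sq_le w M hw1).trans ?_
  have h2 : (w : ℝ) ≤ 2 ^ L := by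
    have := H.lt
    exact_mod_cast (hwn.trans this.le)
  rw [hM, div_le_iff₀ (by positivity)]
  -- Since w ≤ 2^L, the ratio (64w)²/4^(L+7) is at most 4096/16384 = 1/4.
  have h4 : (4 : ℝ) ^ (L + 7) = (2 ^ L) ^ 2 * 16384 := by
    rw [pow_add, ← pow_mul, mul_comm L, pow_mul]; norm_num
  rw [h4]
  have : (64 * (w : ℝ)) ^ 2 ≤ (64 * 2 ^ L) ^ 2 := by gcongr
  linarith [this, show (64 * (2 : ℝ) ^ L) ^ 2 = 4096 * (2 ^ L) ^ 2 by ring]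

/-- The weight is now at most W·M instead of n, so W qubits without repetition are enough. -/
lemma prod_stageB_le {b : Fin N → Bool} (hb : ∃ q : Fin N, Z.has labs q = true ∧ b q = true) :
    ∏ z with (H.stageB hN).Z z = true, Real.cos (angle * (H.stageB hN).mult z b) ^ 2 ≤
      (64 * (W * M : ℕ)) ^ 2 / 4 ^ W := by
  set w := (Finset.univ.filter fun i : Fin N => Z.has labs i = true ∧ b i = true).card with hw
  have hw1 : 1 ≤ w := by
    obtain ⟨q, hq⟩ := hb
    exact Finset.card_pos.2 ⟨q, by simpa using hq⟩
  have hwn : w ≤ W * M := H.card_Z_le hN b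
  have e : ∏ z ∈ Finset.univ.filter (fun z : Fin N => Y.has labs z = true), Real.cos (angle * (H.stageB hN).mult z b) ^ 2 =
      ∏ p ∈ Finset.range W, Real.cos (angle * w * 2 ^ p) ^ 2 := by
    apply Finset.prod_nbij (fun z : Fin N => Nat.log 2 (fld 3 labs z))
    · intro z hz
      simpa using (H.bijOn_Y hN).mapsTo (show Y.has labs z = true by simpa using hz)
    · have := (H.bijOn_Y hN).injOn
      simpa using this
    · have := (H.bijOn_Y hN).surjOn
      intro i hi
      obtain ⟨z, hz, hz'⟩ := this (show i < W by simpa using hi)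
      exact ⟨z, by simpa using hz, hz'⟩
    · intro z hz
      rw [H.mult_B hN (show Y.has labs z = true by simpa using hz)]
      push_cast
      rw [mul_assoc]
  refine (le_of_eq e).trans ?_
  refine (prod_cos_sq_le w W hw1).trans ?_
  gcongr

end Labels

/-! ### The number of odd parities and the number of qubits that are used -/

lemma odd_flip {W l₀ : ℕ} {B : ℕ → Prop} [DecidablePred B] (hl : l₀ < W) (hB : B l₀) (t : ℕ) :
    Odd ((Finset.range W).filter fun l => (t ^^^ 2 ^ l₀).testBit l = true ∧ B l).card ↔
      ¬ Odd ((Finset.range W).filter fun l => t.testBit l = true ∧ B l).card := by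
  have key : ∀ t : ℕ, t.testBit l₀ = false →
      (Odd ((Finset.range W).filter fun l => (t ^^^ 2 ^ l₀).testBit l = true ∧ B l).card ↔
      ¬ Odd ((Finset.range W).filter fun l => t.testBit l = true ∧ B l).card) := by
    intro t ht
    have e : ((Finset.range W).filter fun l => (t ^^^ 2 ^ l₀).testBit l = true ∧ B l) =
        insert l₀ ((Finset.range W).filter fun l => t.testBit l = true ∧ B l) := by
      ext l
      simp only [Finset.mem_filter, Finset.mem_range, Finset.mem_insert, Nat.testBit_xor,
        Nat.testBit_two_pow]
      by_cases h : l = l₀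
      · subst h; simp [ht, hl, hB]
      · simp [h, Ne.symm h]
    rw [e, Finset.card_insert_of_notMem (by simp [ht]), Nat.odd_add_one]
  cases ht : t.testBit l₀
  · exact key t ht
  -- If t already contains the element, the other case applies to t with it removed, and toggling
  -- again returns t.
  · have := key (t ^^^ 2 ^ l₀) (by simp [Nat.testBit_xor, ht])
    rw [Nat.xor_assoc, Nat.xor_self, Nat.xor_zero] at this
    rw [this, not_not]

/-- Toggling a fixed element of the nonzero word pairs the subsets of odd parity with those of even
parity. -/
lemma card_odd {W l₀ : ℕ} {B : ℕ → Prop} [DecidablePred B] (hl : l₀ < W) (hB : B l₀) :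
    2 * ((Finset.range (2 ^ W)).filter fun t =>
      Odd ((Finset.range W).filter fun l => t.testBit l = true ∧ B l).card).card = 2 ^ W := by
  have h1 := Finset.card_filter_add_card_filter_not (s := Finset.range (2 ^ W)) (fun t =>
      Odd ((Finset.range W).filter fun l => t.testBit l = true ∧ B l).card)
  have hlt : ∀ t < 2 ^ W, t ^^^ 2 ^ l₀ < 2 ^ W := fun t ht =>
    Nat.xor_lt_two_pow ht (Nat.pow_lt_pow_right (by norm_num) hl)
  have h2 : ((Finset.range (2 ^ W)).filter fun t =>
      Odd ((Finset.range W).filter fun l => t.testBit l = true ∧ B l).card).card =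
      ((Finset.range (2 ^ W)).filter fun t =>
      ¬ Odd ((Finset.range W).filter fun l => t.testBit l = true ∧ B l).card).card := by
    apply Finset.card_nbij' (fun t => t ^^^ 2 ^ l₀) (fun t => t ^^^ 2 ^ l₀)
    · intro t ht
      simp only [Finset.coe_filter, Finset.mem_range, Set.mem_ofPred_eq, odd_flip hl hB,
        not_not] at ht ⊢
      exact ⟨hlt t ht.1, ht.2⟩
    · intro t ht
      simp only [Finset.coe_filter, Finset.mem_range, Set.mem_ofPred_eq, odd_flip hl hB] at ht ⊢
      exact ⟨hlt t ht.1, ht.2⟩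
    · intro t _
      simp
    · intro t _
      simp
  rw [Finset.card_range] at h1
  omega

lemma Stage.support_specs {Q : Type} (S : Stage Q) {s : LayerSpec Q} {q : Q}
    (hs : s ∈ S.specs ∨ s ∈ S.invSpecs) (hq : s.support q) :
    S.I q = true ∨ S.Z q = true ∨ S.C q = true := by
  have hI : ∀ a, S.rI a q = true → S.C q = true := fun a h => (S.rel_I a q h).2
  have hZ : ∀ a, S.rZ a q = true → S.C q = true := fun a h => (S.rel_Z a q h).2
  have key : s = .had S.Z ∨ s = .fan S.Z S.rZ ∨ s = .rot S.C ∨ s = .fan S.I S.rI ∨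
      s = .rotInv S.C := by
    simp only [Stage.specs, Stage.invSpecs, List.mem_cons, List.not_mem_nil, or_false] at hs
    tauto
  rcases key with rfl | rfl | rfl | rfl | rfl <;> simp only [LayerSpec.support] at hq <;> grind

lemma Parities.support_specs {Q : Type} [DecidableEq Q] (F : Parities Q) {s : LayerSpec Q} {q : Q}
    (hs : s ∈ F.specs) (hq : s.support q) :
    F.isO q = true ∨ F.Y q = true ∨ F.D q = true ∨ F.E q = true := by
  have hY : ∀ a, F.rY a q = true → F.E q = true := fun a h => (F.rel_Y a q h).2
  have hD : ∀ a, F.rD a q = true → F.E q = true := fun a h => (F.rel_D a q h).2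
  simp only [Parities.specs, Parities.parSpecs, List.cons_append, List.nil_append, List.mem_cons,
    List.not_mem_nil, or_false] at hs
  have key : s = .fan F.isO (fun _ => F.D) ∨ s = .rot F.D ∨ s = .fan F.Y F.rY ∨ s = .had F.D ∨
      s = .had F.E ∨ s = .fan F.D F.rD ∨ s = .rotInv F.D := by
    tauto
  rcases key with rfl | rfl | rfl | rfl | rfl | rfl | rfl <;>
    simp only [LayerSpec.support] at hq <;> grind

namespace Labels

open Role

variable {n L M W : ℕ} {labs : List Lab} (H : Labels n L M W labs)
variable {N : ℕ} (hN : N = 2 ^ labs.length)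

open Classical in
-- The element qubits of d correspond, by the logarithm of field 2, to the elements of the subset t;
-- those that receive a one are the l with y_l = 1.
lemma val_eq {d : Fin N} (hd : D.has labs d = true) (b : Fin N → Bool) :
    (H.parities hN).val d b = true ↔ Odd ((Finset.range W).filter fun l =>
      (fld 3 labs d).testBit l = true ∧
        ∃ y : Fin N, Y.has labs y = true ∧ fld 3 labs y = 2 ^ l ∧ b y = true).card := by
  unfold Parities.val
  rw [decide_eq_true_iff]
  refine iff_of_eq (congrArg Odd ?_)
  apply Finset.card_nbij (fun e : Fin N => Nat.log 2 (fld 2 labs e))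
  · intro e he
    simp only [Finset.coe_filter, Finset.mem_univ, true_and, Set.mem_ofPred_eq] at he
    obtain ⟨h1, y, h2, hy⟩ := he
    obtain ⟨-, he, h1⟩ := rel_DE.1 h1
    obtain ⟨h3, -, h2⟩ := H.rel_YE.1 h2
    obtain ⟨-, -, l, hl, hl'⟩ := H.fld_E he
    have hlW := H.len2 ▸ fld_lt 2 labs e
    simp only [Finset.coe_filter, Finset.mem_range, Set.mem_ofPred_eq]
    rw [hl] at hlW
    rw [hl, Nat.log_pow (by norm_num), h1]
    exact ⟨(Nat.pow_lt_pow_iff_right (by norm_num)).1 hlW, hl', y, h3, by rw [h2, hl], hy⟩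
  · intro e he e' he' h
    simp only [Finset.coe_filter, Finset.mem_univ, true_and, Set.mem_ofPred_eq] at he he'
    obtain ⟨-, hE, h1⟩ := rel_DE.1 he.1
    obtain ⟨-, hE', h1'⟩ := rel_DE.1 he'.1
    obtain ⟨e0, e1, l, hl, -⟩ := H.fld_E hE
    obtain ⟨e0', e1', l', hl', -⟩ := H.fld_E hE'
    exact H.has_ext hN hE hE' (by rw [e0, e0']) (by rw [e1, e1'])
      (eq_of_log_eq ⟨_, hl⟩ ⟨_, hl'⟩ h) (by rw [← h1, h1'])
  · intro l hl
    simp only [Finset.coe_filter, Finset.mem_range, Set.mem_ofPred_eq] at hl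
    obtain ⟨hlW, hlt, y, hy, hyl, hby⟩ := hl
    obtain ⟨e, he, e0, e1, e2, e3⟩ := H.exists_has hN (ρ := E) (x := 0) (k := 0) (r := 2 ^ l)
      (t := fld 3 labs d) (by positivity) (by positivity)
      (Nat.pow_lt_pow_right (by norm_num) hlW) (H.len3 ▸ fld_lt 3 labs d)
      (cond_E.2 ⟨rfl, rfl, l, rfl, hlt⟩)
    refine ⟨e, ?_, by simp only [e2, Nat.log_pow (show 1 < 2 by norm_num)]⟩
    simp only [Finset.coe_filter, Finset.mem_univ, true_and, Set.mem_ofPred_eq]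
    exact ⟨rel_DE.2 ⟨hd, he, e3.symm⟩, y, H.rel_YE.2 ⟨hy, he, by rw [hyl, e2]⟩, hby⟩

include H hN in
lemma bijOn_D : Set.BijOn (fun z : Fin N => fld 3 labs z)
    {z | D.has labs z = true} {t | t < 2 ^ W} := by
  refine ⟨?_, ?_, ?_⟩
  · intro z _
    exact H.len3 ▸ fld_lt 3 labs z
  · intro z hz z' hz' h
    obtain ⟨h0, h1, h2⟩ := H.fld_D hz
    obtain ⟨h0', h1', h2'⟩ := H.fld_D hz'
    exact H.has_ext hN hz hz' (by rw [h0, h0']) (by rw [h1, h1']) (by rw [h2, h2']) h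
  · intro t ht
    obtain ⟨c, hc, c0, c1, c2, c3⟩ := H.exists_has hN (ρ := D) (x := 0)
      (k := 0) (r := 0) (t := t) (by positivity) (by positivity) (by positivity) ht
      (cond_D.2 ⟨rfl, rfl, rfl⟩)
    exact ⟨c, hc, c3⟩

open Classical in
-- The qubits D are all subsets, so this is `card_odd` in terms of qubits.
lemma two_mul_cnt {b : Fin N → Bool} (hb : ∃ y : Fin N, Y.has labs y = true ∧ b y = true) :
    2 * (H.parities hN).cnt b = 2 ^ W := by
  obtain ⟨y, hy, hby⟩ := hb
  obtain ⟨-, -, -, l, hl⟩ := H.fld_Y hy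
  have hlW := H.len3 ▸ fld_lt 3 labs y
  rw [hl] at hlW
  rw [← card_odd (W := W) (l₀ := l)
    (B := fun l => ∃ y : Fin N, Y.has labs y = true ∧ fld 3 labs y = 2 ^ l ∧ b y = true)
    ((Nat.pow_lt_pow_iff_right (by norm_num)).1 hlW) ⟨y, hy, hl, hby⟩]
  congr 1
  have hB := H.bijOn_D hN
  apply Finset.card_nbij (fun e : Fin N => fld 3 labs e)
  · intro d hd
    simp only [Finset.coe_filter, Finset.mem_univ, true_and, Set.mem_ofPred_eq] at hd
    have hd' : D.has labs d = true := hd.1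
    simp only [Finset.coe_filter, Finset.mem_range, Set.mem_ofPred_eq, ← H.val_eq hN hd']
    exact ⟨hB.mapsTo hd', hd.2⟩
  · apply hB.injOn.mono
    intro d hd
    simp only [Finset.coe_filter, Finset.mem_univ, true_and, Set.mem_ofPred_eq] at hd
    exact hd.1
  · intro t ht
    simp only [Finset.coe_filter, Finset.mem_range, Set.mem_ofPred_eq] at ht
    obtain ⟨d, hd, rfl⟩ := hB.surjOn ht.1
    refine ⟨d, ?_, rfl⟩
    simp only [Finset.coe_filter, Finset.mem_univ, true_and, Set.mem_ofPred_eq, H.val_eq hN hd]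
    exact ⟨hd, ht.2⟩

/-- The total phase is 2θ·2^(W-1) = θ·2^W, and W has the form for which the angle was chosen. -/
lemma cos_cnt_le {i : ℕ} (hW : W = 3 * 2 ^ i) {b : Fin N → Bool}
    (hb : ∃ y : Fin N, Y.has labs y = true ∧ b y = true) :
    Real.cos (2 * angle * (H.parities hN).cnt b) ≤ -1 + 20 / 4 ^ W := by
  have h : 2 * angle * (H.parities hN).cnt b = angle * 2 ^ W := by
    rw [show (2 : ℝ) ^ W = ((2 ^ W : ℕ) : ℝ) by push_cast; rfl, ← H.two_mul_cnt hN hb]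
    push_cast
    ring
  rw [h, hW]
  exact cos_angle_pow_le i

/-- The qubits that are used by the circuit. -/
def used (N : ℕ) (labs : List Lab) : Finset (Fin N) :=
  Finset.univ.filter fun v => X.has labs v = true ∨ O.has labs v = true ∨ Z.has labs v = true ∨
    C.has labs v = true ∨ Y.has labs v = true ∨ F.has labs v = true ∨ D.has labs v = true ∨
    E.has labs v = true

lemma mem_used (s : LayerSpec (Fin N)) (hs : s ∈ (H.layout hN).specs) (q : Fin N)
    (hq : s.support q) : q ∈ used N labs := by
  have hO : (H.parities hN).isO q = true → O.has labs q = true := by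
    intro hv
    rw [(H.has_O_iff (hN ▸ q.2))]
    have : q = (H.parities hN).o := by simpa [Parities.isO] using hv
    rw [this]; rfl
  have hA : (H.stageA hN).I q = true ∨ (H.stageA hN).Z q = true ∨ (H.stageA hN).C q = true →
      q ∈ used N labs := by
    rintro (h | h | h) <;> simp only [stageA] at h <;> simp [used, h]
  have hB : (H.stageB hN).I q = true ∨ (H.stageB hN).Z q = true ∨ (H.stageB hN).C q = true →
      q ∈ used N labs := by
    rintro (h | h | h) <;> simp only [stageB] at h <;> simp [used, h]
  simp only [OrLayout.specs, List.mem_append, List.mem_singleton] at hs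
  rcases hs with (((((rfl | hs) | hs) | hs) | hs) | hs) | rfl
  · simp [used, hO hq]
  · exact hA ((H.stageA hN).support_specs (Or.inl hs) hq)
  · exact hB ((H.stageB hN).support_specs (Or.inl hs) hq)
  · rcases (H.parities hN).support_specs hs hq with h | h | h | h
    · simp [used, hO h]
    all_goals simp only [parities] at h; simp [used, h]
  · exact hB ((H.stageB hN).support_specs (Or.inr hs) hq)
  · exact hA ((H.stageA hN).support_specs (Or.inr hs) hq)
  · simp [used, hO hq]

include H hN in
lemma card_role_le (ρ : Role) (A B C D : Finset ℕ)
    (h : ∀ a b c d, a < 2 ^ L → b < 2 ^ M → c < 2 ^ W → d < 2 ^ W → ρ.Cond n a b c d →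
      a ∈ A ∧ b ∈ B ∧ c ∈ C ∧ d ∈ D) :
    (Finset.univ.filter fun v : Fin N => ρ.has labs v = true).card ≤
      A.card * (B.card * (C.card * D.card)) := by
  rw [← Finset.card_product, ← Finset.card_product, ← Finset.card_product]
  apply Finset.card_le_card_of_injOn
    (fun v : Fin N => (fld 0 labs v, fld 1 labs v, fld 2 labs v, fld 3 labs v))
  · intro v hv
    simp only [Finset.coe_filter, Finset.mem_univ, true_and, Set.mem_ofPred_eq] at hv
    simpa using h _ _ _ _ (H.len0 ▸ fld_lt 0 labs v) (H.len1 ▸ fld_lt 1 labs v)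
      (H.len2 ▸ fld_lt 2 labs v) (H.len3 ▸ fld_lt 3 labs v) ((H.has_iff _ _).1 hv).1
  · intro v hv v' hv' e
    simp only [Finset.coe_filter, Finset.mem_univ, true_and, Set.mem_ofPred_eq] at hv hv'
    simp only [Prod.mk.injEq] at e
    exact H.has_ext hN hv hv' e.1 e.2.1 e.2.2.1 e.2.2.2

omit H hN in
lemma card_pows_le (m : ℕ) : ((Finset.range m).image (2 ^ ·)).card ≤ m :=
  Finset.card_image_le.trans (Finset.card_range m).le

omit H hN in
lemma mem_pows {x m : ℕ} (h : x < 2 ^ m) (h' : ∃ j, x = 2 ^ j) :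
    x ∈ (Finset.range m).image (2 ^ ·) := by
  obtain ⟨j, rfl⟩ := h'
  exact Finset.mem_image.2 ⟨j, Finset.mem_range.2 ((Nat.pow_lt_pow_iff_right (by norm_num)).1 h),
    rfl⟩

include H hN in
-- Each role is counted by the possible contents of its four fields. The term 2^L·(2^M·W) stems from
-- the copies of stage A and has order n²·W; the terms with 2^W stem from stage B and the subsets.
lemma card_used_le : (used N labs).card ≤ n + 1 + W * M + 2 ^ L * (2 ^ M * W) + W +
    M * (W * 2 ^ W) + 2 ^ W + W * 2 ^ W := by
  have p := card_pows_le
  have c1 : (({0} : Finset ℕ)).card = 1 := rfl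
  have r := fun m : ℕ => Finset.card_range m
  have hX := H.card_role_le hN X (Finset.range n) {0} {0} {0} (by
    intro a b c d _ _ _ _ h
    simpa using cond_X.1 h)
  have hO := H.card_role_le hN O {n} {0} {0} {0} (by
    intro a b c d _ _ _ _ h
    simpa using cond_O.1 h)
  have hZ := H.card_role_le hN Z {0} ((Finset.range M).image (2 ^ ·))
    ((Finset.range W).image (2 ^ ·)) {0} (by
    intro a b c d _ hb hc _ h
    obtain ⟨h0, h1, h2, h3⟩ := cond_Z.1 h
    exact ⟨by simpa using h0, mem_pows hb h1, mem_pows hc h2, by simpa using h3⟩)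
  have hC := H.card_role_le hN C (Finset.range (2 ^ L)) (Finset.range (2 ^ M))
    ((Finset.range W).image (2 ^ ·)) {0} (by
    intro a b c d ha hb hc _ h
    obtain ⟨h1, h2, h3⟩ := cond_C.1 h
    exact ⟨by simpa using ha, by simpa using hb, mem_pows hc h2, by simpa using h3⟩)
  have hY := H.card_role_le hN Y {0} {0} {0} ((Finset.range W).image (2 ^ ·)) (by
    intro a b c d _ _ _ hd h
    obtain ⟨h0, h1, h2, h3⟩ := cond_Y.1 h
    exact ⟨by simpa using h0, by simpa using h1, by simpa using h2, mem_pows hd h3⟩)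
  have hF := H.card_role_le hN F {0} ((Finset.range M).image (2 ^ ·))
    ((Finset.range W).image (2 ^ ·)) (Finset.range (2 ^ W)) (by
    intro a b c d _ hb hc hd h
    obtain ⟨h0, h1, h2, h3⟩ := cond_F.1 h
    exact ⟨by simpa using h0, mem_pows hb h1, mem_pows hc h2, by simpa using hd⟩)
  have hD := H.card_role_le hN D {0} {0} {0} (Finset.range (2 ^ W)) (by
    intro a b c d _ _ _ hd h
    obtain ⟨h0, h1, h2⟩ := cond_D.1 h
    exact ⟨by simpa using h0, by simpa using h1, by simpa using h2, by simpa using hd⟩)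
  have hE := H.card_role_le hN E {0} {0} ((Finset.range W).image (2 ^ ·))
    (Finset.range (2 ^ W)) (by
    intro a b c d _ _ hc hd h
    obtain ⟨h0, h1, l, h2, -⟩ := cond_E.1 h
    exact ⟨by simpa using h0, by simpa using h1, mem_pows hc ⟨l, h2⟩, by simpa using hd⟩)
  simp only [Finset.card_singleton, mul_one, one_mul, Finset.card_range] at hX hO hZ hC hY hF hD hE
  have hZ' := hZ.trans (Nat.mul_le_mul (p M) (p W))
  have hC' := hC.trans (Nat.mul_le_mul_left _ (Nat.mul_le_mul_left _ (p W)))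
  have hY' := hY.trans (p W)
  have hF' := hF.trans (Nat.mul_le_mul (p M) (Nat.mul_le_mul_right _ (p W)))
  have hE' := hE.trans (Nat.mul_le_mul_right _ (p W))
  rw [mul_comm M W] at hZ'
  unfold used
  simp only [Finset.filter_or]
  have u := fun s t : Finset (Fin N) => Finset.card_union_le s t
  refine (u _ _).trans ?_
  refine (Nat.add_le_add_left (u _ _) _).trans ?_
  refine (Nat.add_le_add_left (Nat.add_le_add_left (u _ _) _) _).trans ?_
  refine (Nat.add_le_add_left (Nat.add_le_add_left (Nat.add_le_add_left (u _ _) _) _) _).trans ?_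
  refine (Nat.add_le_add_left (Nat.add_le_add_left (Nat.add_le_add_left
    (Nat.add_le_add_left (u _ _) _) _) _) _).trans ?_
  refine (Nat.add_le_add_left (Nat.add_le_add_left (Nat.add_le_add_left
    (Nat.add_le_add_left (Nat.add_le_add_left (u _ _) _) _) _) _) _).trans ?_
  refine (Nat.add_le_add_left (Nat.add_le_add_left (Nat.add_le_add_left
    (Nat.add_le_add_left (Nat.add_le_add_left (Nat.add_le_add_left (u _ _) _) _) _) _) _) _).trans ?_
  omega

end Labels

/-! ### The labels of the circuit of size `n` -/

/-- Double `u` until the sum of `3 * u` over all steps reaches `l`. -/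
def grow (u l : ℕ) : ℕ := if l = 0 ∨ u = 0 then u else grow (2 * u) (l - 3 * u)
termination_by l
decreasing_by omega

lemma grow_zero (u : ℕ) : grow u 0 = u := by rw [grow]; simp

lemma grow_pos {u l : ℕ} (hu : u ≠ 0) (hl : l ≠ 0) : grow u l = grow (2 * u) (l - 3 * u) := by
  rw [grow, if_neg (by simp [hu, hl])]

/-- W must be 3 times a power of two and still linear in log n. Starting from 96 = 3·2^5, doubling
keeps the form. The lower bound serves the error, the upper bound the size. -/
lemma grow_spec (l : ℕ) : ∀ u, u ≠ 0 → (∃ i, grow u l = u * 2 ^ i) ∧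
    l + 3 * u ≤ 3 * grow u l ∧ 3 * grow u l ≤ 6 * u + 2 * l := by
  induction l using Nat.strong_induction_on with
  | _ l ih =>
    intro u hu
    by_cases hl : l = 0
    · subst hl
      rw [grow_zero]
      exact ⟨⟨0, by simp⟩, by omega, by omega⟩
    · rw [grow_pos hu hl]
      obtain ⟨⟨i, hi⟩, h1, h2⟩ := ih (l - 3 * u) (by omega) (2 * u) (by omega)
      refine ⟨⟨i + 1, by rw [hi, pow_succ]; ring⟩, by omega, ?_⟩
      by_cases h3 : 3 * u ≤ l
      · omega
      · rw [show l - 3 * u = 0 by omega, grow_zero]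
        omega

/-- Pairs of labels of the fields `2` and `3`. -/
def pairLabs (w : ℕ) : List Lab := (List.replicate w [((2 : Kind), false), (3, false)]).flatten

/-- The labels that do not depend on the number of input qubits. -/
def constLabs : List Lab :=
  [4, 5, 6, 7, 8, 9, 1, 1, 1, 1, 1, 1, 1].map (fun κ : Kind => (κ, false)) ++ pairLabs 96

/-- The length of the fields `2` and `3`. -/
def width (h n : ℕ) : ℕ := grow 96 (h * n.size)

/-- Field 0 comes first, and its labels store the digits of n for the comparison with x. Field 1 has
length `n.size` + 7, the seven coming from `constLabs`. Fields 2 and 3 are interleaved, 96 pairs of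
them constant. -/
def labels (h n : ℕ) : List Lab :=
  (n.bits.map fun b => ((0 : Kind), b)) ++ (List.replicate n.size ((1 : Kind), false) ++
    (constLabs ++ pairLabs (width h n - 96)))

lemma pairLabs_succ (w : ℕ) : pairLabs (w + 1) = (2, false) :: (3, false) :: pairLabs w := by
  simp [pairLabs, List.replicate_succ]

lemma flen_pairLabs (κ : Kind) (w : ℕ) :
    flen κ (pairLabs w) = if κ = 2 ∨ κ = 3 then w else 0 := by
  induction w with
  | zero => simp [pairLabs, flen]
  | succ w ih =>
    rw [pairLabs_succ]
    simp only [flen, ih]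
    by_cases h2 : κ = 2
    · subst h2; simp
    · by_cases h3 : κ = 3
      · subst h3; simp
      · simp [h2, h3, Ne.symm h2, Ne.symm h3]

lemma paired_pairLabs (w : ℕ) : Paired (pairLabs w) := by
  induction w with
  | zero => exact .nil
  | succ w ih => rw [pairLabs_succ]; exact .pair _ _ _ ih

lemma Paired.of_forall {l : List Lab} (h : ∀ x ∈ l, x.1 ≠ 2 ∧ x.1 ≠ 3) : Paired l := by
  induction l with
  | nil => exact .nil
  | cons a l ih =>
    exact .other a l (h a List.mem_cons_self).1 (h a List.mem_cons_self).2
      (ih fun x hx => h x (List.mem_cons_of_mem _ hx))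

lemma flen_inputs (κ : Kind) (l : List Bool) :
    flen κ (l.map fun b => ((0 : Kind), b)) = if κ = 0 then l.length else 0 := by
  induction l with
  | nil => simp [flen]
  | cons a l ih =>
    simp only [List.map_cons, flen, ih, List.length_cons]
    by_cases h : κ = 0
    · simp [h]
    · simp [h, Ne.symm h]

lemma fld_zero_right (κ : Kind) (l : List Lab) : fld κ l 0 = 0 := by
  induction l with
  | nil => rfl
  | cons a l ih => simp [fld, ih, bitOf]

lemma fld_inputs (κ : Kind) (l : List Bool) (x : ℕ) (hx : x < 2 ^ l.length) :
    fld κ (l.map fun b => ((0 : Kind), b)) x = if κ = 0 then x else 0 := by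
  induction l generalizing x with
  | nil =>
    simp only [List.length_nil, pow_zero] at hx
    simp only [List.map_nil, fld]
    split_ifs <;> omega
  | cons a l ih =>
    rw [List.length_cons, pow_succ] at hx
    have := ih (x / 2) (by omega)
    simp only [List.map_cons, fld, this, toNat_bitOf]
    by_cases h : κ = 0
    · subst h; simp; omega
    · simp [h, Ne.symm h]

lemma nval_append {l₁ l₂ : List Lab} (h : ∀ x ∈ l₂, x.1 ≠ 0) : nval (l₁ ++ l₂) = nval l₁ := by
  induction l₁ with
  | nil =>
    rw [List.nil_append]
    induction l₂ with
    | nil => rfl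
    | cons a l ih =>
      simp only [nval, if_neg (h a List.mem_cons_self),
        ih fun x hx => h x (List.mem_cons_of_mem _ hx)]
  | cons a l ih => simp only [List.cons_append, nval, ih]

lemma nval_bits (n : ℕ) : nval (n.bits.map fun b => ((0 : Kind), b)) = n := by
  induction n using Nat.binaryRec' with
  | zero => simp [nval]
  | bit b n h ih =>
    rw [Nat.bits_append_bit n b h, List.map_cons, nval, if_pos rfl, ih, Nat.bit_val]
    ring

lemma constLabs_ne_zero : ∀ x ∈ constLabs, x.1 ≠ 0 := by
  have : ∀ w, ∀ x ∈ pairLabs w, x.1 ≠ 0 := by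
    intro w x hx
    simp only [pairLabs, List.mem_flatten, List.mem_replicate] at hx
    obtain ⟨l, ⟨-, rfl⟩, hx⟩ := hx
    simp only [List.mem_cons, List.not_mem_nil, or_false] at hx
    rcases hx with rfl | rfl <;> decide
  intro x hx
  rw [constLabs, List.mem_append] at hx
  rcases hx with hx | hx
  · revert hx; revert x; decide
  · exact this _ x hx

lemma le_width (h n : ℕ) : 96 ≤ width h n := by
  have := (grow_spec (h * n.size) 96 (by norm_num)).2.1
  unfold width
  omega

lemma length_labels_ge (h n : ℕ) : n.size ≤ (labels h n).length := by
  rw [labels, List.length_append, List.length_map, Nat.size_eq_bits_len]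
  exact Nat.le_add_right _ _

lemma labels_spec (h n : ℕ) : Labels n n.size (n.size + 7) (width h n) (labels h n) := by
  have hpair : ∀ w, ∀ x ∈ pairLabs w, x.1 ≠ 0 := by
    intro w x hx
    simp only [pairLabs, List.mem_flatten, List.mem_replicate] at hx
    obtain ⟨l, ⟨-, rfl⟩, hx⟩ := hx
    simp only [List.mem_cons, List.not_mem_nil, or_false] at hx
    rcases hx with rfl | rfl <;> decide
  have hw := le_width h n
  have hflen : ∀ κ, flen κ (labels h n) = (if κ = 0 then n.size else 0) +
      ((if 1 = κ then n.size else 0) + ((flen κ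
        ([4, 5, 6, 7, 8, 9, 1, 1, 1, 1, 1, 1, 1].map (fun κ : Kind => (κ, false))) +
        (if κ = 2 ∨ κ = 3 then 96 else 0)) + (if κ = 2 ∨ κ = 3 then width h n - 96 else 0))) := by
    intro κ
    simp only [labels, constLabs, flen_append, flen_inputs, flen_replicate, flen_pairLabs,
      Nat.size_eq_bits_len]
  have hc : ∀ κ : Kind, flen κ
        ([4, 5, 6, 7, 8, 9, 1, 1, 1, 1, 1, 1, 1].map (fun κ : Kind => (κ, false))) =
      if κ = 1 then 7 else if 4 ≤ κ then 1 else 0 := by decide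
  simp only [hc] at hflen
  refine ⟨?_, ?_, ?_, ?_, ?_, ?_, ?_, ?_, Nat.lt_size_self n, length_labels_ge h n⟩
  · refine Paired.append (Paired.of_forall ?_) (Paired.append (Paired.of_forall ?_)
      (Paired.append (Paired.append (Paired.of_forall (by decide)) (paired_pairLabs _))
        (paired_pairLabs _)))
    · intro x hx
      obtain ⟨b, -, rfl⟩ := List.mem_map.1 hx
      exact ⟨show (0 : Kind) ≠ 2 by decide, show (0 : Kind) ≠ 3 by decide⟩
    · intro x hx
      rw [List.eq_of_mem_replicate hx]
      exact ⟨by decide, by decide⟩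
  · intro x hx
    have key : ∀ κ, fld κ (labels h n) x = if κ = 0 then x else 0 := by
      intro κ
      rw [labels, fld_append, fld_inputs κ _ x (by rwa [Nat.size_eq_bits_len]) , List.length_map,
        Nat.size_eq_bits_len, Nat.div_eq_of_lt hx, fld_zero_right, mul_zero, add_zero]
    exact ⟨by rw [key, if_pos rfl], fun κ hκ => by rw [key, if_neg hκ]⟩
  · rw [hflen]; simp
  · rw [hflen]; simp
  · rw [hflen]; simp; omega
  · rw [hflen]; simp; omega
  · intro κ hκ
    rw [hflen]
    revert hκ; revert κ
    simp only [Fin.forall_fin_succ]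
    simp
  · rw [labels, nval_append, nval_bits]
    intro x hx
    simp only [List.mem_append] at hx
    rcases hx with hx | hx | hx
    · rw [List.eq_of_mem_replicate hx]; decide
    · exact constLabs_ne_zero x hx
    · exact hpair _ x hx

/-! ### Estimates -/

lemma width_eq (h n : ℕ) : ∃ i, width h n = 3 * 2 ^ i := by
  obtain ⟨i, hi⟩ := (grow_spec (h * n.size) 96 (by norm_num)).1
  exact ⟨5 + i, by rw [width, hi, pow_add]; ring⟩

lemma width_ge (h n : ℕ) : h * n.size + 288 ≤ 3 * width h n :=
  (grow_spec (h * n.size) 96 (by norm_num)).2.1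

lemma width_le (h n : ℕ) : 3 * width h n ≤ 576 + 2 * (h * n.size) :=
  (grow_spec (h * n.size) 96 (by norm_num)).2.2

lemma pow_eight_le (w : ℕ) : w ^ 8 ≤ 2 ^ 24 * 2 ^ w := by
  have h1 : w ≤ 8 * 2 ^ (w / 8) := by
    have := Nat.lt_two_pow_self (n := w / 8)
    omega
  calc w ^ 8 ≤ (8 * 2 ^ (w / 8)) ^ 8 := Nat.pow_le_pow_left h1 8
    _ = 2 ^ 24 * 2 ^ (w / 8 * 8) := by rw [mul_pow, ← pow_mul]; norm_num
    _ ≤ 2 ^ 24 * 2 ^ w := by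
      apply Nat.mul_le_mul_left
      apply Nat.pow_le_pow_right (by norm_num)
      omega

/-- After squaring it is a comparison of exponents of 2: the power of n costs at most
2(c+1)·`n.size`, the power w^8 costs w + 24, and 3w ≥ 2(c+1)·`n.size` + 288 leaves room for the
constants 34 + 24 = 58. -/
lemma error_le (c n : ℕ) :
    2 ^ 17 * width (2 * (c + 1)) n ^ 4 * n ^ (c + 1) ≤ 4 ^ width (2 * (c + 1)) n := by
  have h1 := width_ge (2 * (c + 1)) n
  generalize width (2 * (c + 1)) n = w at *
  have h2 : n ^ (2 * (c + 1)) ≤ 2 ^ (2 * (c + 1) * n.size) := by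
    rw [mul_comm (2 * (c + 1)) n.size, pow_mul 2]
    exact Nat.pow_le_pow_left (Nat.lt_size_self n).le _
  refine (Nat.pow_le_pow_iff_left two_ne_zero).1 ?_
  calc (2 ^ 17 * w ^ 4 * n ^ (c + 1)) ^ 2 = 2 ^ 34 * w ^ 8 * n ^ (2 * (c + 1)) := by
        rw [mul_comm 2 (c + 1), pow_mul]; ring
    _ ≤ 2 ^ 34 * (2 ^ 24 * 2 ^ w) * 2 ^ (2 * (c + 1) * n.size) := by
        gcongr
        exact pow_eight_le w
    _ = 2 ^ (58 + w + 2 * (c + 1) * n.size) := by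
        rw [pow_add, pow_add, show 58 = 34 + 24 by norm_num, pow_add]; ring
    _ ≤ 2 ^ (4 * w) := Nat.pow_le_pow_right (by norm_num) (by omega)
    _ = (4 ^ w) ^ 2 := by
        rw [show 4 = 2 ^ 2 by norm_num, ← pow_mul, ← pow_mul]; congr 1; ring

/-- The error of the circuit. -/
noncomputable def err (w m : ℕ) : ℝ := 20 / 4 ^ w + 2 * ((1 / 4) ^ w + (64 * (w * m : ℕ)) ^ 2 / 4 ^ w)

lemma two_mul_err_le (c n : ℕ) (hn : 1 ≤ n) :
    2 * err (width (2 * (c + 1)) n) (n.size + 7) ≤ 1 / (n : ℝ) ^ (c + 1) := by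
  have h0 := le_width (2 * (c + 1)) n
  have h1 := width_ge (2 * (c + 1)) n
  have h2 := error_le c n
  have h3 : n.size + 7 ≤ 2 * width (2 * (c + 1)) n := by nlinarith
  generalize width (2 * (c + 1)) n = w at *
  have hn' : (0 : ℝ) < n := by exact_mod_cast hn
  have h2' : (2 : ℝ) ^ 17 * w ^ 4 * n ^ (c + 1) ≤ 4 ^ w := by exact_mod_cast h2
  have h3' : ((w * (n.size + 7) : ℕ) : ℝ) ≤ 2 * w ^ 2 := by
    have : w * (n.size + 7) ≤ 2 * w ^ 2 := by
      calc _ ≤ w * (2 * w) := Nat.mul_le_mul_left _ h3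
        _ = _ := by ring
    exact_mod_cast this
  have h0' : (96 : ℝ) ≤ w := by exact_mod_cast h0
  have h4 : (44 : ℝ) ≤ w ^ 4 := by
    calc (44 : ℝ) ≤ 96 ^ 4 := by norm_num
      _ ≤ w ^ 4 := by gcongr
  have e : 2 * err w (n.size + 7) = (44 + 4 * (64 * (w * (n.size + 7) : ℕ)) ^ 2) / 4 ^ w := by
    unfold err
    rw [one_div, inv_pow]
    field_simp
    ring
  rw [e, div_le_div_iff₀ (by positivity) (by positivity), one_mul]
  refine le_trans ?_ h2'
  gcongr
  -- With w·m ≤ 2w² the second term is 4·128²·w^4 = 2^16·w^4, and the constant 44 is below w^4.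
  calc (44 : ℝ) + 4 * (64 * (w * (n.size + 7) : ℕ)) ^ 2
      ≤ (w : ℝ) ^ 4 + 4 * (64 * (2 * (w : ℝ) ^ 2)) ^ 2 := by gcongr
    _ ≤ 2 ^ 17 * (w : ℝ) ^ 4 := by nlinarith [sq_nonneg ((w : ℝ) ^ 2)]

/-! ### Approximation of the Or gate -/

lemma clean_withAncillas {m a : ℕ} {Ψ : State (Fin m)} {b : Fin (m + a) → Bool}
    (h : withAncillas a Ψ b ≠ 0) :
    (∀ j : Fin a, b (Fin.natAdd m j) = false) ∧ Ψ (fun i => b (Fin.castAdd a i)) ≠ 0 := by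
  unfold withAncillas at h
  split_ifs at h with h1
  · exact ⟨h1, h⟩
  · exact absurd rfl h

lemma sum_withAncillas {m : ℕ} (a : ℕ) (Ψ : State (Fin m)) :
    ∑ b, ‖withAncillas a Ψ b‖ ^ 2 = ∑ b, ‖Ψ b‖ ^ 2 := by
  have e : ∀ b : Fin (m + a) → Bool, ‖withAncillas a Ψ b‖ ^ 2 =
      if ∀ j : Fin a, b (Fin.natAdd m j) = false then ‖Ψ (fun i => b (Fin.castAdd a i))‖ ^ 2
      else 0 := by
    intro b
    unfold withAncillas
    split_ifs <;> simp
  simp only [e]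
  rw [← Finset.sum_filter]
  apply Finset.sum_nbij' (fun b i => b (Fin.castAdd a i))
    (fun b => Fin.append b (fun _ => false))
  · intro b _
    exact Finset.mem_univ _
  · intro b _
    simp
  · intro b hb
    simp only [Finset.mem_filter, Finset.mem_univ, true_and] at hb
    funext i
    refine Fin.addCases (fun j => ?_) (fun j => ?_) i
    · simp
    · simp [hb]
  · intro b _
    simp
  · intro b _
    rfl

namespace Labels

variable {n L M W : ℕ} {labs : List Lab} (H : Labels n L M W labs)
variable {a : ℕ} (hN : n + 1 + a = 2 ^ labs.length)

/-- The circuit for the Or gate. -/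
def circuit : Circuit (Fin (n + 1 + a)) :=
  (H.layout hN).specs.map (LayerSpec.toLayer (List.finRange (n + 1 + a)))

lemma circuit_valid : (H.circuit hN).Valid := by
  intro l hl
  obtain ⟨s, hs, rfl⟩ := List.mem_map.1 hl
  exact LayerSpec.toLayer_valid (List.nodup_finRange _) ((H.layout hN).specs_wf s hs)

lemma circuit_depth : (H.circuit hN).depth = 51 := by
  simp [circuit, Circuit.depth, OrLayout.specs, Stage.specs, Stage.invSpecs, Parities.specs,
    Parities.parSpecs]

lemma circuit_size : (H.circuit hN).size ≤ 51 * (n + 1 + W * M + 2 ^ L * (2 ^ M * W) + W +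
    M * (W * 2 ^ W) + 2 ^ W + W * 2 ^ W) := by
  have h := circuit_size_le (List.nodup_finRange _) (H.layout hN).specs (H.layout hN).specs_wf
    (used _ labs) (H.mem_used hN)
  have h51 : (H.layout hN).specs.length = 51 := by
    have := H.circuit_depth hN
    simpa [circuit, Circuit.depth] using this
  rw [h51] at h
  exact h.trans (Nat.mul_le_mul_left _ (H.card_used_le hN))

lemma or_eq (b : Fin (n + 1 + a) → Bool) :
    (H.layout hN).or b = orFun n (fun i => b (Fin.castAdd a i.castSucc)) := by
  unfold OrLayout.or orFun weight
  rw [decide_eq_decide, Finset.card_pos]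
  constructor
  · rintro ⟨q, hq, hb⟩
    have hq' := (H.has_X_iff (hN ▸ q.2)).1 hq
    exact ⟨⟨q, hq'⟩, by simpa using hb⟩
  · rintro ⟨i, hi⟩
    simp only [Finset.mem_filter, Finset.mem_univ, true_and] at hi
    refine ⟨Fin.castAdd a i.castSucc, ?_, hi⟩
    refine (H.has_X_iff ?_).2 (by simp)
    rw [← hN]
    exact Fin.is_lt _

lemma o_eq : (H.layout hN).F.o = Fin.castAdd a (Fin.last n) := rfl

lemma cleanOn_withAncillas (Ψ : State (Fin (n + 1))) :
    CleanOn (H.layout hN).anc (withAncillas a Ψ) := by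
  intro b hb q hq
  have hX : ¬ (q : ℕ) < n := by
    intro h
    have h1 : (H.layout hN).A.I q = true := (H.has_X_iff (hN ▸ q.2)).2 h
    rw [hq.2] at h1
    simp at h1
  have hO : (q : ℕ) ≠ n := fun h => hq.1 (Fin.ext h)
  have hlt : (q : ℕ) - (n + 1) < a := by have := q.2; omega
  have e : q = Fin.natAdd (n + 1) ⟨(q : ℕ) - (n + 1), hlt⟩ := by
    apply Fin.ext
    simp only [Fin.natAdd_mk]
    omega
  rw [e]
  exact (clean_withAncillas hb).1 _

lemma target_eq (Ψ : State (Fin (n + 1))) :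
    withAncillas a (gateOf (orFun n) Ψ) = fun b => withAncillas a Ψ
      (Function.update b (H.layout hN).F.o (xor (b (H.layout hN).F.o) ((H.layout hN).or b))) := by
  funext b
  rw [o_eq, or_eq]
  have h1 : ∀ (x : Bool) (j : Fin a), Function.update b (Fin.castAdd a (Fin.last n)) x
      (Fin.natAdd (n + 1) j) = b (Fin.natAdd (n + 1) j) := by
    intro x j
    apply Function.update_of_ne
    intro h
    have := congrArg Fin.val h
    simp at this
    omega
  unfold withAncillas gateOf
  simp only [h1]
  split_ifs
  · congr 1
    funext i
    by_cases hi : i = Fin.last n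
    · subst hi; simp
    · rw [Function.update_of_ne hi, Function.update_of_ne]
      intro h
      exact hi (Fin.castAdd_injective _ _ h)
  · rfl

lemma approx (hM : M = L + 7) {i : ℕ} (hW : W = 3 * 2 ^ i) {ε : ℝ} (hε : 2 * err W M ≤ ε) :
    ApproxOneSided angle (H.circuit hN) (orFun n) ε := by
  have hnd := List.nodup_finRange (n + 1 + a)
  have hmem : ∀ q, q ∈ List.finRange (n + 1 + a) := List.mem_finRange
  constructor
  · intro b hb
    rw [circuit, run_specs]
    apply OrLayout.foldl_specs_of_zero _ _ hnd hmem (H.cleanOn_withAncillas hN _)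
    intro b' hb'
    have h1 := (clean_withAncillas hb').2
    have h2 : (fun i => b' (Fin.castAdd a i)) = b := by
      by_contra hne
      exact h1 (Pi.single_eq_of_ne hne _)
    rw [or_eq, ← hb, ← h2]
  · intro Ψ hΨ
    have h := OrLayout.overlap_ge (H.layout hN) angle hnd hmem (H.cleanOn_withAncillas hN Ψ)
      (by rw [sum_withAncillas, hΨ]) (εA := (1 / 4) ^ W) (εB := (64 * (W * M : ℕ)) ^ 2 / 4 ^ W)
      (η := 20 / 4 ^ W) (by positivity) (by positivity) (by positivity)
      (fun b hb => H.prod_stageA_le hN hM hb) (fun b hb => H.prod_stageB_le hN hb)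
      (fun b hb => H.cos_cnt_le hN hW hb)
    rw [circuit, run_specs, H.target_eq hN, fidelity]
    change _ ≤ ‖inn (Q := Fin (n + 1 + a)) _ _‖ ^ 2
    have e : 1 - 20 / 4 ^ W - 2 * ((1 / 4) ^ W + (64 * (W * M : ℕ)) ^ 2 / 4 ^ W) = 1 - err W M := by
      unfold err; ring
    rw [e] at h
    have h0 : 0 ≤ err W M := by unfold err; positivity
    generalize ‖inn (Q := Fin (n + 1 + a)) _ _‖ = x at *
    -- The fidelity is the square of the overlap x, and x² ≥ 2x - 1 ≥ 1 - 2·`err`.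
    nlinarith [sq_nonneg (1 - x)]

end Labels

/-! ### Size estimates -/

lemma qubits_eq (h n : ℕ) :
    n + 1 + (2 ^ (labels h n).length - (n + 1)) = 2 ^ (labels h n).length := by
  have h1 := Nat.lt_size_self n
  have h2 := Nat.pow_le_pow_right (n := 2) (by norm_num) (length_labels_ge h n)
  omega

lemma two_pow_size_le {n : ℕ} (hn : 1 ≤ n) : 2 ^ n.size ≤ 2 * n := by
  obtain ⟨m, hm⟩ : ∃ m, n.size = m + 1 := ⟨n.size - 1, by
    have := Nat.size_pos.2 hn
    omega⟩
  have : 2 ^ m ≤ n := Nat.lt_size.1 (by omega)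
  rw [hm, pow_succ]
  omega

lemma total_le (n L M W : ℕ) (hn : n < 2 ^ L) :
    n + 1 + W * M + 2 ^ L * (2 ^ M * W) + W + M * (W * 2 ^ W) + 2 ^ W + W * 2 ^ W ≤
      7 * (2 ^ L * 2 ^ M * (2 ^ W * 2 ^ W)) := by
  have a := Nat.one_le_two_pow (n := L)
  have b := Nat.one_le_two_pow (n := M)
  have c := Nat.one_le_two_pow (n := W)
  have b' := (Nat.lt_two_pow_self (n := M)).le
  have c' := (Nat.lt_two_pow_self (n := W)).le
  generalize 2 ^ L = x at *
  generalize 2 ^ M = y at *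
  generalize 2 ^ W = z at *
  have h1 : n + 1 ≤ x * y * (z * z) := by
    calc n + 1 ≤ x * 1 * (1 * 1) := by omega
      _ ≤ x * y * (z * z) := by gcongr
  have h2 : W * M ≤ x * y * (z * z) := by
    calc W * M = 1 * M * (W * 1) := by ring
      _ ≤ x * y * (z * z) := by gcongr
  have h3 : x * (y * W) ≤ x * y * (z * z) := by
    calc x * (y * W) = x * y * (W * 1) := by ring
      _ ≤ x * y * (z * z) := by gcongr
  have h4 : W ≤ x * y * (z * z) := by
    calc W = 1 * 1 * (W * 1) := by ring
      _ ≤ x * y * (z * z) := by gcongr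
  have h5 : M * (W * z) ≤ x * y * (z * z) := by
    calc M * (W * z) = 1 * M * (W * z) := by ring
      _ ≤ x * y * (z * z) := by gcongr
  have h6 : z ≤ x * y * (z * z) := by
    calc z = 1 * 1 * (1 * z) := by ring
      _ ≤ x * y * (z * z) := by gcongr
  have h7 : W * z ≤ x * y * (z * z) := by
    calc W * z = 1 * 1 * (W * z) := by ring
      _ ≤ x * y * (z * z) := by gcongr
  omega

/-- The size is polynomial. -/
lemma exists_poly_bound (h : ℕ) : ∃ C p : ℕ, ∀ n, 1 ≤ n →
    n + 1 + width h n * (n.size + 7) + 2 ^ n.size * (2 ^ (n.size + 7) * width h n) + width h n +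
      (n.size + 7) * (width h n * 2 ^ width h n) + 2 ^ width h n + width h n * 2 ^ width h n ≤
      C * n ^ p := by
  refine ⟨7 * (2 ^ 7 * (2 ^ 192 * 2 ^ 192) * 2 ^ (2 + 2 * h)), 2 + 2 * h, fun n hn => ?_⟩
  refine (total_le n n.size (n.size + 7) (width h n) (Nat.lt_size_self n)).trans ?_
  have hw : width h n ≤ 192 + h * n.size := by have := width_le h n; omega
  have h1 : 2 ^ width h n ≤ 2 ^ 192 * (2 ^ n.size) ^ h := by
    calc 2 ^ width h n ≤ 2 ^ (192 + h * n.size) := Nat.pow_le_pow_right (by norm_num) hw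
      _ = _ := by rw [pow_add, mul_comm h, pow_mul]
  have h2 := two_pow_size_le hn
  generalize (2 : ℕ) ^ 192 = K at *
  rw [pow_add 2 n.size]
  generalize 2 ^ n.size = x at *
  calc 7 * (x * (x * 2 ^ 7) * (2 ^ width h n * 2 ^ width h n))
      ≤ 7 * (x * (x * 2 ^ 7) * ((K * x ^ h) * (K * x ^ h))) := by gcongr
    _ = 7 * (2 ^ 7 * (K * K)) * x ^ (2 + 2 * h) := by
      rw [pow_add, two_mul h, pow_add]; ring
    _ ≤ 7 * (2 ^ 7 * (K * K)) * (2 * n) ^ (2 + 2 * h) := by gcongr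
    _ = _ := by rw [mul_pow]; ring

lemma cube_le (L : ℕ) : (L + 7) ^ 3 ≤ 343 * 4 ^ L := by
  induction L with
  | zero => norm_num
  | succ L ih =>
    have : (L + 1 + 7) ^ 3 ≤ 4 * (L + 7) ^ 3 := by
      nlinarith [sq_nonneg L, mul_nonneg (sq_nonneg L) L.zero_le]
    rw [pow_succ 4]
    omega

/-- The size for a quadratic error. -/
lemma exists_quadratic_bound : ∃ C : ℕ, ∀ n, 2 ≤ n →
    n + 1 + width 2 n * (n.size + 7) + 2 ^ n.size * (2 ^ (n.size + 7) * width 2 n) + width 2 n +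
      (n.size + 7) * (width 2 n * 2 ^ width 2 n) + 2 ^ width 2 n + width 2 n * 2 ^ width 2 n ≤
      C * n ^ 2 * Nat.log 2 n := by
  obtain ⟨K, hK⟩ : ∃ K, K = (2 : ℕ) ^ 192 := ⟨_, rfl⟩
  refine ⟨(7 * (200 * K)) * 4 * 200, fun n hn => ?_⟩
  have hL1 := Nat.lt_size_self n
  have hL2 := two_pow_size_le (show 1 ≤ n by omega)
  have hlog1 : 1 ≤ Nat.log 2 n := Nat.log_pos (by norm_num) hn
  have hLlog : n.size ≤ Nat.log 2 n + 1 := by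
    rw [Nat.size_le]
    exact Nat.lt_pow_succ_log_self (by norm_num) n
  have hw := width_le 2 n
  have hw96 := le_width 2 n
  generalize width 2 n = w at *
  generalize n.size = L at *
  have hwlog : w ≤ 200 * Nat.log 2 n := by omega
  -- For error 1/n the width is about (4/3)·log n, so 2^W stays below n² with room for the factor L
  -- + 7. Cubing avoids fractional exponents.
  have key : (L + 7) * 2 ^ w ≤ 7 * K * (2 ^ L * 2 ^ L) := by
    refine (Nat.pow_le_pow_iff_left (n := 3) (by norm_num)).1 ?_
    calc ((L + 7) * 2 ^ w) ^ 3 = (L + 7) ^ 3 * 2 ^ (3 * w) := by rw [mul_pow, ← pow_mul, mul_comm w]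
      _ ≤ (343 * 4 ^ L) * 2 ^ (576 + 2 * (2 * L)) :=
        Nat.mul_le_mul (cube_le L) (Nat.pow_le_pow_right (by norm_num) hw)
      _ = (7 * K * (2 ^ L * 2 ^ L)) ^ 3 := by
        rw [hK, pow_add, show 576 = 192 * 3 by norm_num, pow_mul 2 192 3,
          show 4 = 2 ^ 2 by norm_num, ← pow_mul]
        generalize (2 : ℕ) ^ 192 = k
        ring
  have hK1 : 1 ≤ K := hK ▸ Nat.one_le_two_pow
  have hx : 1 ≤ 2 ^ L := Nat.one_le_two_pow
  have hLx : L ≤ 2 ^ L := (Nat.lt_two_pow_self).le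
  have hz : 2 ^ w ≤ (L + 7) * 2 ^ w := Nat.le_mul_of_pos_left _ (by omega)
  rw [pow_add 2 L 7]
  generalize 2 ^ w = z at *
  generalize 2 ^ L = x at *
  have hxx : x ≤ x * x := Nat.le_mul_of_pos_left _ hx
  have hKX : x * x ≤ K * (x * x) := Nat.le_mul_of_pos_left _ hK1
  rw [mul_assoc 7 K] at key
  generalize hY : K * (x * x) = Y at *
  have e : n + 1 + w * (L + 7) + x * (x * 2 ^ 7 * w) + w + (L + 7) * (w * z) + z + w * z ≤
      w * (7 * (200 * Y)) := by
    have h1 : w * (L + 7) ≤ w * (8 * Y) := Nat.mul_le_mul_left _ (by omega)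
    have h2 : x * (x * 2 ^ 7 * w) ≤ w * (128 * Y) := by
      calc x * (x * 2 ^ 7 * w) = w * (128 * (x * x)) := by ring
        _ ≤ _ := by gcongr
    have h3 : (L + 7) * (w * z) ≤ w * (7 * Y) := by
      calc (L + 7) * (w * z) = w * ((L + 7) * z) := by ring
        _ ≤ _ := Nat.mul_le_mul_left _ key
    have h4 : w * z ≤ w * (7 * Y) := Nat.mul_le_mul_left _ (hz.trans key)
    have h5 : z ≤ w * (7 * Y) := (Nat.le_mul_of_pos_left _ (by omega)).trans h4
    have h6 : n + 1 ≤ w * Y := by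
      calc n + 1 ≤ Y := by omega
        _ ≤ w * Y := Nat.le_mul_of_pos_left _ (by omega)
    have h7 : w ≤ w * Y := Nat.le_mul_of_pos_right _ (by omega)
    have e1 : w * (8 * Y) = 8 * (w * Y) := by ring
    have e2 : w * (128 * Y) = 128 * (w * Y) := by ring
    have e3 : w * (7 * Y) = 7 * (w * Y) := by ring
    have e4 : w * (7 * (200 * Y)) = 1400 * (w * Y) := by ring
    omega
  refine e.trans ?_
  rw [← hY]
  calc w * (7 * (200 * (K * (x * x))))
      ≤ (200 * Nat.log 2 n) * (7 * (200 * (K * ((2 * n) * (2 * n))))) := by gcongr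
    _ = _ := by ring

/-! ### The description of the circuit -/

/-- A layer that is given by conditions on addresses. -/
inductive AddrSpec : Type
  | had (P : Track → Bool)
  | rot (P : Track → Bool)
  | rotInv (P : Track → Bool)
  | fan (P : Track → Bool) (R : Monitor → Bool)

namespace AddrSpec

def toSpec (labs : List Lab) (N : ℕ) : AddrSpec → LayerSpec (Fin N)
  | had P => .had fun v => P (Track.init.run labs v)
  | rot P => .rot fun v => P (Track.init.run labs v)
  | rotInv P => .rotInv fun v => P (Track.init.run labs v)
  | fan P R => .fan (fun v => P (Track.init.run labs v)) fun v w => relAt labs R v w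

def tok : AddrSpec → Token
  | had _ => .had
  | rot _ => .rot
  | rotInv _ => .rotInv
  | fan _ _ => .fanout

def src : AddrSpec → Track → Bool
  | had P => P
  | rot P => P
  | rotInv P => P
  | fan P _ => P

def tgt : AddrSpec → Monitor → Bool
  | fan _ R => R
  | _ => fun _ => false

/-- What is written for the pair `(v, w)` of addresses. -/
def describePair (s : AddrSpec) (labs : List Lab) (v w : ℕ) : List Token :=
  (if w = 0 ∧ s.src (Track.init.run labs v) = true then s.tok :: describeNum v else []) ++
    (if (s.src (Track.init.run labs v) && relAt labs s.tgt v w) = true then describeNum w else [])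

lemma flatMap_filter_map {α β γ : Type} (l : List α) (P : α → Bool) (f : α → β) (g : β → List γ) :
    ((l.filter P).map f).flatMap g = l.flatMap fun a => if P a = true then g (f a) else [] := by
  induction l with
  | nil => rfl
  | cons a l ih =>
    rw [List.flatMap_cons, List.filter_cons]
    split_ifs
    · rw [List.map_cons, List.flatMap_cons, ih]
    · rw [ih, List.nil_append]

lemma flatMap_range {γ : Type} (N : ℕ) (f : ℕ → List γ) :
    (List.range N).flatMap f = (List.finRange N).flatMap fun i : Fin N => f i.val := by
  rw [← List.map_coe_finRange_eq_range, List.flatMap_map]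

/-- The head of the gate at v is written at w = 0 and its targets as w runs through all addresses,
so the loop over w writes exactly one gate. -/
lemma flatMap_describePair (s : AddrSpec) (labs : List Lab) {N : ℕ} (hN : 0 < N) (v : ℕ) :
    (List.range N).flatMap (s.describePair labs v) =
      if s.src (Track.init.run labs v) = true then s.tok :: (describeNum v ++
        (List.range N).flatMap fun w => if relAt labs s.tgt v w = true then describeNum w else [])
      else [] := by
  obtain ⟨M, rfl⟩ : ∃ M, N = M + 1 := ⟨N - 1, by omega⟩
  rw [List.range_succ_eq_map, List.flatMap_cons, List.flatMap_cons, List.flatMap_map,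
    List.flatMap_map]
  unfold describePair
  cases h : s.src (Track.init.run labs v)
  · simp
  · simp

lemma describeGate_fanout {N : ℕ} (c : Fin N) (ts : List (Fin N)) :
    describeGate (.fanout c ts) =
      Token.fanout :: (describeNum c ++ ts.flatMap fun t : Fin N => describeNum t.val) := by
  simp [describeGate, List.flatMap_assoc]

/-- A layer is written by a double loop whose body looks only at the current pair of addresses; such
a loop needs just two binary counters as memory. -/
lemma describeLayer_toSpec (s : AddrSpec) (labs : List Lab) {N : ℕ} (hN : 0 < N) :
    describeLayer ((s.toSpec labs N).toLayer (List.finRange N)) =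
      ((List.range N).flatMap fun v => (List.range N).flatMap (s.describePair labs v)) ++
        [Token.endLayer] := by
  have h0 : (List.range N).flatMap (fun _ => ([] : List Token)) = [] :=
    List.flatMap_eq_nil_iff.2 fun _ _ => rfl
  simp only [flatMap_describePair s labs hN]
  unfold describeLayer
  congr 1
  rw [flatMap_range]
  cases s with
  | had P =>
    simp only [toSpec, LayerSpec.toLayer, flatMap_filter_map]
    simp [describeGate, src, tok, tgt, relAt, h0]
  | rot P =>
    simp only [toSpec, LayerSpec.toLayer, flatMap_filter_map]
    simp [describeGate, src, tok, tgt, relAt, h0]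
  | rotInv P =>
    simp only [toSpec, LayerSpec.toLayer, flatMap_filter_map]
    simp [describeGate, src, tok, tgt, relAt, h0]
  | fan P R =>
    simp only [toSpec, LayerSpec.toLayer, flatMap_filter_map, describeGate_fanout, src, tok, tgt]
    refine congrArg (fun f => List.flatMap f (List.finRange N)) (funext fun v => ?_)
    rw [flatMap_range]
    have := flatMap_filter_map (List.finRange N) (fun w : Fin N => relAt labs R v w) id
        (fun w => describeNum w.val)
    rw [List.map_id] at this
    rw [this]
    rfl

end AddrSpec

open Role in
/-- The layers of the circuit. -/
def layerTable : List AddrSpec :=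
  let stA : List AddrSpec := [.had Z.ok, .fan Z.ok (relOf Z C linkZC), .rot C.ok,
    .fan X.ok (relOf X C linkXC), .rotInv C.ok, .fan X.ok (relOf X C linkXC),
    .fan Z.ok (relOf Z C linkZC), .had Z.ok]
  let stA' : List AddrSpec := [.had Z.ok, .fan Z.ok (relOf Z C linkZC),
    .fan X.ok (relOf X C linkXC), .rot C.ok, .fan X.ok (relOf X C linkXC), .rotInv C.ok,
    .fan Z.ok (relOf Z C linkZC), .had Z.ok]
  let stB : List AddrSpec := [.had Y.ok, .fan Y.ok (relOf Y F linkYF), .rot F.ok,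
    .fan Z.ok (relOf Z F linkZF), .rotInv F.ok, .fan Z.ok (relOf Z F linkZF),
    .fan Y.ok (relOf Y F linkYF), .had Y.ok]
  let stB' : List AddrSpec := [.had Y.ok, .fan Y.ok (relOf Y F linkYF),
    .fan Z.ok (relOf Z F linkZF), .rot F.ok, .fan Z.ok (relOf Z F linkZF), .rotInv F.ok,
    .fan Y.ok (relOf Y F linkYF), .had Y.ok]
  let par : List AddrSpec := [.had D.ok, .had E.ok, .fan D.ok (relOf D E linkDE), .had E.ok,
    .had D.ok]
  let od : AddrSpec := .fan O.ok fun m => D.ok m.b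
  [.had O.ok] ++ stA ++ stB ++ ([od, .rot D.ok, .fan Y.ok (relOf Y E linkYE)] ++ par ++
    [.rotInv D.ok, od, .rot D.ok] ++ par ++ [.fan Y.ok (relOf Y E linkYE)]) ++ stB' ++ stA' ++
    [.had O.ok]

namespace Labels

open Role

variable {n L M W : ℕ} {labs : List Lab} (H : Labels n L M W labs)

lemma specs_eq {N : ℕ} (hN : N = 2 ^ labs.length) :
    (H.layout hN).specs = layerTable.map (AddrSpec.toSpec labs N) := by
  have hO : (H.parities hN).isO = fun v : Fin N => O.has labs v := by
    funext v
    rw [Bool.eq_iff_iff, H.has_O_iff (hN ▸ v.2)]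
    simp only [Parities.isO, decide_eq_true_eq]
    exact Fin.ext_iff
  have hOD : (fun (_ : Fin N) (w : Fin N) => D.has labs w) =
      fun v w : Fin N => relAt labs (fun m => D.ok m.b) v w := by
    funext v w
    exact congrArg D.ok (Monitor.run_b Monitor.init labs v w).symm
  unfold OrLayout.specs Parities.specs
  change [LayerSpec.had (H.parities hN).isO] ++ (H.stageA hN).specs ++ (H.stageB hN).specs ++
    ([LayerSpec.fan (H.parities hN).isO fun (_ : Fin N) (w : Fin N) => D.has labs w, _, _] ++ _ ++
      [_, LayerSpec.fan (H.parities hN).isO fun (_ : Fin N) (w : Fin N) => D.has labs w, _] ++ _ ++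
      _) ++ _ ++ _ ++ [LayerSpec.had (H.parities hN).isO] = _
  rw [hO, hOD]
  rfl

lemma describe_circuit {a : ℕ} (hN : n + 1 + a = 2 ^ labs.length) :
    describe (H.circuit hN) = describeNum (2 ^ labs.length) ++ layerTable.flatMap fun s =>
      ((List.range (2 ^ labs.length)).flatMap fun v =>
        (List.range (2 ^ labs.length)).flatMap (s.describePair labs v)) ++ [Token.endLayer] := by
  unfold describe circuit
  rw [specs_eq, List.map_map, List.flatMap_map, ← hN]
  congr 2
  funext s
  exact s.describeLayer_toSpec labs (by omega)

end Labels

/-! ### Machines whose head sweeps over the work tape -/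

/-- A machine whose head moves back and forth between the left end of its work tape and the first
blank cell. It can only change its direction there. At the right end, it may append a cell and read
the input. -/
structure Sweeper (S C : Type) : Type where
  init : S
  halts : S → Bool
  toRight : S → Bool
  cell : S → C → S × C × Option Token
  left : S → S × Option Token
  right : S → InSym → S × Option C × Move × Option Token

namespace Sweeper

variable {S C : Type} (P : Sweeper S C)

/-- The Turing machine; `none` is the blank, and `some none` marks the left end of the tape. -/
def transition : Option S → InSym → (Fin 1 → Option (Option C)) →
    Option (Action (Option S) (Option (Option C)) 1)
  | none, _, _ => some ⟨some P.init, .right, fun _ => some none, fun _ => .right, none⟩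
  | some s, i, g => if P.halts s then none else
    match g 0 with
    | some none => some ⟨some (P.left s).1, .stay, fun _ => some none, fun _ => .right, (P.left s).2⟩
    | some (some c) => some ⟨some (P.cell s c).1, .stay, fun _ => some (some (P.cell s c).2.1),
        fun _ => if P.toRight s then .right else .left, (P.cell s c).2.2⟩
    | none => some ⟨some (P.right s i).1, (P.right s i).2.2.1, fun _ => (P.right s i).2.1.map some,
        fun _ => if (P.right s i).2.1.isSome then .right else .left, (P.right s i).2.2.2⟩

def machine [Finite S] [Finite C] : Machine where
  S := Option S
  Γ := Option (Option C)
  finS := inferInstance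
  finΓ := inferInstance
  k := 1
  start := none
  blank := none
  transition := P.transition

/-- The content of the work tape. -/
def tape (l : List C) : ℕ → Option (Option C)
  | 0 => some none
  | i + 1 => l[i]?.map some

lemma tape_update (l r : List C) (c d : C) :
    Function.update (tape (l ++ c :: r)) (l.length + 1) (some (some d)) = tape (l ++ d :: r) := by
  funext i
  cases i with
  | zero => rw [Function.update_of_ne (by omega)]; rfl
  | succ i =>
    by_cases h : i = l.length
    · subst h
      simp [tape]
    · rw [Function.update_of_ne (by omega)]
      change (l ++ c :: r)[i]?.map some = (l ++ d :: r)[i]?.map some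
      congr 1
      rcases lt_or_gt_of_ne h with h' | h'
      · rw [List.getElem?_append_left h', List.getElem?_append_left h']
      · rw [List.getElem?_append_right h'.le, List.getElem?_append_right h'.le]
        obtain ⟨k, hk⟩ : ∃ k, i - l.length = k + 1 := ⟨i - l.length - 1, by omega⟩
        rw [hk, List.getElem?_cons_succ, List.getElem?_cons_succ]

lemma tape_append (l : List C) (d : C) :
    Function.update (tape l) (l.length + 1) (some (some d)) = tape (l ++ [d]) := by
  funext i
  cases i with
  | zero => rw [Function.update_of_ne (by omega)]; rfl
  | succ i =>
    by_cases h : i = l.length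
    · subst h
      simp [tape]
    · rw [Function.update_of_ne (by omega)]
      change l[i]?.map some = (l ++ [d])[i]?.map some
      congr 1
      rcases lt_or_gt_of_ne h with h' | h'
      · rw [List.getElem?_append_left h']
      · rw [List.getElem?_eq_none h'.le, List.getElem?_eq_none (by simp; omega)]

lemma tape_update_self (l : List C) (i : ℕ) : Function.update (tape l) i (tape l i) = tape l :=
  Function.update_eq_self i (tape l)

lemma tape_cell (l r : List C) (c : C) : tape (l ++ c :: r) (l.length + 1) = some (some c) := by
  simp [tape]

lemma tape_end (l : List C) : tape l (l.length + 1) = none := by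
  simp [tape]

variable [Finite S] [Finite C]

/-- A configuration after the first step. -/
def conf (s : S) (ip : ℕ) (l : List C) (pos : ℕ) (out : List Token) : P.machine.Config where
  state := some s
  inPos := ip
  work := fun _ => tape l
  pos := fun _ => pos
  out := out

/-- The machine gets from one configuration to another one, and its head stays below `B`. -/
def Steps (n B : ℕ) : P.machine.Config → P.machine.Config → Prop :=
  Relation.ReflTransGen fun c d => P.machine.step n c = some d ∧ ∀ i, c.pos i ≤ B

variable {P} {n B : ℕ}

lemma Steps.refl (c : P.machine.Config) : P.Steps n B c c := Relation.ReflTransGen.refl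

lemma Steps.trans {c d e : P.machine.Config} (h : P.Steps n B c d) (h' : P.Steps n B d e) :
    P.Steps n B c e := Relation.ReflTransGen.trans h h'

lemma step_cell_right {s : S} (hh : P.halts s = false) (hr : P.toRight s = true) (ip : ℕ)
    (hip : ip ≤ n + 1) (l r : List C) (c : C) (out : List Token) (hB : l.length + 1 ≤ B) :
    P.Steps n B (P.conf s ip (l ++ c :: r) (l.length + 1) out)
      (P.conf (P.cell s c).1 ip ((l ++ [(P.cell s c).2.1]) ++ r) (l.length + 2)
        (out ++ (P.cell s c).2.2.toList)) := by
  refine Relation.ReflTransGen.single ⟨?_, fun _ => hB⟩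
  have ht := tape_cell l r c
  have hm : min ip (n + 1) = ip := min_eq_left hip
  simp [Machine.step, machine, conf, transition, hh, ht, hr, Move.apply, hm, tape_update]

lemma step_cell_left {s : S} (hh : P.halts s = false) (hr : P.toRight s = false) (ip : ℕ)
    (hip : ip ≤ n + 1) (l r : List C) (c : C) (out : List Token) (hB : l.length + 1 ≤ B) :
    P.Steps n B (P.conf s ip (l ++ c :: r) (l.length + 1) out)
      (P.conf (P.cell s c).1 ip (l ++ ((P.cell s c).2.1 :: r)) l.length
        (out ++ (P.cell s c).2.2.toList)) := by
  refine Relation.ReflTransGen.single ⟨?_, fun _ => hB⟩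
  have ht := tape_cell l r c
  have hm : min ip (n + 1) = ip := min_eq_left hip
  simp [Machine.step, machine, conf, transition, hh, ht, hr, Move.apply, hm, tape_update]

lemma step_left {s s' : S} {o : Option Token} (h : P.left s = (s', o)) (hh : P.halts s = false)
    {ip : ℕ} (hip : ip ≤ n + 1) (l : List C) (out : List Token) :
    P.Steps n B (P.conf s ip l 0 out) (P.conf s' ip l 1 (out ++ o.toList)) := by
  refine Relation.ReflTransGen.single ⟨?_, fun _ => B.zero_le⟩
  have ht : tape l 0 = some none := rfl
  have hm : min ip (n + 1) = ip := min_eq_left hip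
  have hu := tape_update_self l 0
  rw [ht] at hu
  simp [Machine.step, machine, conf, transition, hh, ht, Move.apply, hm, hu, h]

lemma step_right {s s' : S} {o : Option Token} {mv : Move} {ip ip' : ℕ}
    (h : P.right s (inputSym n ip) = (s', none, mv, o))
    (hip : min (mv.apply ip) (n + 1) = ip') (hh : P.halts s = false) (l : List C)
    (out : List Token) (hB : l.length + 1 ≤ B) :
    P.Steps n B (P.conf s ip l (l.length + 1) out)
      (P.conf s' ip' l l.length (out ++ o.toList)) := by
  refine Relation.ReflTransGen.single ⟨?_, fun _ => hB⟩
  have ht := tape_end l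
  have hu := tape_update_self l (l.length + 1)
  rw [ht] at hu
  have hm : Move.left.apply (l.length + 1) = l.length := rfl
  simp [Machine.step, machine, conf, transition, hh, ht, hm, hip, hu, h]

lemma step_append {s s' : S} {o : Option Token} {mv : Move} {ip ip' : ℕ} {c : C}
    (h : P.right s (inputSym n ip) = (s', some c, mv, o))
    (hip : min (mv.apply ip) (n + 1) = ip') (hh : P.halts s = false) (l : List C)
    (out : List Token) (hB : l.length + 1 ≤ B) :
    P.Steps n B (P.conf s ip l (l.length + 1) out)
      (P.conf s' ip' (l ++ [c]) ((l ++ [c]).length + 1) (out ++ o.toList)) := by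
  refine Relation.ReflTransGen.single ⟨?_, fun _ => hB⟩
  have ht := tape_end l
  have hm : Move.right.apply (l.length + 1) = l.length + 2 := rfl
  simp [Machine.step, machine, conf, transition, hh, ht, hm, hip, h, tape_append]

/-- A sweep to the right. -/
def runR {A : Type} (f : A → C → A × C × Option Token) : A → List C → A × List C × List Token
  | a, [] => (a, [], [])
  | a, c :: cs => ((runR f (f a c).1 cs).1, (f a c).2.1 :: (runR f (f a c).1 cs).2.1,
      (f a c).2.2.toList ++ (runR f (f a c).1 cs).2.2)

/-- A sweep to the left. -/
def runL {A : Type} (f : A → C → A × C) : A → List C → A × List C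
  | a, [] => (a, [])
  | a, c :: cs => ((f (runL f a cs).1 c).1, (f (runL f a cs).1 c).2 :: (runL f a cs).2)

omit [Finite C] in
lemma length_runR {A : Type} (f : A → C → A × C × Option Token) (a : A) (l : List C) :
    (runR f a l).2.1.length = l.length := by
  induction l generalizing a with
  | nil => rfl
  | cons c cs ih => simp [runR, ih]

lemma sweep_right {A : Type} (st : A → S) (f : A → C → A × C × Option Token)
    (hh : ∀ a, P.halts (st a) = false) (hr : ∀ a, P.toRight (st a) = true)
    (hf : ∀ a c, P.cell (st a) c = (st (f a c).1, (f a c).2.1, (f a c).2.2))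
    {ip : ℕ} (hip : ip ≤ n + 1) (a : A) (l : List C) (out : List Token) (hB : l.length ≤ B) :
    P.Steps n B (P.conf (st a) ip l 1 out)
      (P.conf (st (runR f a l).1) ip (runR f a l).2.1 ((runR f a l).2.1.length + 1)
        (out ++ (runR f a l).2.2)) := by
  -- Generalised to a prefix l that has been processed already.
  have key : ∀ (r : List C) (a : A) (l : List C) (out : List Token), l.length + r.length ≤ B →
      P.Steps n B (P.conf (st a) ip (l ++ r) (l.length + 1) out)
        (P.conf (st (runR f a r).1) ip (l ++ (runR f a r).2.1)
          (l.length + (runR f a r).2.1.length + 1) (out ++ (runR f a r).2.2)) := by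
    intro r
    induction r with
    | nil => intro a l out _; simpa [runR] using Steps.refl _
    | cons c r ih =>
      intro a l out h
      rw [List.length_cons] at h
      have h1 := step_cell_right (n := n) (B := B) (hh a) (hr a) ip hip l r c out (by omega)
      rw [hf] at h1
      have h2 := ih (f a c).1 (l ++ [(f a c).2.1]) (out ++ (f a c).2.2.toList)
        (by simp; omega)
      refine h1.trans ?_
      simp only [List.length_append, List.length_singleton, List.append_assoc,
        List.singleton_append] at h2 ⊢
      simp only [runR, List.length_cons]
      convert h2 using 2
      omega
  simpa using key l a [] out (by simpa using hB)

lemma sweep_left {A : Type} (st : A → S) (f : A → C → A × C)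
    (hh : ∀ a, P.halts (st a) = false) (hr : ∀ a, P.toRight (st a) = false)
    (hf : ∀ a c, P.cell (st a) c = (st (f a c).1, (f a c).2, none))
    {ip : ℕ} (hip : ip ≤ n + 1) (a : A) (l : List C) (out : List Token) (hB : l.length ≤ B) :
    P.Steps n B (P.conf (st a) ip l l.length out)
      (P.conf (st (runL f a l).1) ip (runL f a l).2 0 out) := by
  have key : ∀ (r l : List C) (a : A), l.length + r.length ≤ B →
      P.Steps n B (P.conf (st a) ip (l ++ r) (l.length + r.length) out)
        (P.conf (st (runL f a r).1) ip (l ++ (runL f a r).2) l.length out) := by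
    intro r
    induction r with
    | nil => intro l a _; simpa [runL] using Steps.refl _
    | cons c r ih =>
      intro l a h
      rw [List.length_cons] at h
      have h1 := ih (l ++ [c]) a (by simp; omega)
      have h2 := step_cell_left (n := n) (B := B) (hh (runL f a r).1) (hr _) ip hip l
        (runL f a r).2 c out (by omega)
      rw [hf] at h2
      simp only [List.length_append, List.length_singleton, List.append_assoc,
        List.singleton_append] at h1
      simp only [Option.toList_none, List.append_nil] at h2
      simp only [runL, List.length_cons]
      convert h1.trans h2 using 2
      omega
  simpa using key l [] a (by simpa using hB)

lemma pass_right {A : Type} (st : A → S) (f : A → C → A × C × Option Token)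
    (hh : ∀ a, P.halts (st a) = false) (hr : ∀ a, P.toRight (st a) = true)
    (hf : ∀ a c, P.cell (st a) c = (st (f a c).1, (f a c).2.1, (f a c).2.2))
    {ip : ℕ} (hip : ip ≤ n + 1) {a a' : A} {l l' : List C} {toks : List Token} {s' : S}
    {o : Option Token} (hrun : runR f a l = (a', l', toks))
    (hs : P.right (st a') (inputSym n ip) = (s', none, .stay, o)) (out : List Token)
    (hB : l.length + 1 ≤ B) :
    P.Steps n B (P.conf (st a) ip l 1 out) (P.conf s' ip l' l'.length (out ++ toks ++ o.toList)) := by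
  have h1 := sweep_right (n := n) (B := B) st f hh hr hf hip a l out (by omega)
  have hl := length_runR f a l
  rw [hrun] at h1 hl
  exact h1.trans (step_right hs (min_eq_left hip) (hh a') l' _ (by simpa [hl] using hB))

lemma pass_left {A : Type} (st : A → S) (f : A → C → A × C)
    (hh : ∀ a, P.halts (st a) = false) (hr : ∀ a, P.toRight (st a) = false)
    (hf : ∀ a c, P.cell (st a) c = (st (f a c).1, (f a c).2, none))
    {ip : ℕ} (hip : ip ≤ n + 1) {a a' : A} {l l' : List C} {s' : S}
    {o : Option Token} (hrun : runL f a l = (a', l')) (hs : P.left (st a') = (s', o))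
    (out : List Token) (hB : l.length ≤ B) :
    P.Steps n B (P.conf (st a) ip l l.length out) (P.conf s' ip l' 1 (out ++ o.toList)) := by
  have h1 := sweep_left (n := n) (B := B) st f hh hr hf hip a l out hB
  rw [hrun] at h1
  exact h1.trans (step_left hs (hh a') hip l' out)

/-- The first step. -/
lemma step_start : P.machine.step n P.machine.startConfig = some (P.conf P.init 1 [] 1 []) := by
  have ht : Function.update (fun _ : ℕ => (none : Option (Option C))) 0 (some none) = tape [] := by
    funext i
    cases i with
    | zero => simp [tape]
    | succ i => rw [Function.update_of_ne (by omega)]; simp [tape]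
  simp [Machine.step, machine, conf, transition, Machine.startConfig, Move.apply, ht]

lemma step_halt {s : S} (h : P.halts s = true) (ip : ℕ) (l : List C) (pos : ℕ) (out : List Token) :
    P.machine.step n (P.conf s ip l pos out) = none := by
  simp [Machine.step, machine, conf, transition, h]

/-- A terminating run determines the output and bounds the space. -/
lemma outputs_of_steps {s : S} (h : P.halts s = true) {ip : ℕ} {l : List C} {pos : ℕ}
    {out : List Token} (hpos : pos ≤ B)
    (hs : P.Steps n B (P.conf P.init 1 [] 1 []) (P.conf s ip l pos out)) :
    P.machine.Outputs n out ∧ ∀ c, P.machine.Reachable n c → ∀ i, c.pos i ≤ B := by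
  have hs' : P.Steps n B P.machine.startConfig (P.conf s ip l pos out) :=
    Relation.ReflTransGen.head ⟨step_start, fun _ => B.zero_le⟩ hs
  have hn := step_halt (n := n) h ip l pos out
  have hr : P.machine.Reachable n (P.conf s ip l pos out) := by
    refine Relation.ReflTransGen.mono (fun _ _ h => ?_) _ _ hs'
    exact h.1
  refine ⟨⟨_, hr, hn, rfl⟩, fun c hc => ?_⟩
  -- The machine is deterministic, so every reachable configuration lies on the halting run and
  -- inherits its space bound.
  have key : P.Steps n B c (P.conf s ip l pos out) := by
    induction hc with
    | refl => exact hs'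
    | tail _ hcd ih =>
      rcases Relation.ReflTransGen.cases_head ih with rfl | ⟨d', ⟨h1, -⟩, h2⟩
      · rw [hn] at hcd
        simp at hcd
      · rw [hcd] at h1
        rw [Option.some_injective _ h1]
        exact h2
  rcases Relation.ReflTransGen.cases_head key with rfl | ⟨d', ⟨-, h1⟩, -⟩
  · exact fun _ => hpos
  · exact h1

end Sweeper

/-! ### The machine that writes the circuits -/

/-- A cell of the work tape: a label, a bit of each of two addresses, two marks, and a counter. -/
structure Cell (h : ℕ) : Type where
  lab : Lab
  a : Bool
  b : Bool
  u : Bool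
  v : Bool
  m : Fin (h + 1)
deriving Fintype

/-- A new cell. -/
def Cell.new {h : ℕ} (l : Lab) : Cell h := ⟨l, false, false, false, false, 0⟩

/-- A new cell for a bit of the number of input qubits. -/
def Cell.input {h : ℕ} (b : Bool) : Cell h := ⟨(0, b), false, false, true, false, Fin.last h⟩

/-- The blocks of labels that the machine appends. -/
def block : Fin 3 → List Lab
  | 0 => [(1, false)]
  | 1 => constLabs
  | 2 => pairLabs 1

/-- The states. The first group builds the labels; the second one writes the layers. -/
inductive Ctl (T : ℕ) : Type
  | inc (c : Bool)
  | ret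
  | scan (ph found : Bool)
  | app (j : Fin 3) (i : Fin ((block j).length + 1))
  | hits (ph : Bool) (r : Fin 4)
  | mark (any : Bool)
  | pow
  | powEnd
  | check (ℓ : Fin T) (m : Monitor) (z o : Bool)
  | msk (ℓ : Fin T) (e₁ e₂ c x y : Bool)
  | putA (ℓ : Fin T) (e₁ e₂ c : Bool)
  | mid (ℓ : Fin T) (e₂ d : Bool)
  | putB (ℓ : Fin T) (e₂ d c : Bool)
  | fin (ℓ : Fin T) (d : Bool)
  | halt
deriving Fintype

namespace Ctl

variable {h : ℕ} (tbl : List AddrSpec)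

/-- The first state of a layer. -/
def layer (k : ℕ) : Ctl tbl.length :=
  if hk : k < tbl.length then check ⟨k, hk⟩ Monitor.init true true else halt

def afterBlock {T : ℕ} : Fin 3 → Ctl T
  | 0 => hits false 0
  | 1 => mark false
  | 2 => hits true 3

/-- The next cell of a block. -/
def appStep {T : ℕ} (j : Fin 3) (i : Fin ((block j).length + 1)) :
    Ctl T × Option (Cell h) × Move × Option Token :=
  if hi : i.val < (block j).length then
    (app j ⟨i.val + 1, by omega⟩, some (Cell.new (block j)[i.val]), .stay, none)
  else (afterBlock j, none, .stay, none)

/-- The first cell of a block. -/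
def appStart {T : ℕ} (j : Fin 3) : Ctl T × Option (Cell h) × Move × Option Token := appStep j 0

/-- First group: `inc` adds 1 to the binary number of input symbols read, `scan` deletes the first
mark, `hits` takes an amount from the counters, `mark` marks one cell per pair of labels. Second
group: `check` runs the monitor and tests whether the second address is first or last, `msk` marks
the significant digits of both addresses, `putA` and `putB` print an address and at the same time
add a carry to it. -/
def cellStep {T : ℕ} : Ctl T → Cell h → Ctl T × Cell h × Option Token
  | inc c, x => (inc (c && x.lab.2), { x with lab := (x.lab.1, xor x.lab.2 c) }, none)
  | scan ph f, x => (scan ph (f || x.u), { x with u := f && x.u }, none)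
  | hits ph r, x => (hits ph ⟨r - x.m, by omega⟩, { x with m := ⟨x.m - r, by omega⟩ }, none)
  | mark any, x => (mark (any || decide (x.m ≠ 0)), { x with u := decide (x.lab.1 = 2) }, none)
  | pow, x => (pow, x, some (.bit false))
  | check ℓ m z o, x => (check ℓ (m.step x.lab x.a x.b) (z && !x.b) (o && x.b), x, none)
  | msk ℓ e₁ e₂ c p q, x => (msk ℓ e₁ e₂ c (p || x.a) (q || x.b),
      { x with u := p || x.a, v := q || x.b }, none)
  | putA ℓ e₁ e₂ c, x => (putA ℓ e₁ e₂ (c && x.a), { x with a := xor x.a c },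
      if (e₁ && x.u) = true then some (.bit x.a) else none)
  | putB ℓ e₂ d c, x => (putB ℓ e₂ d (c && x.b), { x with b := xor x.b c },
      if (e₂ && x.v) = true then some (.bit x.b) else none)
  | s, x => (s, x, none)

/-- The tests made by a sweep to the left are evaluated here: whether counters remain decides on
another doubling, and an overflow of the first address ends the layer. -/
def leftStep : Ctl tbl.length → Ctl tbl.length × Option Token
  | ret => (inc true, none)
  | hits ph _ => (scan ph false, none)
  | mark any => (if any = true then scan true false else pow, none)
  | powEnd => (layer tbl 0, some .endNum)
  | msk ℓ e₁ e₂ c _ _ => (putA ℓ e₁ e₂ c, if e₁ = true then some tbl[ℓ].tok else none)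
  | mid ℓ e₂ d => (putB ℓ e₂ d true, none)
  | fin ℓ d => if d = true then (layer tbl (ℓ + 1), some .endLayer)
      else (check ℓ Monitor.init true true, none)
  | s => (s, none)

/-- Only here does the tape grow: by a carry of the input count, or by a block of labels after a
mark has been found. After `check` the control keeps three bits: whether to print each address, and
whether the first one advances. -/
def rightStep : Ctl tbl.length → InSym → Ctl tbl.length × Option (Cell h) × Move × Option Token
  | inc true, _ => (inc false, some (Cell.input true), .stay, none)
  | inc false, .one => (ret, none, .right, none)
  | inc false, _ => (hits false 0, none, .stay, none)
  | scan ph found, _ => if found = true then appStart (if ph = true then 2 else 0)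
      else if ph = true then (mark false, none, .stay, none) else appStart 1
  | app j i, _ => appStep j i
  | pow, _ => (powEnd, none, .stay, some (.bit true))
  | check ℓ m z o, _ => (msk ℓ (z && tbl[ℓ].src m.a) (tbl[ℓ].src m.a && tbl[ℓ].tgt m) o false false,
      none, .stay, none)
  | putA ℓ e₁ e₂ c, _ => (mid ℓ e₂ c, none, .stay, if e₁ = true then some .endNum else none)
  | putB ℓ e₂ d _, _ => (fin ℓ d, none, .stay, if e₂ = true then some .endNum else none)
  | s, _ => (s, none, .stay, none)

def isRight {T : ℕ} : Ctl T → Bool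
  | inc _ => true
  | scan _ _ => true
  | app _ _ => true
  | pow => true
  | check _ _ _ _ => true
  | putA _ _ _ _ => true
  | putB _ _ _ _ => true
  | _ => false

def isHalt {T : ℕ} : Ctl T → Bool
  | halt => true
  | _ => false

end Ctl

open Ctl

/-- The machine that writes the circuits with a given list of layers. -/
def writer (h : ℕ) (tbl : List AddrSpec) : Sweeper (Ctl tbl.length) (Cell h) where
  init := inc false
  halts := isHalt
  toRight := isRight
  cell := cellStep
  left := leftStep tbl
  right := rightStep tbl

namespace Sweeper

variable {h : ℕ} {tbl : List AddrSpec} {n B : ℕ}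

lemma runL_id {A C : Type} (a : A) (l : List C) : runL (fun (a : A) (c : C) => (a, c)) a l = (a, l) := by
  induction l with
  | nil => rfl
  | cons c cs ih => simp [runL, ih]

/-! #### Counting the input -/

/-- Addition of a bit. -/
def addBit : Bool → List Bool → Bool × List Bool
  | c, [] => (c, [])
  | c, x :: xs => ((addBit (c && x) xs).1, xor x c :: (addBit (c && x) xs).2)

lemma addBit_false (l : List Bool) : addBit false l = (false, l) := by
  induction l with
  | nil => rfl
  | cons x xs ih => simp [addBit, ih]

lemma bits_succ (k : ℕ) : (k + 1).bits = (addBit true k.bits).2 ++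
    if (addBit true k.bits).1 = true then [true] else [] := by
  induction k using Nat.binaryRec' with
  | zero => simp [addBit]
  | bit b k hk ih =>
    rw [Nat.bits_append_bit k b hk]
    cases b
    · have e : Nat.bit false k + 1 = Nat.bit true k := by simp [Nat.bit_val]
      rw [e, Nat.bits_append_bit k true fun _ => rfl]
      simp [addBit, addBit_false]
    · have e : Nat.bit true k + 1 = Nat.bit false (k + 1) := by simp [Nat.bit_val]; ring
      rw [e, Nat.bits_append_bit (k + 1) false fun h => by omega, ih]
      simp [addBit]

lemma runR_inc (c : Bool) (l : List Bool) :
    runR (fun (c : Bool) (x : Cell h) =>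
      (c && x.lab.2, { x with lab := (x.lab.1, xor x.lab.2 c) }, none)) c (l.map Cell.input) =
    ((addBit c l).1, (addBit c l).2.map Cell.input, []) := by
  induction l generalizing c with
  | nil => rfl
  | cons x xs ih => simp [runR, addBit, ih, Cell.input]

lemma count_step {k : ℕ} (hk : k < n) (out : List Token) (hB : n.size + 1 ≤ B) :
    (writer h tbl).Steps n B
      ((writer h tbl).conf (inc false) (k + 1) (k.bits.map Cell.input) (k.size + 1) out)
      ((writer h tbl).conf (inc false) (k + 2) ((k + 1).bits.map Cell.input) ((k + 1).size + 1)
        out) := by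
  have hs : k.size ≤ n.size := Nat.size_le_size hk.le
  have hs' : (k + 1).size ≤ n.size := Nat.size_le_size hk
  have hlen : (k.bits.map (Cell.input (h := h))).length = k.size := by
    rw [List.length_map, Nat.size_eq_bits_len]
  have hsym : inputSym n (k + 1) = .one := by
    simp [inputSym]; omega
  have h1 := step_right (P := writer h tbl) (n := n) (B := B) (s := inc false) (s' := ret)
    (o := none) (mv := .right) (ip := k + 1) (ip' := k + 2) (by rw [hsym]; rfl)
    (by simp [Move.apply]; omega) rfl (k.bits.map Cell.input) out (by omega)
  have h2 := pass_left (P := writer h tbl) (n := n) (B := B) (fun _ : Unit => ret)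
    (fun a c => (a, c)) (fun _ => rfl) (fun _ => rfl) (fun _ _ => rfl) (ip := k + 2) (by omega)
    (o := none) (runL_id () _) rfl out (l := k.bits.map Cell.input) (by omega)
  have h4 := sweep_right (P := writer h tbl) (n := n) (B := B) inc
    (fun (c : Bool) (x : Cell h) =>
      (c && x.lab.2, { x with lab := (x.lab.1, xor x.lab.2 c) }, none))
    (fun _ => rfl) (fun _ => rfl) (fun _ _ => rfl) (ip := k + 2) (by omega) true
    (k.bits.map Cell.input) out (by omega)
  rw [runR_inc] at h4
  rw [hlen] at h1 h2
  simp only [Option.toList_none, List.append_nil] at h1 h2 h4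
  have h14 := (h1.trans h2).trans h4
  have hb := bits_succ k
  have hl := congrArg List.length hb
  rw [Nat.size_eq_bits_len] at hl
  -- A carry out of the highest digit becomes a new cell.
  rcases hc : (addBit true k.bits).1 with _ | _
  · rw [hc] at hb hl h14
    simp only [Bool.false_eq_true, if_false, List.append_nil] at hb hl
    rw [← hb, List.length_map, Nat.size_eq_bits_len] at h14
    exact h14
  · rw [hc] at hb hl h14
    simp only [if_true, List.length_append, List.length_singleton] at hb hl
    have h5 := step_append (P := writer h tbl) (n := n) (B := B) (s := inc true) (s' := inc false)
      (o := none) (mv := .stay) (ip := k + 2) (ip' := k + 2) (c := Cell.input true) rfl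
      (by simp [Move.apply]; omega) rfl ((addBit true k.bits).2.map Cell.input) out
      (by rw [List.length_map]; omega)
    have e : (addBit true k.bits).2.map (Cell.input (h := h)) ++ [Cell.input true] =
        (k + 1).bits.map Cell.input := by
      rw [hb, List.map_append]; rfl
    rw [e] at h5
    simp only [Option.toList_none, List.append_nil, List.length_map, Nat.size_eq_bits_len] at h5 h14
    exact h14.trans h5

lemma count_steps (hB : n.size + 1 ≤ B) (k : ℕ) (hk : k ≤ n) :
    (writer h tbl).Steps n B ((writer h tbl).conf (inc false) 1 [] 1 [])
      ((writer h tbl).conf (inc false) (k + 1) (k.bits.map Cell.input) (k.size + 1) []) := by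
  induction k with
  | zero => simpa using Steps.refl _
  | succ k ih => exact (ih (by omega)).trans (count_step hk [] hB)

lemma count_end (hB : n.size + 1 ≤ B) :
    (writer h tbl).Steps n B ((writer h tbl).conf (inc false) 1 [] 1 [])
      ((writer h tbl).conf (hits false 0) (n + 1) (n.bits.map Cell.input) n.size []) := by
  refine (count_steps hB n le_rfl).trans ?_
  have hsym : inputSym n (n + 1) = .rightEnd := by simp [inputSym]
  have h1 := step_right (P := writer h tbl) (n := n) (B := B) (s := inc false) (s' := hits false 0)
    (o := none) (mv := .stay) (ip := n + 1) (ip' := n + 1) (by rw [hsym]; rfl)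
    (by simp [Move.apply]) rfl (n.bits.map Cell.input) []
    (by rw [List.length_map, Nat.size_eq_bits_len]; omega)
  rw [List.length_map, Nat.size_eq_bits_len] at h1
  simpa using h1

end Sweeper

open Ctl

namespace Sweeper

variable {h : ℕ} {tbl : List AddrSpec} {n B : ℕ}

/-! #### Building the labels -/

/-- The state of the tape while the labels are built: the labels, the number of marks, and the sum
of the counters. -/
structure Setup (labs : List Lab) (q s : ℕ) (l : List (Cell h)) : Prop where
  labs_eq : l.map Cell.lab = labs
  marks : l.countP (fun c => c.u) = q
  total : (l.map fun c => (c.m : ℕ)).sum = s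
  clear : ∀ c ∈ l, c.a = false ∧ c.b = false

lemma Setup.length {labs : List Lab} {q s : ℕ} {l : List (Cell h)} (H : Setup labs q s l) :
    l.length = labs.length := by
  rw [← H.labs_eq, List.length_map]

lemma Setup.append {labs : List Lab} {q s : ℕ} {l : List (Cell h)} (H : Setup labs q s l)
    (ls : List Lab) : Setup (labs ++ ls) q s (l ++ ls.map Cell.new) := by
  refine ⟨?_, ?_, ?_, ?_⟩
  · rw [List.map_append, H.labs_eq, List.map_map]
    congr 1
    exact List.map_id ls
  · rw [List.countP_append, H.marks, List.countP_map, List.countP_eq_zero.2, add_zero]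
    intro x _
    simp [Cell.new]
  · rw [List.map_append, List.sum_append, H.total, List.map_map, List.sum_eq_zero, add_zero]
    intro x hx
    obtain ⟨y, -, rfl⟩ := List.mem_map.1 hx
    rfl
  · intro c hc
    rcases List.mem_append.1 hc with hc | hc
    · exact H.clear c hc
    · obtain ⟨y, -, rfl⟩ := List.mem_map.1 hc
      exact ⟨rfl, rfl⟩

def scanF (f : Bool) (x : Cell h) : Bool × Cell h × Option Token :=
  (f || x.u, { x with u := f && x.u }, none)

lemma runR_scan_true (l : List (Cell h)) : runR scanF true l = (true, l, []) := by
  induction l with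
  | nil => rfl
  | cons c cs ih => simp [runR, scanF, ih]

/-- The first mark is deleted and the others stay, so marks serve as a unary loop counter held in
finite control and tape. -/
lemma runR_scan (l : List (Cell h)) : ∃ l', runR scanF false l =
    (decide (l.countP (fun c => c.u) ≠ 0), l', []) ∧ ∀ labs q s, Setup labs q s l →
      Setup labs (q - 1) s l' := by
  suffices H : ∃ l', runR scanF false l =
      (decide (l.countP (fun c => c.u) ≠ 0), l', []) ∧ l'.map Cell.lab = l.map Cell.lab ∧
      l'.countP (fun c => c.u) = l.countP (fun c => c.u) - 1 ∧
      (l'.map fun c => (c.m : ℕ)) = l.map (fun c => (c.m : ℕ)) ∧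
      ((∀ c ∈ l, c.a = false ∧ c.b = false) → ∀ c ∈ l', c.a = false ∧ c.b = false) by
    obtain ⟨l', h0, h1, h2, h3, h4⟩ := H
    exact ⟨l', h0, fun labs q s S => ⟨by rw [h1, S.labs_eq], by rw [h2, S.marks],
      by rw [h3, S.total], h4 S.clear⟩⟩
  induction l with
  | nil => exact ⟨[], rfl, rfl, rfl, rfl, fun h => h⟩
  | cons c cs ih =>
    obtain ⟨l', h0, h1, h2, h3, h4⟩ := ih
    cases hu : c.u
    · refine ⟨{ c with u := false } :: l', ?_, ?_, ?_, ?_, ?_⟩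
      · simp only [runR, scanF, hu, Bool.or_false, Bool.and_false]
        have : (fun (f : Bool) (x : Cell h) => (f || x.u, { x with u := f && x.u }, none)) =
          scanF := rfl
        rw [h0]
        simp [hu]
      · simp [h1]
      · simp [h2, hu]
      · simp [h3]
      · intro hc x hx
        rcases List.mem_cons.1 hx with rfl | hx
        · exact hc c List.mem_cons_self
        · exact h4 (fun x hx => hc x (List.mem_cons_of_mem _ hx)) x hx
    · refine ⟨{ c with u := false } :: cs, ?_, ?_, ?_, ?_, ?_⟩
      · simp [runR, scanF, hu, runR_scan_true]
      · simp
      · simp [hu]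
      · simp
      · intro hc x hx
        rcases List.mem_cons.1 hx with rfl | hx
        · exact hc c List.mem_cons_self
        · exact hc x (List.mem_cons_of_mem _ hx)

def hitF (r : Fin 4) (x : Cell h) : Fin 4 × Cell h :=
  (⟨r - x.m, by omega⟩, { x with m := ⟨x.m - r, by omega⟩ })

lemma runL_hit (r : Fin 4) (l : List (Cell h)) : ∃ r' l', runL hitF r l = (r', l') ∧
    ∀ labs q s, Setup labs q s l → Setup labs q (s - r) l' := by
  suffices H : ∃ r' l', runL hitF r l = (r', l') ∧
      (r' : ℕ) = r - (l.map fun c => (c.m : ℕ)).sum ∧ l'.map Cell.lab = l.map Cell.lab ∧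
      l'.countP (fun c => c.u) = l.countP (fun c => c.u) ∧
      (l'.map fun c => (c.m : ℕ)).sum = (l.map fun c => (c.m : ℕ)).sum - r ∧
      ((∀ c ∈ l, c.a = false ∧ c.b = false) → ∀ c ∈ l', c.a = false ∧ c.b = false) by
    obtain ⟨r', l', h0, -, h1, h2, h3, h4⟩ := H
    exact ⟨r', l', h0, fun labs q s S => ⟨by rw [h1, S.labs_eq], by rw [h2, S.marks],
      by rw [h3, S.total], h4 S.clear⟩⟩
  induction l with
  | nil => exact ⟨r, [], rfl, by simp, rfl, rfl, by simp, fun h => h⟩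
  | cons c cs ih =>
    obtain ⟨r', l', h0, hr, h1, h2, h3, h4⟩ := ih
    refine ⟨(hitF r' c).1, (hitF r' c).2 :: l', ?_, ?_, ?_, ?_, ?_, ?_⟩
    · simp only [runL, h0]
    · simp only [hitF, List.map_cons, List.sum_cons, hr]
      omega
    · simp [hitF, h1]
    · simp [hitF, List.countP_cons, h2]
    · simp only [hitF, List.map_cons, List.sum_cons, h3, hr]
      omega
    · intro hc x hx
      rcases List.mem_cons.1 hx with rfl | hx
      · exact hc c List.mem_cons_self
      · exact h4 (fun x hx => hc x (List.mem_cons_of_mem _ hx)) x hx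

def markF (any : Bool) (x : Cell h) : Bool × Cell h :=
  (any || decide (x.m ≠ 0), { x with u := decide (x.lab.1 = 2) })

/-- As many marks are set as there are pairs of labels; appending one pair per mark then doubles the
number of pairs. -/
lemma runL_mark (l : List (Cell h)) : ∃ l', runL markF false l =
    (decide ((l.map fun c => (c.m : ℕ)).sum ≠ 0), l') ∧
    ∀ labs q s, Setup labs q s l → Setup labs (flen 2 labs) s l' := by
  suffices H : ∃ l', runL markF false l = (decide ((l.map fun c => (c.m : ℕ)).sum ≠ 0), l') ∧
      l'.map Cell.lab = l.map Cell.lab ∧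
      l'.countP (fun c => c.u) = flen 2 (l.map Cell.lab) ∧
      (l'.map fun c => (c.m : ℕ)) = l.map (fun c => (c.m : ℕ)) ∧
      ((∀ c ∈ l, c.a = false ∧ c.b = false) → ∀ c ∈ l', c.a = false ∧ c.b = false) by
    obtain ⟨l', h0, h1, h2, h3, h4⟩ := H
    exact ⟨l', h0, fun labs q s S => ⟨by rw [h1, S.labs_eq], by rw [h2, S.labs_eq],
      by rw [h3, S.total], h4 S.clear⟩⟩
  induction l with
  | nil => exact ⟨[], rfl, rfl, rfl, rfl, fun h => h⟩
  | cons c cs ih =>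
    obtain ⟨l', h0, h1, h2, h3, h4⟩ := ih
    refine ⟨(markF false c).2 :: l', ?_, ?_, ?_, ?_, ?_⟩
    · simp only [runL, h0, markF, List.map_cons, List.sum_cons, Prod.mk.injEq, and_true]
      rw [Bool.eq_iff_iff]
      simp only [Bool.or_eq_true, decide_eq_true_iff, ne_eq, Nat.add_eq_zero_iff, Fin.ext_iff,
        Fin.val_zero]
      tauto
    · simp [markF, h1]
    · rw [List.countP_cons, h2, List.map_cons, flen]
      simp only [markF, decide_eq_true_eq]
      split_ifs <;> rfl
    · simp [markF, h3]
    · intro hc x hx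
      rcases List.mem_cons.1 hx with rfl | hx
      · exact hc c List.mem_cons_self
      · exact h4 (fun x hx => hc x (List.mem_cons_of_mem _ hx)) x hx

/-- Appending a block. -/
lemma append_block (j : Fin 3) {s : Ctl tbl.length} (hs : isHalt s = false)
    (hs' : ∀ i, (writer h tbl).right s i = appStart j) (l : List (Cell h)) (out : List Token)
    (hB : (l ++ (block j).map Cell.new).length + 1 ≤ B) :
    (writer h tbl).Steps n B ((writer h tbl).conf s (n + 1) l (l.length + 1) out)
      ((writer h tbl).conf (afterBlock j) (n + 1) (l ++ (block j).map Cell.new)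
        (l ++ (block j).map Cell.new).length out) := by
  have key : ∀ (d : ℕ) (i : Fin ((block j).length + 1)), i + d = (block j).length →
      ∀ (s : Ctl tbl.length), isHalt s = false → (∀ x, (writer h tbl).right s x = appStep j i) →
      ∀ l : List (Cell h), l.length + d + 1 ≤ B →
      (writer h tbl).Steps n B ((writer h tbl).conf s (n + 1) l (l.length + 1) out)
        ((writer h tbl).conf (afterBlock j) (n + 1) (l ++ ((block j).drop i).map Cell.new)
          (l ++ ((block j).drop i).map Cell.new).length out) := by
    intro d
    induction d with
    | zero =>
      intro i hi s hs hs' l hl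
      have h1 := step_right (P := writer h tbl) (n := n) (B := B) (s := s) (s' := afterBlock j)
        (o := none) (mv := .stay) (ip := n + 1) (ip' := n + 1)
        (by rw [hs', appStep, dif_neg (by omega)]) (by simp [Move.apply]) hs l out (by omega)
      rw [List.drop_eq_nil_of_le (by omega)]
      simpa using h1
    | succ d ih =>
      intro i hi s hs hs' l hl
      have hlt : i.val < (block j).length := by omega
      have h1 := step_append (P := writer h tbl) (n := n) (B := B) (s := s)
        (s' := app j ⟨i.val + 1, by omega⟩) (o := none) (mv := .stay) (ip := n + 1) (ip' := n + 1)
        (c := Cell.new (block j)[i.val]) (by rw [hs', appStep, dif_pos hlt])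
        (by simp [Move.apply]) hs l out (by omega)
      have h2 := ih ⟨i.val + 1, by omega⟩ (by simp only; omega) (app j ⟨i.val + 1, by omega⟩) rfl
        (fun _ => rfl) (l ++ [Cell.new (block j)[i.val]]) (by simp; omega)
      rw [List.drop_eq_getElem_cons hlt]
      simp only [Option.toList_none, List.append_nil] at h1
      refine h1.trans ?_
      simpa only [List.append_assoc, List.singleton_append, List.map_cons] using h2
  have := key (block j).length 0 (by simp) s hs hs' l (by simpa using hB)
  simpa using this

def blockOf (ph : Bool) : Fin 3 := if ph = true then 2 else 0

def hitsOf (ph : Bool) : Fin 4 := if ph = true then 3 else 0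

/-- Removing one mark. -/
lemma scan_round (ph : Bool) {labs : List Lab} {q s : ℕ} {l : List (Cell h)}
    (H : Setup labs (q + 1) s l) (out : List Token)
    (hB : (labs ++ block (blockOf ph)).length + 1 ≤ B) :
    ∃ l', Setup (labs ++ block (blockOf ph)) q (s - hitsOf ph) l' ∧
      (writer h tbl).Steps n B ((writer h tbl).conf (scan ph false) (n + 1) l 1 out)
        ((writer h tbl).conf (scan ph false) (n + 1) l' 1 out) := by
  rw [List.length_append] at hB
  obtain ⟨l₁, h1, S1⟩ := runR_scan l
  have S1 := S1 _ _ _ H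
  rw [H.marks] at h1
  simp only [ne_eq, Nat.add_eq_zero_iff, one_ne_zero, and_false, not_false_eq_true, decide_true]
    at h1
  have t1 := sweep_right (P := writer h tbl) (n := n) (B := B) (scan ph) scanF
    (fun _ => rfl) (fun _ => rfl) (fun _ _ => rfl) (ip := n + 1) (by omega) false l out
    (by rw [H.length]; omega)
  rw [h1] at t1
  have t2 := append_block (tbl := tbl) (n := n) (B := B) (blockOf ph) (s := scan ph true) rfl
    (fun _ => rfl) l₁ out (by simp [S1.length]; omega)
  have S2 := S1.append (block (blockOf ph))
  generalize l₁ ++ (block (blockOf ph)).map Cell.new = l₂ at t2 S2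
  obtain ⟨r', l₃, h3, S3⟩ := runL_hit (hitsOf ph) l₂
  have t3 := pass_left (P := writer h tbl) (n := n) (B := B) (hits ph) hitF
    (fun _ => rfl) (fun _ => rfl) (fun _ _ => rfl) (ip := n + 1) (by omega)
    (o := none) (s' := scan ph false) h3 rfl out (by rw [S2.length, List.length_append]; omega)
  refine ⟨l₃, S3 _ _ _ S2, ?_⟩
  have e : (afterBlock (blockOf ph) : Ctl tbl.length) = hits ph (hitsOf ph) := by
    cases ph <;> rfl
  rw [e] at t2
  simp only [List.append_nil, Option.toList_none] at t1 t3
  exact (t1.trans t2).trans t3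

lemma scan_rounds (ph : Bool) (out : List Token) (q : ℕ) : ∀ {labs : List Lab} {s : ℕ}
    {l : List (Cell h)}, Setup labs q s l →
    (labs ++ (List.replicate q (block (blockOf ph))).flatten).length + 1 ≤ B →
    ∃ l', Setup (labs ++ (List.replicate q (block (blockOf ph))).flatten) 0
        (s - q * hitsOf ph) l' ∧
      (writer h tbl).Steps n B ((writer h tbl).conf (scan ph false) (n + 1) l 1 out)
        ((writer h tbl).conf (scan ph false) (n + 1) l' (l'.length + 1) out) := by
  induction q with
  | zero =>
    intro labs s l H hB
    obtain ⟨l₁, h1, S1⟩ := runR_scan l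
    have S1 := S1 _ _ _ H
    rw [H.marks] at h1
    have t1 := sweep_right (P := writer h tbl) (n := n) (B := B) (scan ph) scanF
      (fun _ => rfl) (fun _ => rfl) (fun _ _ => rfl) (ip := n + 1) (by omega) false l out
      (by rw [H.length]; simp at hB; omega)
    rw [h1] at t1
    refine ⟨l₁, by simpa using S1, ?_⟩
    simpa using t1
  | succ q ih =>
    intro labs s l H hB
    rw [List.replicate_succ, List.flatten_cons, ← List.append_assoc] at hB ⊢
    obtain ⟨l₁, S1, t1⟩ := scan_round (tbl := tbl) (n := n) (B := B) ph H out
      (by rw [List.length_append] at hB; omega)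
    obtain ⟨l₂, S2, t2⟩ := ih S1 hB
    refine ⟨l₂, ?_, t1.trans t2⟩
    rwa [show s - (q + 1) * (hitsOf ph : ℕ) = s - hitsOf ph - q * hitsOf ph by
      rw [Nat.sub_sub]; congr 1; ring]

lemma right_scan (ph found : Bool) (i : InSym) : (writer h tbl).right (scan ph found) i =
    if found = true then appStart (if ph = true then 2 else 0)
    else if ph = true then (mark false, none, .stay, none) else appStart 1 := rfl

/-- Appending the labels that are not repeated. -/
lemma extend_steps {labs : List Lab} {q s : ℕ} {l : List (Cell h)} (H : Setup labs q s l)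
    (out : List Token)
    (hB : (labs ++ (List.replicate q ((1 : Kind), false) ++ constLabs)).length + 1 ≤ B) :
    ∃ l', Setup (labs ++ (List.replicate q ((1 : Kind), false) ++ constLabs)) 0 s l' ∧
      (writer h tbl).Steps n B ((writer h tbl).conf (scan false false) (n + 1) l 1 out)
        ((writer h tbl).conf (mark false) (n + 1) l' l'.length out) := by
  have e : (List.replicate q (block (blockOf false))).flatten =
      List.replicate q ((1 : Kind), false) := by
    change (List.replicate q [((1 : Kind), false)]).flatten = _
    rw [List.flatten_replicate_singleton]
  rw [← List.append_assoc] at hB ⊢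
  obtain ⟨l₁, S1, t1⟩ := scan_rounds (tbl := tbl) (n := n) (B := B) false out q H
    (by rw [e]; rw [List.length_append] at hB; omega)
  rw [e] at S1
  have e1 : block 1 = constLabs := rfl
  have t2 := append_block (tbl := tbl) (n := n) (B := B) 1 (s := scan false false) rfl
    (fun _ => by rw [right_scan, if_neg Bool.false_ne_true, if_neg Bool.false_ne_true]) l₁ out (by
      rw [e1, List.length_append, S1.length, List.length_map, ← List.length_append]
      exact hB)
  rw [e1] at t2
  have S2 := S1.append constLabs
  rw [show s - q * (hitsOf false : ℕ) = s by simp [hitsOf]] at S2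
  exact ⟨_, S2, t1.trans t2⟩

lemma pairLabs_add (u w : ℕ) : pairLabs (u + w) = pairLabs u ++ pairLabs w := by
  rw [pairLabs, List.replicate_add, List.flatten_append]; rfl

/-- Doubling the number of pairs of labels until the counters are empty. -/
lemma grow_steps (out : List Token) (s : ℕ) : ∀ {labs : List Lab} {q : ℕ} {l : List (Cell h)},
    Setup labs q s l → flen 2 labs ≠ 0 →
    (labs ++ pairLabs (grow (flen 2 labs) s - flen 2 labs)).length + 1 ≤ B →
    ∃ l' q', Setup (labs ++ pairLabs (grow (flen 2 labs) s - flen 2 labs)) q' 0 l' ∧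
      (writer h tbl).Steps n B ((writer h tbl).conf (mark false) (n + 1) l l.length out)
        ((writer h tbl).conf pow (n + 1) l' 1 out) := by
  induction s using Nat.strong_induction_on with
  | _ s ih =>
    intro labs q l H hu hB
    obtain ⟨l₁, h1, S1⟩ := runL_mark l
    have S1 := S1 _ _ _ H
    rw [H.total] at h1
    have hlen : labs.length + 1 ≤ B := by
      rw [List.length_append] at hB; omega
    have t1 := fun o s' hs => pass_left (P := writer h tbl) (n := n) (B := B) mark markF
      (fun _ => rfl) (fun _ => rfl) (fun _ _ => rfl) (ip := n + 1) (by omega)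
      (o := o) (s' := s') h1 hs out (by rw [H.length]; omega)
    by_cases hs : s = 0
    · subst hs
      have t1 := t1 none pow rfl
      refine ⟨l₁, flen 2 labs, ?_, by simpa using t1⟩
      rw [grow_zero, Nat.sub_self]
      simpa [pairLabs] using S1
    -- One round appends a pair and takes 3 from the counters for each of the u marks, so u becomes
    -- 2u and s becomes s - 3u, as in the recursion of `grow`.
    · have t1 := t1 none (scan true false) (by simp [hs, writer, leftStep])
      simp only [Option.toList_none, List.append_nil] at t1
      have hg := grow_pos hu hs
      have hge := (grow_spec (s - 3 * flen 2 labs) (2 * flen 2 labs) (by omega)).1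
      obtain ⟨i, hi⟩ := hge
      have hge : 2 * flen 2 labs ≤ grow (2 * flen 2 labs) (s - 3 * flen 2 labs) := by
        rw [hi]; exact Nat.le_mul_of_pos_right _ (by positivity)
      rw [hg] at hB ⊢
      generalize hG : grow (2 * flen 2 labs) (s - 3 * flen 2 labs) = G at *
      have e : (List.replicate (flen 2 labs) (block (blockOf true))).flatten =
          pairLabs (flen 2 labs) := by
        simp [block, blockOf, pairLabs]
      have e2 : labs ++ pairLabs (G - flen 2 labs) =
          labs ++ pairLabs (flen 2 labs) ++ pairLabs (G - 2 * flen 2 labs) := by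
        rw [List.append_assoc, ← pairLabs_add]
        congr 2; omega
      have e3 : flen 2 (labs ++ pairLabs (flen 2 labs)) = 2 * flen 2 labs := by
        rw [flen_append, flen_pairLabs, if_pos (Or.inl rfl)]; ring
      rw [e2] at hB ⊢
      obtain ⟨l₂, S2, t2⟩ := scan_rounds (tbl := tbl) (n := n) (B := B) true out _ S1
        (by rw [e]; rw [List.length_append] at hB; omega)
      rw [e] at S2
      have hh : s - flen 2 labs * (hitsOf true : ℕ) = s - 3 * flen 2 labs := by
        rw [mul_comm]; rfl
      rw [hh] at S2
      have t3 := step_right (P := writer h tbl) (n := n) (B := B) (s := scan true false)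
        (s' := mark false) (o := none) (mv := .stay) (ip := n + 1) (ip' := n + 1) rfl
        (by simp [Move.apply]) rfl l₂ out
        (by rw [S2.length]; rw [List.length_append] at hB; omega)
      obtain ⟨l₃, q', S3, t4⟩ := ih (s - 3 * flen 2 labs) (by omega) S2 (by omega)
        (by rw [e3, hG]; exact hB)
      rw [e3, hG] at S3
      simp only [Option.toList_none, List.append_nil] at t3
      exact ⟨l₃, q', S3, ((t1.trans t2).trans t3).trans t4⟩

lemma setup_inputs (l : List Bool) :
    Setup (h := h) (l.map fun b => ((0 : Kind), b)) l.length (h * l.length) (l.map Cell.input) := by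
  refine ⟨by rw [List.map_map]; rfl, ?_, ?_, ?_⟩
  · rw [List.countP_map, List.countP_eq_length.2]
    intro x _; rfl
  · rw [List.map_map]
    have : (fun c : Cell h => (c.m : ℕ)) ∘ Cell.input = fun _ => h := by funext b; rfl
    rw [this, List.map_const', List.sum_replicate, smul_eq_mul, mul_comm]
  · intro c hc
    obtain ⟨y, -, rfl⟩ := List.mem_map.1 hc
    exact ⟨rfl, rfl⟩

/-- The machine writes the labels on its work tape. -/
lemma labels_steps (hB : (labels h n).length + 1 ≤ B) :
    ∃ l q, Setup (labels h n) q 0 l ∧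
      (writer h tbl).Steps n B ((writer h tbl).conf (inc false) 1 [] 1 [])
        ((writer h tbl).conf pow (n + 1) l 1 []) := by
  have hge := length_labels_ge h n
  have t1 := count_end (h := h) (tbl := tbl) (n := n) (B := B) (by omega)
  have S0 := setup_inputs (h := h) n.bits
  rw [Nat.size_eq_bits_len] at S0
  obtain ⟨r', l₁, h1, S1⟩ := runL_hit 0 (n.bits.map (Cell.input (h := h)))
  have S1 := S1 _ _ _ S0
  have t2 := pass_left (P := writer h tbl) (n := n) (B := B) (hits false) hitF
    (fun _ => rfl) (fun _ => rfl) (fun _ _ => rfl) (ip := n + 1) (by omega)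
    (o := none) (s' := scan false false) h1 rfl []
    (by rw [List.length_map, Nat.size_eq_bits_len]; omega)
  have hl : labels h n = (n.bits.map fun b => ((0 : Kind), b)) ++
      (List.replicate n.size ((1 : Kind), false) ++ constLabs) ++ pairLabs (width h n - 96) := by
    rw [labels, List.append_assoc, List.append_assoc]
  rw [hl] at hB ⊢
  obtain ⟨l₂, S2, t3⟩ := extend_steps (tbl := tbl) (n := n) (B := B) S1 []
    (by rw [List.length_append] at hB; omega)
  have e : flen 2 ((n.bits.map fun b => ((0 : Kind), b)) ++
      (List.replicate n.size ((1 : Kind), false) ++ constLabs)) = 96 := by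
    rw [flen_append, flen_append, flen_inputs, flen_replicate, constLabs, flen_append,
      flen_pairLabs, show flen 2 ([4, 5, 6, 7, 8, 9, 1, 1, 1, 1, 1, 1, 1].map fun κ : Kind => (κ, false)) = 0 by decide]
    simp
  obtain ⟨l₃, q', S3, t4⟩ := grow_steps (tbl := tbl) (n := n) (B := B) [] _ S2 (by rw [e]; norm_num)
    (by rw [e]; exact hB)
  rw [e] at S3
  rw [List.length_map, Nat.size_eq_bits_len] at t2
  simp only [Option.toList_none, List.append_nil] at t2
  exact ⟨l₃, q', S3, ((t1.trans t2).trans t3).trans t4⟩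

end Sweeper

open Ctl

namespace Sweeper

variable {h : ℕ} {tbl : List AddrSpec} {n B : ℕ}

/-! #### Writing the layers -/

/-- The cells hold the labels, and their contents are related to the digits of two numbers and to
the remaining digits. -/
def Rep (P : Cell h → ℕ → ℕ → Prop) : List Lab → ℕ → ℕ → List (Cell h) → Prop
  | [], _, _, [] => True
  | l :: ls, a, b, c :: cs => c.lab = l ∧ P c a b ∧ Rep P ls (a / 2) (b / 2) cs
  | _, _, _, _ => False

def Plain (c : Cell h) (a b : ℕ) : Prop := c.a = bitOf a ∧ c.b = bitOf b

def MarkedB (c : Cell h) (a b : ℕ) : Prop := Plain c a b ∧ c.v = decide (b ≠ 0)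

def MarkedAB (c : Cell h) (a b : ℕ) : Prop := MarkedB c a b ∧ c.u = decide (a ≠ 0)

lemma Rep.length {P : Cell h → ℕ → ℕ → Prop} {labs : List Lab} {a b : ℕ} {l : List (Cell h)}
    (H : Rep P labs a b l) : l.length = labs.length := by
  induction labs generalizing a b l with
  | nil => cases l with
    | nil => rfl
    | cons => exact H.elim
  | cons x xs ih => cases l with
    | nil => exact H.elim
    | cons c cs => simp [ih H.2.2]

lemma div_two_lt {a k : ℕ} (h : a < 2 ^ (k + 1)) : a / 2 < 2 ^ k := by
  rw [pow_succ] at h; omega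

lemma bitOf_eq_true {a : ℕ} : bitOf a = true ↔ a % 2 = 1 := by simp [bitOf]

lemma bits_eq_ite (a : ℕ) : a.bits = if a = 0 then [] else bitOf a :: (a / 2).bits := by
  split_ifs with h
  · simp [h]
  · have e : Nat.bit (bitOf a) (a / 2) = a := by
      rw [Nat.bit_val, toNat_bitOf]; omega
    conv_lhs => rw [← e]
    rw [Nat.bits_append_bit]
    intro h0
    rw [bitOf_eq_true]; omega

/-- Addresses on the tape count modulo 2^length, so an overflow resets them to zero. -/
lemma Rep.congr {labs : List Lab} {a b a' b' : ℕ} {l : List (Cell h)} (H : Rep Plain labs a b l)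
    (ha : a % 2 ^ labs.length = a' % 2 ^ labs.length)
    (hb : b % 2 ^ labs.length = b' % 2 ^ labs.length) : Rep Plain labs a' b' l := by
  have key : ∀ {a a' k : ℕ}, a % 2 ^ (k + 1) = a' % 2 ^ (k + 1) →
      a / 2 % 2 ^ k = a' / 2 % 2 ^ k ∧ bitOf a = bitOf a' := by
    intro a a' k h
    rw [pow_succ'] at h
    refine ⟨?_, ?_⟩
    · rw [← Nat.mod_mul_right_div_self, ← Nat.mod_mul_right_div_self, h]
    · have h2 := congrArg (· % 2) h
      simp only [Nat.mod_mul_right_mod] at h2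
      unfold bitOf
      rw [h2]
  induction labs generalizing a b a' b' l with
  | nil => cases l with
    | nil => trivial
    | cons => exact H.elim
  | cons x xs ih => cases l with
    | nil => exact H.elim
    | cons c cs =>
      obtain ⟨h1, ⟨h2, h3⟩, h4⟩ := H
      exact ⟨h1, ⟨h2.trans (key ha).2, h3.trans (key hb).2⟩, ih h4 (key ha).1 (key hb).1⟩

def checkF (p : Monitor × Bool × Bool) (x : Cell h) :
    (Monitor × Bool × Bool) × Cell h × Option Token :=
  ((p.1.step x.lab x.a x.b, p.2.1 && !x.b, p.2.2 && x.b), x, none)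

lemma runR_check {labs : List Lab} {a b : ℕ} {l : List (Cell h)} (H : Rep Plain labs a b l)
    (hb : b < 2 ^ labs.length) (m : Monitor) (z o : Bool) :
    runR checkF (m, z, o) l = ((m.run labs a b, z && decide (b = 0),
      o && decide (b + 1 = 2 ^ labs.length)), l, []) := by
  induction labs generalizing a b l m z o with
  | nil => cases l with
    | nil =>
      have : b = 0 := by simpa using hb
      simp [runR, Monitor.run, this]
    | cons => exact H.elim
  | cons x xs ih => cases l with
    | nil => exact H.elim
    | cons c cs =>
      obtain ⟨h1, ⟨h2, h3⟩, h4⟩ := H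
      have e1 : (!bitOf b && decide (b / 2 = 0)) = decide (b = 0) := by
        rw [Bool.eq_iff_iff]; simp [bitOf]; omega
      have e2 : (bitOf b && decide (b / 2 + 1 = 2 ^ xs.length)) =
          decide (b + 1 = 2 ^ (xs.length + 1)) := by
        rw [Bool.eq_iff_iff, pow_succ]; simp [bitOf]; omega
      simp only [runR, checkF]
      rw [ih h4 (div_two_lt hb), h1, h2, h3, Bool.and_assoc, Bool.and_assoc, e1, e2]
      rfl

def mskF (p : Bool × Bool) (x : Cell h) : (Bool × Bool) × Cell h :=
  ((p.1 || x.a, p.2 || x.b), { x with u := p.1 || x.a, v := p.2 || x.b })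

/-- A digit is significant if the number formed by it and the higher digits is not zero. A sweep
from the high end knows this, and `Nat.bits` has no leading zeros, so only marked digits may be
printed. -/
lemma runL_msk {labs : List Lab} {a b : ℕ} {l : List (Cell h)} (H : Rep Plain labs a b l)
    (ha : a < 2 ^ labs.length) (hb : b < 2 ^ labs.length) :
    ∃ l', runL mskF (false, false) l = ((decide (a ≠ 0), decide (b ≠ 0)), l') ∧
      Rep MarkedAB labs a b l' := by
  have key : ∀ a : ℕ, (decide (a / 2 ≠ 0) || bitOf a) = decide (a ≠ 0) := by
    intro a
    rw [Bool.eq_iff_iff]; simp [bitOf]; omega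
  induction labs generalizing a b l with
  | nil => cases l with
    | nil =>
      have ha : a = 0 := by simpa using ha
      have hb : b = 0 := by simpa using hb
      exact ⟨[], by simp [runL, ha, hb], trivial⟩
    | cons => exact H.elim
  | cons x xs ih => cases l with
    | nil => exact H.elim
    | cons c cs =>
      obtain ⟨h1, ⟨h2, h3⟩, h4⟩ := H
      obtain ⟨l', h5, h6⟩ := ih h4 (div_two_lt ha) (div_two_lt hb)
      refine ⟨{ c with u := decide (a ≠ 0), v := decide (b ≠ 0) } :: l', ?_,
        h1, ⟨⟨⟨h2, h3⟩, rfl⟩, rfl⟩, h6⟩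
      simp only [runL, h5, mskF, h2, h3, key]

lemma carry (a : ℕ) (c : Bool) : a / 2 + (c && bitOf a).toNat = (a + c.toNat) / 2 ∧
    (bitOf a ^^ c) = bitOf (a + c.toNat) := by
  rcases Nat.mod_two_eq_zero_or_one a with h | h <;> cases c <;>
    simp only [bitOf, h, Bool.false_and, Bool.true_and, Bool.toNat_false, Bool.toNat_true,
      add_zero] <;> refine ⟨?_, ?_⟩ <;> first | omega | (simp <;> omega)

def putAF (e : Bool) (c : Bool) (x : Cell h) : Bool × Cell h × Option Token :=
  (c && x.a, { x with a := xor x.a c }, if (e && x.u) = true then some (.bit x.a) else none)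

/-- The old digit is printed while the new one is stored, so printing and incrementing share a
sweep. The final carry reports that the address was the last one. -/
lemma runR_putA (e : Bool) {labs : List Lab} {a b : ℕ} {l : List (Cell h)}
    (H : Rep MarkedAB labs a b l) (ha : a < 2 ^ labs.length) (c : Bool) :
    ∃ l', runR (putAF e) c l = (decide (a + c.toNat = 2 ^ labs.length), l',
      if e = true then a.bits.map Token.bit else []) ∧ Rep MarkedB labs (a + c.toNat) b l' := by
  induction labs generalizing a b l c with
  | nil => cases l with
    | nil =>
      have : a = 0 := by simpa using ha
      refine ⟨[], ?_, trivial⟩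
      cases c <;> simp [runR, this]
    | cons => exact H.elim
  | cons x xs ih => cases l with
    | nil => exact H.elim
    | cons y cs =>
      obtain ⟨h1, ⟨⟨⟨h2, h3⟩, hv⟩, hu⟩, h4⟩ := H
      obtain ⟨l', h5, h6⟩ := ih h4 (div_two_lt ha) (c && bitOf a)
      obtain ⟨c1, c2⟩ := carry a c
      rw [c1] at h5 h6
      refine ⟨{ y with a := xor y.a c } :: l', ?_, h1, ⟨⟨?_, h3⟩, hv⟩, h6⟩
      · have e1 : decide ((a + c.toNat) / 2 = 2 ^ xs.length) =
            decide (a + c.toNat = 2 ^ (xs.length + 1)) := by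
          rw [List.length_cons, pow_succ] at ha
          have := c.toNat_le
          rw [Bool.eq_iff_iff, pow_succ]; simp; omega
        rw [show (c && bitOf a) = (putAF e c y).1 by rw [putAF, h2]] at h5
        simp only [runR, h5]
        rw [e1, bits_eq_ite a]
        simp only [putAF, hu, h2, List.length_cons]
        congr 2
        by_cases h0 : a = 0
        · subst h0; simp
        · cases e <;> simp [h0]
      · exact (congrArg (xor · c) h2).trans c2

def putBF (e : Bool) (c : Bool) (x : Cell h) : Bool × Cell h × Option Token :=
  (c && x.b, { x with b := xor x.b c }, if (e && x.v) = true then some (.bit x.b) else none)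

lemma runR_putB (e : Bool) {labs : List Lab} {a b : ℕ} {l : List (Cell h)}
    (H : Rep MarkedB labs a b l) (hb : b < 2 ^ labs.length) (c : Bool) :
    ∃ c' l', runR (putBF e) c l = (c', l', if e = true then b.bits.map Token.bit else []) ∧
      Rep Plain labs a (b + c.toNat) l' := by
  induction labs generalizing a b l c with
  | nil => cases l with
    | nil =>
      have : b = 0 := by simpa using hb
      exact ⟨c, [], by simp [runR, this], trivial⟩
    | cons => exact H.elim
  | cons x xs ih => cases l with
    | nil => exact H.elim
    | cons y cs =>
      obtain ⟨h1, ⟨⟨h2, h3⟩, hv⟩, h4⟩ := H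
      obtain ⟨c', l', h5, h6⟩ := ih h4 (div_two_lt hb) (c && bitOf b)
      obtain ⟨c1, c2⟩ := carry b c
      rw [c1] at h6
      refine ⟨c', { y with b := xor y.b c } :: l', ?_, h1, ⟨h2, ?_⟩, h6⟩
      · rw [show (c && bitOf b) = (putBF e c y).1 by rw [putBF, h3]] at h5
        simp only [runR, h5]
        rw [bits_eq_ite b]
        simp only [putBF, hv, h3]
        congr 2
        by_cases h0 : b = 0
        · subst h0; simp
        · cases e <;> simp [h0]
      · exact (congrArg (xor · c) h3).trans c2

/-- The state after a pair of addresses. -/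
def next (ℓ : Fin tbl.length) (d : Bool) : Ctl tbl.length :=
  if d = true then layer tbl (ℓ + 1) else check ℓ Monitor.init true true

/-- One pair of addresses. -/
lemma pair_steps (ℓ : Fin tbl.length) {labs : List Lab} {a b : ℕ} {l : List (Cell h)}
    (H : Rep Plain labs a b l) (ha : a < 2 ^ labs.length) (hb : b < 2 ^ labs.length)
    (hB : labs.length + 1 ≤ B) {c d : Bool} (hc : c = decide (b + 1 = 2 ^ labs.length))
    (hd : d = decide (a + c.toNat = 2 ^ labs.length)) (out : List Token) :
    ∃ l', Rep Plain labs (a + c.toNat) (b + 1) l' ∧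
      (writer h tbl).Steps n B
        ((writer h tbl).conf (check ℓ Monitor.init true true) (n + 1) l 1 out)
        ((writer h tbl).conf (next ℓ d) (n + 1) l' 1
          (out ++ tbl[ℓ].describePair labs a b ++ if d = true then [.endLayer] else [])) := by
  set m := Monitor.init.run labs a b with hm
  set e₁ : Bool := decide (b = 0) && tbl[ℓ].src m.a with he₁
  set e₂ : Bool := tbl[ℓ].src m.a && tbl[ℓ].tgt m with he₂
  -- Six sweeps in alternating directions: monitor, significant digits, print and advance the first
  -- address, return, print and advance the second address, return.
  have r1 := runR_check H hb Monitor.init true true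
  rw [← hm, ← hc.trans (Bool.true_and _).symm, Bool.true_and] at r1
  have t1 := pass_right (P := writer h tbl) (n := n) (B := B)
    (fun p : Monitor × Bool × Bool => check ℓ p.1 p.2.1 p.2.2) checkF
    (fun _ => rfl) (fun _ => rfl) (fun _ _ => rfl) (ip := n + 1) le_rfl
    (s' := msk ℓ e₁ e₂ c false false) (o := none) r1 rfl out (by rw [H.length]; omega)
  obtain ⟨l₁, r2, H1⟩ := runL_msk H ha hb
  have t2 := pass_left (P := writer h tbl) (n := n) (B := B)
    (fun p : Bool × Bool => msk ℓ e₁ e₂ c p.1 p.2) mskF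
    (fun _ => rfl) (fun _ => rfl) (fun _ _ => rfl) (ip := n + 1) le_rfl
    (s' := putA ℓ e₁ e₂ c) (o := if e₁ = true then some tbl[ℓ].tok else none) r2 rfl
  obtain ⟨l₂, r3, H2⟩ := runR_putA e₁ H1 ha c
  rw [← hd] at r3
  have t3 := pass_right (P := writer h tbl) (n := n) (B := B) (putA ℓ e₁ e₂) (putAF e₁)
    (fun _ => rfl) (fun _ => rfl) (fun _ _ => rfl) (ip := n + 1) le_rfl
    (s' := mid ℓ e₂ d) (o := if e₁ = true then some .endNum else none) r3 rfl
  have t4 := pass_left (P := writer h tbl) (n := n) (B := B) (fun _ : Unit => mid ℓ e₂ d)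
    (fun a c => (a, c)) (fun _ => rfl) (fun _ => rfl) (fun _ _ => rfl) (ip := n + 1) le_rfl
    (s' := putB ℓ e₂ d true) (o := none) (runL_id () l₂) rfl
  obtain ⟨c', l₃, r5, H3⟩ := runR_putB e₂ H2 hb true
  have t5 := pass_right (P := writer h tbl) (n := n) (B := B) (putB ℓ e₂ d) (putBF e₂)
    (fun _ => rfl) (fun _ => rfl) (fun _ _ => rfl) (ip := n + 1) le_rfl
    (s' := fin ℓ d) (o := if e₂ = true then some .endNum else none) r5 rfl
  have t6 := pass_left (P := writer h tbl) (n := n) (B := B) (fun _ : Unit => fin ℓ d)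
    (fun a c => (a, c)) (fun _ => rfl) (fun _ => rfl) (fun _ _ => rfl) (ip := n + 1) le_rfl
    (s' := next ℓ d) (o := if d = true then some .endLayer else none) (runL_id () l₃)
    (by cases d <;> rfl)
  refine ⟨l₃, H3, ?_⟩
  have T := ((((t1.trans (t2 _ (by rw [H.length]; omega))).trans
    (t3 _ (by rw [H1.length]; omega))).trans (t4 _ (by rw [H2.length]; omega))).trans
    (t5 _ (by rw [H2.length]; omega))).trans (t6 _ (by rw [H3.length]; omega))
  convert T using 2
  have f0 : Track.init.run labs a = m.a := (Monitor.run_a Monitor.init labs a b).symm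
  rw [AddrSpec.describePair, relAt, ← hm, f0]
  have f1 : (b = 0 ∧ tbl[ℓ].src m.a = true) ↔ e₁ = true := by simp [he₁]
  rw [if_congr f1 rfl rfl, ← he₂]
  unfold describeNum
  cases e₁ <;> cases e₂ <;> cases d <;> simp

lemma inner_steps (ℓ : Fin tbl.length) {labs : List Lab} {a : ℕ} {l : List (Cell h)}
    (H : Rep Plain labs a 0 l) (ha : a < 2 ^ labs.length) (hB : labs.length + 1 ≤ B)
    (out : List Token) (b : ℕ) (hb : b < 2 ^ labs.length) :
    ∃ l', Rep Plain labs a b l' ∧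
      (writer h tbl).Steps n B
        ((writer h tbl).conf (check ℓ Monitor.init true true) (n + 1) l 1 out)
        ((writer h tbl).conf (check ℓ Monitor.init true true) (n + 1) l' 1
          (out ++ (List.range b).flatMap (tbl[ℓ].describePair labs a))) := by
  induction b with
  | zero => exact ⟨l, H, by simpa using Steps.refl _⟩
  | succ b ih =>
    obtain ⟨l₁, H1, t1⟩ := ih (by omega)
    obtain ⟨l₂, H2, t2⟩ := pair_steps (n := n) (B := B) ℓ H1 ha (by omega) hB (c := false)
      (d := false) (by simp; omega) (by simp; omega)
      (out ++ (List.range b).flatMap (tbl[ℓ].describePair labs a))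
    refine ⟨l₂, H2, t1.trans ?_⟩
    rw [List.range_succ, List.flatMap_append]
    simpa [next] using t2

/-- One value of the first address. -/
lemma row_steps (ℓ : Fin tbl.length) {labs : List Lab} {a : ℕ} {l : List (Cell h)}
    (H : Rep Plain labs a 0 l) (ha : a < 2 ^ labs.length) (hB : labs.length + 1 ≤ B) {d : Bool}
    (hd : d = decide (a + 1 = 2 ^ labs.length)) (out : List Token) :
    ∃ l', Rep Plain labs (a + 1) 0 l' ∧
      (writer h tbl).Steps n B
        ((writer h tbl).conf (check ℓ Monitor.init true true) (n + 1) l 1 out)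
        ((writer h tbl).conf (next ℓ d) (n + 1) l' 1
          (out ++ (List.range (2 ^ labs.length)).flatMap (tbl[ℓ].describePair labs a) ++
            if d = true then [.endLayer] else [])) := by
  obtain ⟨b, hb⟩ : ∃ b, 2 ^ labs.length = b + 1 :=
    ⟨2 ^ labs.length - 1, by have := Nat.two_pow_pos labs.length; omega⟩
  obtain ⟨l₁, H1, t1⟩ := inner_steps (n := n) (B := B) ℓ H ha hB out b (by omega)
  obtain ⟨l₂, H2, t2⟩ := pair_steps (n := n) (B := B) ℓ H1 ha (by omega) hB (c := true) (d := d)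
    (by simp; omega) (by simpa using hd)
    (out ++ (List.range b).flatMap (tbl[ℓ].describePair labs a))
  -- The second address has overflowed to 2^length, which the tape represents as 0.
  refine ⟨l₂, H2.congr rfl (by rw [← hb]; simp), t1.trans ?_⟩
  rw [hb, List.range_succ, List.flatMap_append]
  simpa using t2

lemma rows_steps (ℓ : Fin tbl.length) {labs : List Lab} {l : List (Cell h)}
    (H : Rep Plain labs 0 0 l) (hB : labs.length + 1 ≤ B) (out : List Token) (a : ℕ)
    (ha : a < 2 ^ labs.length) :
    ∃ l', Rep Plain labs a 0 l' ∧
      (writer h tbl).Steps n B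
        ((writer h tbl).conf (check ℓ Monitor.init true true) (n + 1) l 1 out)
        ((writer h tbl).conf (check ℓ Monitor.init true true) (n + 1) l' 1
          (out ++ (List.range a).flatMap fun v =>
            (List.range (2 ^ labs.length)).flatMap (tbl[ℓ].describePair labs v))) := by
  induction a with
  | zero => exact ⟨l, H, by simpa using Steps.refl _⟩
  | succ a ih =>
    obtain ⟨l₁, H1, t1⟩ := ih (by omega)
    obtain ⟨l₂, H2, t2⟩ := row_steps (n := n) (B := B) ℓ H1 (by omega) hB (d := false)
      (by simp; omega) (out ++ (List.range a).flatMap fun v =>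
            (List.range (2 ^ labs.length)).flatMap (tbl[ℓ].describePair labs v))
    refine ⟨l₂, H2, t1.trans ?_⟩
    rw [List.range_succ, List.flatMap_append]
    simpa [next] using t2

/-- One layer. -/
lemma layer_steps (ℓ : Fin tbl.length) {labs : List Lab} {l : List (Cell h)}
    (H : Rep Plain labs 0 0 l) (hB : labs.length + 1 ≤ B) (out : List Token) :
    ∃ l', Rep Plain labs 0 0 l' ∧
      (writer h tbl).Steps n B ((writer h tbl).conf (layer tbl ℓ) (n + 1) l 1 out)
        ((writer h tbl).conf (layer tbl (ℓ + 1)) (n + 1) l' 1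
          (out ++ (((List.range (2 ^ labs.length)).flatMap fun v =>
            (List.range (2 ^ labs.length)).flatMap (tbl[ℓ].describePair labs v)) ++
              [.endLayer]))) := by
  obtain ⟨a, ha⟩ : ∃ a, 2 ^ labs.length = a + 1 :=
    ⟨2 ^ labs.length - 1, by have := Nat.two_pow_pos labs.length; omega⟩
  obtain ⟨l₁, H1, t1⟩ := rows_steps (n := n) (B := B) ℓ H hB out a (by omega)
  obtain ⟨l₂, H2, t2⟩ := row_steps (n := n) (B := B) ℓ H1 (by omega) hB (d := true)
    (by simp; omega) (out ++ (List.range a).flatMap fun v =>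
            (List.range (2 ^ labs.length)).flatMap (tbl[ℓ].describePair labs v))
  have e : layer tbl ℓ = check ℓ Monitor.init true true := dif_pos ℓ.2
  refine ⟨l₂, H2.congr (by rw [← ha]; simp) rfl, ?_⟩
  rw [e]
  refine t1.trans ?_
  rw [show List.range (2 ^ labs.length) = List.range (a + 1) by rw [ha], List.range_succ,
    List.flatMap_append]
  rw [show List.range (2 ^ labs.length) = List.range a ++ [a] by rw [ha, List.range_succ]] at t2
  simpa [next] using t2

lemma layers_steps {labs : List Lab} {l : List (Cell h)} (H : Rep Plain labs 0 0 l)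
    (hB : labs.length + 1 ≤ B) (out : List Token) (k : ℕ) (hk : k ≤ tbl.length) :
    ∃ l', Rep Plain labs 0 0 l' ∧
      (writer h tbl).Steps n B ((writer h tbl).conf (layer tbl 0) (n + 1) l 1 out)
        ((writer h tbl).conf (layer tbl k) (n + 1) l' 1
          (out ++ (tbl.take k).flatMap fun s => (((List.range (2 ^ labs.length)).flatMap fun v =>
            (List.range (2 ^ labs.length)).flatMap (s.describePair labs v)) ++ [.endLayer]))) := by
  induction k with
  | zero => exact ⟨l, H, by simpa using Steps.refl _⟩
  | succ k ih =>
    obtain ⟨l₁, H1, t1⟩ := ih (by omega)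
    obtain ⟨l₂, H2, t2⟩ := layer_steps (n := n) (B := B) ⟨k, hk⟩ H1 hB _
    refine ⟨l₂, H2, t1.trans ?_⟩
    rw [List.take_succ_eq_append_getElem hk, List.flatMap_append, ← List.append_assoc]
    simp only [List.flatMap_singleton]
    exact t2

lemma bits_two_pow (k : ℕ) : (2 ^ k).bits = List.replicate k false ++ [true] := by
  induction k with
  | zero => simp
  | succ k ih =>
    have e : 2 ^ (k + 1) = Nat.bit false (2 ^ k) := by rw [Nat.bit_val, pow_succ']; simp
    rw [e, Nat.bits_append_bit _ _ fun h0 => absurd h0 (by positivity), ih]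
    rfl

lemma runR_pow (l : List (Cell h)) :
    runR (fun (a : Unit) c => (a, c, some (Token.bit false))) () l =
      ((), l, List.replicate l.length (Token.bit false)) := by
  induction l with
  | nil => rfl
  | cons c cs ih => simp [runR, ih, List.replicate_succ]

/-- The number of qubits. -/
lemma pow_steps {l : List (Cell h)} (hB : l.length + 1 ≤ B) :
    (writer h tbl).Steps n B ((writer h tbl).conf pow (n + 1) l 1 [])
      ((writer h tbl).conf (layer tbl 0) (n + 1) l 1 (describeNum (2 ^ l.length))) := by
  have t1 := pass_right (P := writer h tbl) (n := n) (B := B) (fun _ : Unit => pow)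
    (fun a c => (a, c, some (Token.bit false))) (fun _ => rfl) (fun _ => rfl) (fun _ _ => rfl)
    (ip := n + 1) le_rfl (s' := powEnd) (o := some (.bit true)) (runR_pow l) rfl [] hB
  have t2 := pass_left (P := writer h tbl) (n := n) (B := B) (fun _ : Unit => powEnd)
    (fun a c => (a, c)) (fun _ => rfl) (fun _ => rfl) (fun _ _ => rfl) (ip := n + 1) le_rfl
    (s' := layer tbl 0) (o := some .endNum) (runL_id () l) rfl
  convert t1.trans (t2 _ (by omega)) using 2
  simp [describeNum, bits_two_pow]

lemma Setup.rep {labs : List Lab} {q s : ℕ} {l : List (Cell h)} (H : Setup labs q s l) :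
    Rep Plain labs 0 0 l := by
  obtain ⟨rfl, -, -, H⟩ := H
  induction l with
  | nil => trivial
  | cons c cs ih =>
    obtain ⟨h1, h2⟩ := H c List.mem_cons_self
    exact ⟨rfl, ⟨h1, h2⟩, ih fun x hx => H x (List.mem_cons_of_mem _ hx)⟩

/-- The machine writes the description of the circuit, with little space. -/
theorem writer_outputs (h : ℕ) (tbl : List AddrSpec) (n : ℕ) :
    (writer h tbl).machine.Outputs n (describeNum (2 ^ (labels h n).length) ++
        tbl.flatMap fun s => ((List.range (2 ^ (labels h n).length)).flatMap fun v =>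
          (List.range (2 ^ (labels h n).length)).flatMap (s.describePair (labels h n) v)) ++
            [Token.endLayer]) ∧
      ∀ c, (writer h tbl).machine.Reachable n c → ∀ i, c.pos i ≤ (labels h n).length + 1 := by
  obtain ⟨l, q, S, t1⟩ := labels_steps (h := h) (tbl := tbl) (n := n) le_rfl
  have t2 := pow_steps (tbl := tbl) (n := n) (B := (labels h n).length + 1) (l := l)
    (by rw [S.length])
  obtain ⟨l', H, t3⟩ := layers_steps (tbl := tbl) (n := n) S.rep le_rfl
    (describeNum (2 ^ l.length)) tbl.length le_rfl
  rw [List.take_length, S.length] at t3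
  rw [S.length] at t2
  have e : layer tbl tbl.length = halt := dif_neg (lt_irrefl _)
  exact outputs_of_steps (P := writer h tbl) (by rw [e]; rfl) (by omega)
    ((t1.trans t2).trans t3)

end Sweeper

/-! ### The circuit families -/

lemma length_labels_le (h n : ℕ) :
    (labels h n).length + 1 ≤ (2 * h + 400) * (Nat.log 2 n + 1) := by
  have h1 : (labels h n).length = 2 * n.size + 13 + 2 * width h n := by
    have hp : ∀ w, (pairLabs w).length = 2 * w := by
      intro w; simp [pairLabs, mul_comm]
    have := le_width h n
    simp only [labels, constLabs, List.length_append, List.length_map, List.length_replicate, hp,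
      Nat.size_eq_bits_len, List.length_cons, List.length_nil]
    omega
  have h2 : n.size ≤ Nat.log 2 n + 1 :=
    Nat.size_le.2 (Nat.lt_pow_succ_log_self (by norm_num) n)
  have h3 := width_le h n
  have h4 := Nat.mul_le_mul_left h h2
  rw [h1]
  nlinarith

/-- The circuits for the Or gate; `h` determines the error. -/
def orFamily (h : ℕ) : Family where
  anc n := 2 ^ (labels h n).length - (n + 1)
  circ n := (labels_spec h n).circuit (qubits_eq h n)
  valid n := (labels_spec h n).circuit_valid (qubits_eq h n)

lemma orFamily_uniform (h : ℕ) : (orFamily h).Uniform := by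
  refine ⟨(writer h layerTable).machine, ⟨2 * h + 400, fun n c hc i => ?_⟩, fun n => ?_⟩
  · exact ((Sweeper.writer_outputs h layerTable n).2 c hc i).trans (length_labels_le h n)
  · have := (Sweeper.writer_outputs h layerTable n).1
    rwa [← (labels_spec h n).describe_circuit (qubits_eq h n)] at this

lemma orFamily_depth (h : ℕ) :
    (fun n => (((orFamily h).circ n).depth : ℝ)) =O[atTop] (fun _ : ℕ => (1 : ℝ)) := by
  have e : (fun n => (((orFamily h).circ n).depth : ℝ)) = fun _ => (51 : ℝ) := by
    funext n
    exact_mod_cast (labels_spec h n).circuit_depth (qubits_eq h n)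
  rw [e]
  exact isBigO_const_const _ one_ne_zero _

lemma orFamily_approx (c n : ℕ) (hn : 1 ≤ n) :
    ApproxOneSided angle ((orFamily (2 * (c + 1))).circ n) (orFun n) (1 / (n : ℝ) ^ (c + 1)) := by
  obtain ⟨i, hi⟩ := width_eq (2 * (c + 1)) n
  exact (labels_spec _ n).approx (qubits_eq _ n) rfl hi (two_mul_err_le c n hn)

lemma orFamily_size_poly (h : ℕ) : ∃ p : ℕ,
    (fun n => (((orFamily h).circ n).size : ℝ)) =O[atTop] (fun n : ℕ => (n : ℝ) ^ p) := by
  obtain ⟨C, p, hC⟩ := exists_poly_bound h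
  refine ⟨p, IsBigO.of_bound (51 * C) ?_⟩
  filter_upwards [eventually_ge_atTop 1] with n hn
  have h1 := ((labels_spec h n).circuit_size (qubits_eq h n)).trans
    (Nat.mul_le_mul_left 51 (hC n hn))
  rw [Real.norm_of_nonneg (by positivity), Real.norm_of_nonneg (by positivity), mul_assoc]
  exact_mod_cast h1

lemma orFamily_size_quadratic :
    (fun n => (((orFamily 2).circ n).size : ℝ)) =O[atTop]
      (fun n : ℕ => (n : ℝ) ^ 2 * Real.log n) := by
  obtain ⟨C, hC⟩ := exists_quadratic_bound
  refine IsBigO.of_bound (51 * C / Real.log 2) ?_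
  filter_upwards [eventually_ge_atTop 2] with n hn
  have h1 := ((labels_spec 2 n).circuit_size (qubits_eq 2 n)).trans
    (Nat.mul_le_mul_left 51 (hC n hn))
  have h2 : (Nat.log 2 n : ℝ) ≤ Real.log n / Real.log 2 := by
    have := Real.natLog_le_logb n 2
    simpa [Real.logb] using this
  have hlog : 0 ≤ Real.log n := Real.log_natCast_nonneg n
  rw [Real.norm_of_nonneg (by positivity), Real.norm_of_nonneg (by positivity)]
  calc (((orFamily 2).circ n).size : ℝ) ≤ 51 * (C * (n : ℝ) ^ 2 * Nat.log 2 n) := by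
        exact_mod_cast h1
    _ ≤ 51 * (C * (n : ℝ) ^ 2 * (Real.log n / Real.log 2)) := by gcongr
    _ = _ := by ring

end QCirc

theorem mainTheorem2 :
    ∃ θ : ℝ, Irrational (θ / Real.pi) ∧
      QCirc.RQNCf θ 0 QCirc.orFun ∧
      ∃ F : QCirc.Family, F.Uniform ∧
        (fun n => ((F.circ n).depth : ℝ)) =O[atTop] (fun _ : ℕ => (1 : ℝ)) ∧
        (fun n => ((F.circ n).size : ℝ)) =O[atTop]
          (fun n : ℕ => (n : ℝ) ^ 2 * Real.log n) ∧
        ∀ n, 1 ≤ n →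
          QCirc.ApproxOneSided θ (F.circ n) (QCirc.orFun n) (1 / (n : ℝ)) := by
  refine ⟨QCirc.angle, QCirc.irrational_angle, fun c => ?_, QCirc.orFamily 2,
    QCirc.orFamily_uniform 2, QCirc.orFamily_depth 2, QCirc.orFamily_size_quadratic,
    fun n hn => by simpa using QCirc.orFamily_approx 0 n hn⟩
  -- This parameter gives the error n^(-(c+1)), which is smaller than required; the case c = 0 is
  -- the family used for error 1/n.
  refine ⟨QCirc.orFamily (2 * (c + 1)), QCirc.orFamily_uniform _, ?_,
    QCirc.orFamily_size_poly _, fun n hn => ?_⟩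
  · simpa using QCirc.orFamily_depth (2 * (c + 1))
  · obtain ⟨h1, h2⟩ := QCirc.orFamily_approx c n hn
    refine ⟨h1, fun Ψ hΨ => le_trans ?_ (h2 Ψ hΨ)⟩
    have hn' : (1 : ℝ) ≤ n := by exact_mod_cast hn
    have : 1 / (n : ℝ) ^ (c + 1) ≤ 1 / (n : ℝ) ^ c :=
      one_div_le_one_div_of_le (by positivity) (pow_le_pow_right₀ hn' (Nat.le_succ c))
    linarith
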